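/- A propositional team-based logic $\mathcal L$ extends propositional logic by a set of additional atoms. Each atom $\alpha$ is written as a finite word and uses a finite tuple of variables; formulas are $\varphi ::= \top \mid \bot \mid x \mid \neg x \mid \alpha \mid \varphi\wedge\varphi \mid \varphi\vee\varphi$. A team over a finite set $D$ of variables is a set $T$ of assignments $D\to\{0,1\}$. The logic fixes the relation $T\models\alpha$ for atoms. Further, $T\models\top$ always; $T\models\bot$ iff $T=\emptyset$; $T\models x$ (resp. $\neg x$) iff $t(x)=1$ (resp. $t(x)=0$) for all $t\in T$; $T\models\varphi\wedge\psi$ iff $T\models\varphi$ and $T\models\psi$; and $T\models\varphi\vee\psi$ iff $T=T_1\cup T_2$ for some $T_1\models\varphi$, $T_2\models\psi$ (lax semantics), where in addition $T_1\cap T_2=\emptyset$ is required under strict semantics. The atoms of $\mathcal L$ are polynomial-time checkable if some Turing machine decides, given an atom $\alpha$ and a team $T$ whose domain contains the variables of $\alpha$, whether $T\models\alpha$, in time polynomial in the length of the input. An instance $x=\langle T,\varphi\rangle$ of model checking consists of an $\mathcal L$-formula $\varphi$ and a team $T$ over the set $\mathrm{Var}(\varphi)$ of its variables; the question is whether $T\models\varphi$.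 With respect to a parameter $\kappa$ the problem is FPT if a Turing machine decides every instance $x$ in at most $f(\kappa(x))\cdot p(|x|)$ steps, for a computable function $f$ and a polynomial $p$. The parameters are: * formula-team treewidth $\mathrm{tw}$: the treewidth of the Gaifman graph whose vertices are the subformulas and variables of $\varphi$ (the variable $x$ being identified with the formula $x$, which also counts as a subformula of $\neg x$) and the assignments in $T$; its edges join each formula to its immediate subformulas, each atom to its variables, any two variables of the same atom, and each assignment to each variable; * formula depth $d$: the depth of the binary syntax tree of $\varphi$, in which an atom with $n$ occurrences of variables is spelled out as a balanced binary tree with $n$ leaves, i.e. has depth $\lceil\log_2 n\rceil$ (and depth $0$ for $n=0$); constants and variables have depth $0$ and $\neg x$ has depth $1$; * number of variables $v=|\mathrm{Var}(\varphi)|$; * formula size $|\varphi|$: the number of occurrences of symbols in $\varphi$ (an atom with $n$ occurrences of variables counts $n+1$). **Theorem.** Let $\mathcal L$ be a propositional team-based logic whose atoms are polynomial-time checkable. Under lax as well as under strict semantics, model checking for $\mathcal L$ is FPT when parameterised by formula-team treewidth, by formula depth, by number of variables, or by formula size. Each of these parameters bounds the team size: for every instance, $$|T|\le 2^{\mathrm{tw}+1},\qquad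 |T|\le 2^{2^{d}},\qquad |T|\le 2^{v},\qquad |T|\le 2^{|\varphi|}.$$ If moreover all atoms of $\mathcal L$ have at most $r$ occurrences of variables, for a constant $r$, then the same holds for the depth $d_0$ of the syntax tree in which each atom is a single leaf: model checking parameterised by $d_0$ is FPT, and $|T|\le 2^{(r+1)2^{d_0}}$. -/

import Mathlib

namespace TeamSemantics

/-! ### Assignments, teams, logics, formulas -/

/-- Propositional variables are natural numbers; an assignment with (finite) variable domain `D`. -/
abbrev Assignment (D : Finset ℕ) : Type := {x : ℕ // x ∈ D} → Bool

/-- A team over `D`: a set of assignments with the common variable domain `D`. -/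
abbrev Team (D : Finset ℕ) : Type := Finset (Assignment D)

/-- The value of the variable `x` under `s`. (Below, `x` always lies in `D`; the value `false`
outside of `D` is never used.) -/
def Assignment.val {D : Finset ℕ} (s : Assignment D) (x : ℕ) : Bool :=
  if h : x ∈ D then s ⟨x, h⟩ else false

/-- A propositional team based logic extends propositional logic by a stock of additional atoms:
a set of atoms, each of them given by a finite word and using a finite tuple of variables, together
with the satisfaction relation `T ⊨ α` between teams and atoms. -/
structure TeamLogic where
  /-- the atoms of the logic -/
  Atom : Type
  /-- how an atom is written down -/
  word : Atom → List Bool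
  /-- different atoms are written differently -/
  word_injective : Function.Injective word
  /-- the variables of an atom, listed with repetition in the order of occurrence -/
  args : Atom → List ℕ
  /-- `T ⊨ α`, for a team `T` with domain `D` -/
  AtomSat : (D : Finset ℕ) → Team D → Atom → Prop

/-- Formulas of a team based logic. -/
inductive Formula (L : TeamLogic) : Type
  | top : Formula L
  | bot : Formula L
  | var (x : ℕ) : Formula L
  | neg (x : ℕ) : Formula L
  | atom (a : L.Atom) : Formula L
  | and (φ ψ : Formula L) : Formula L
  | or (φ ψ : Formula L) : Formula L

/-- The two semantics of the split-junction. -/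
inductive Semantics : Type
  | lax : Semantics
  | strict : Semantics

namespace Formula

variable {L : TeamLogic}

/-- The set of propositional variables that occur in a formula. -/
def vars : Formula L → Finset ℕ
  | top => ∅
  | bot => ∅
  | var x => {x}
  | neg x => {x}
  | atom a => (L.args a).toFinset
  | and φ ψ => vars φ ∪ vars ψ
  | or φ ψ => vars φ ∪ vars ψ

/-- Team semantics. Under the strict semantics the two parts of a split are disjoint. -/
def Sat (m : Semantics) {D : Finset ℕ} : Formula L → Team D → Prop
  | top, _ => True
  | bot, T => T = ∅
  | var x, T => ∀ t ∈ T, t.val x = true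
  | neg x, T => ∀ t ∈ T, t.val x = false
  | atom a, T => L.AtomSat D T a
  | and φ ψ, T => Sat m φ T ∧ Sat m ψ T
  | or φ ψ, T => ∃ T₁ T₂ : Team D, T₁ ∪ T₂ = T ∧ (m = Semantics.strict → Disjoint T₁ T₂) ∧
      Sat m φ T₁ ∧ Sat m ψ T₂

/-- Formula size: the number of occurrences of symbols (constants, variables, negations,
connectives, atom symbols). -/
def size : Formula L → ℕ
  | top => 1
  | bot => 1
  | var _ => 1
  | neg _ => 2
  | atom a => (L.args a).length + 1
  | and φ ψ => size φ + size ψ + 1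
  | or φ ψ => size φ + size ψ + 1

/-- The depth of the syntax tree, when each atom is a single leaf. -/
def leafDepth : Formula L → ℕ
  | top => 0
  | bot => 0
  | var _ => 0
  | neg _ => 1
  | atom _ => 0
  | and φ ψ => max (leafDepth φ) (leafDepth ψ) + 1
  | or φ ψ => max (leafDepth φ) (leafDepth ψ) + 1

/-- The depth of the binary syntax tree, when the tuple of variables of an atom is part of the
tree: an atom with `n` occurrences of variables is a balanced binary tree with these `n`
leaves, whose depth is `⌈log₂ n⌉`. -/
def depth : Formula L → ℕ
  | top => 0
  | bot => 0
  | var _ => 0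
  | neg _ => 1
  | atom a => Nat.clog 2 (L.args a).length
  | and φ ψ => max (depth φ) (depth ψ) + 1
  | or φ ψ => max (depth φ) (depth ψ) + 1

/-- `ImmediateSub ψ α`: the formula `α` is an immediate subformula of `ψ`. -/
def ImmediateSub : Formula L → Formula L → Prop
  | neg x, α => α = var x
  | and φ ψ, α => α = φ ∨ α = ψ
  | or φ ψ, α => α = φ ∨ α = ψ
  | _, _ => False

/-- The set of subformulas of a formula. -/
def subformulas : Formula L → Set (Formula L)
  | top => {top}
  | bot => {bot}
  | var x => {var x}
  | neg x => {neg x, var x}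
  | atom a => {atom a}
  | and φ ψ => {and φ ψ} ∪ (subformulas φ ∪ subformulas ψ)
  | or φ ψ => {or φ ψ} ∪ (subformulas φ ∪ subformulas ψ)

end Formula

/-! ### Treewidth -/

/-- Tree decompositions of a graph: a tree `tree` whose nodes are the bags in `bags`. -/
structure TreeDecomposition {V : Type} (G : SimpleGraph V) where
  bags : Finset (Finset V)
  tree : SimpleGraph {b : Finset V // b ∈ bags}
  isTree : tree.IsTree
  cover : ∀ v : V, ∃ b ∈ bags, v ∈ b
  edge : ∀ u v : V, G.Adj u v → ∃ b ∈ bags, u ∈ b ∧ v ∈ b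
  connected : ∀ v : V, (tree.induce {b | v ∈ b.1}).Connected

/-- The size of the largest bag minus one. -/
def TreeDecomposition.width {V : Type} {G : SimpleGraph V} (d : TreeDecomposition G) : ℕ :=
  d.bags.sup Finset.card - 1

/-- The treewidth of a (finite, non-empty) graph. -/
noncomputable def treewidth {V : Type} (G : SimpleGraph V) : ℕ :=
  sInf {w : ℕ | ∃ d : TreeDecomposition G, d.width = w}

/-! ### Instances of model checking and the graph of an instance -/

/-- An instance of the model checking problem: a formula, and a team over its variables. -/
structure MCInstance (L : TeamLogic) where
  formula : Formula L
  team : Team formula.vars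

namespace MCInstance

variable {L : TeamLogic}

/-- The positive instances `⟨T, φ⟩` of model checking: those with `T ⊨ φ`. -/
def Holds (m : Semantics) (x : MCInstance L) : Prop := x.formula.Sat m x.team

/-- The universe of the syntax structure: the subformulas and the variables of the formula (the
variable `x` is identified with the formula `x`), and the assignments of the team. -/
def carrier (x : MCInstance L) : Set (Formula L ⊕ Assignment x.formula.vars) :=
  {u | (∃ ψ ∈ x.formula.subformulas, u = Sum.inl ψ) ∨
    (∃ v ∈ x.formula.vars, u = Sum.inl (Formula.var v)) ∨
    (∃ s ∈ x.team, u = Sum.inr s)}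

/-- The binary relations of the syntax structure, on its universe. -/
inductive Related (x : MCInstance L) :
    Formula L ⊕ Assignment x.formula.vars → Formula L ⊕ Assignment x.formula.vars → Prop
  /-- immediate subformulas -/
  | sub (ψ α : Formula L) (h : ψ.ImmediateSub α) : Related x (Sum.inl ψ) (Sum.inl α)
  /-- an atom is linked to its variables -/
  | depAtom (a : L.Atom) (v : ℕ) (hv : v ∈ L.args a) :
      Related x (Sum.inl (Formula.atom a)) (Sum.inl (Formula.var v))
  /-- two variables of the same atom of the formula are linked -/
  | depVar (a : L.Atom) (ha : Formula.atom a ∈ x.formula.subformulas) (v w : ℕ)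
      (hv : v ∈ L.args a) (hw : w ∈ L.args a) :
      Related x (Sum.inl (Formula.var v)) (Sum.inl (Formula.var w))
  /-- the assignment `s` maps the variable `v` to 1 -/
  | isTrue (s : Assignment x.formula.vars) (v : ℕ) (hv : v ∈ x.formula.vars)
      (h : s.val v = true) : Related x (Sum.inr s) (Sum.inl (Formula.var v))
  /-- the assignment `s` maps the variable `v` to 0 -/
  | isFalse (s : Assignment x.formula.vars) (v : ℕ) (hv : v ∈ x.formula.vars)
      (h : s.val v = false) : Related x (Sum.inr s) (Sum.inl (Formula.var v))

/-- The Gaifman graph of an instance (symmetric, without loops). -/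
def gaifmanGraph (x : MCInstance L) : SimpleGraph {u // u ∈ x.carrier} :=
  SimpleGraph.fromRel fun u v => x.Related u.1 v.1

/-- The number of assignments in the team. -/
def teamSize (x : MCInstance L) : ℕ := x.team.card

/-- The treewidth of the Gaifman graph of formula and team. -/
noncomputable def formulaTeamTreewidth (x : MCInstance L) : ℕ := treewidth x.gaifmanGraph

/-- The number of distinct variables of the formula. -/
def variableCount (x : MCInstance L) : ℕ := x.formula.vars.card

end MCInstance

/-! ### Encodings as words over a finite alphabet -/

/-- The alphabet of the encodings. -/
inductive Letter : Type
  | bit (b : Bool) : Letter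
  | top : Letter
  | bot : Letter
  | var : Letter
  | neg : Letter
  | atom : Letter
  | and : Letter
  | or : Letter
  | row : Letter
  | sep : Letter

/-- Formulas in prefix notation, with variables in binary. -/
def encodeFormula {L : TeamLogic} : Formula L → List Letter
  | .top => [.top]
  | .bot => [.bot]
  | .var x => .var :: (Nat.bits x).map .bit
  | .neg x => .neg :: (Nat.bits x).map .bit
  | .atom a => .atom :: (L.word a).map .bit
  | .and φ ψ => .and :: (encodeFormula φ ++ encodeFormula ψ)
  | .or φ ψ => .or :: (encodeFormula φ ++ encodeFormula ψ)

/-- The sequence of values of an assignment, in the increasing order of the variables. -/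
def Assignment.values {D : Finset ℕ} (s : Assignment D) : List Bool :=
  (D.sort (· ≤ ·)).map s.val

/-- A team is a table: first the list of its variables, in binary and in increasing order, then its
rows (sequences of values), in lexicographic order. -/
def encodeTeam {D : Finset ℕ} (T : Team D) : List Letter :=
  (D.sort (· ≤ ·)).flatMap (fun x => .var :: (Nat.bits x).map .bit) ++
    ((T.image Assignment.values).sort (· ≤ ·)).flatMap (fun r => .row :: r.map .bit)

/-- The encoding of an instance of model checking. -/
def encodeMC {L : TeamLogic} (x : MCInstance L) : List Letter :=
  encodeFormula x.formula ++ .sep :: encodeTeam x.team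

/-! ### Polynomial time checkable atoms, and fixed parameter tractability -/

/-- An instance of atom checking: an atom and a team whose domain contains the variables
of the atom. -/
structure AtomInstance (L : TeamLogic) where
  atom : L.Atom
  dom : Finset ℕ
  team : Team dom
  args_mem : ∀ x ∈ L.args atom, x ∈ dom

/-- The encoding of an instance of atom checking. -/
def encodeAtomInstance {L : TeamLogic} (i : AtomInstance L) : List Letter :=
  (L.word i.atom).map .bit ++ .sep :: encodeTeam i.team

open Classical in
/-- The atoms of `L` are checkable in polynomial time: given an atom `α` and a team `T`, a Turing
machine decides in polynomial time whether `T ⊨ α`. -/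
def TeamLogic.AtomsPolyTimeCheckable (L : TeamLogic) : Prop :=
  Nonempty (Turing.TM2ComputableInPolyTime (encodeAtomInstance (L := L)) Computability.encodeBool
    fun i => decide (L.AtomSat i.dom i.team i.atom))

open Classical in
/-- The problem `Q`, on instances of type `I` that are encoded by `enc` as words over the alphabet
`Γ`, is fixed parameter tractable with respect to the parameter `κ`: a Turing machine decides
whether `Q x` in at most `f (κ x) * p |x|` steps, with `f` computable and `p` a polynomial. -/
def IsFPT {I Γ : Type} (enc : I → List Γ) (Q : I → Prop) (κ : I → ℕ) : Prop :=
  ∃ (M : Turing.TM2ComputableAux Γ Bool) (f : ℕ → ℕ) (p : Polynomial ℕ),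
    Computable f ∧ ∀ x : I, Nonempty (Turing.TM2OutputsInTime M.tm
      ((enc x).map M.inputAlphabet.invFun)
      (some ((Computability.encodeBool (decide (Q x))).map M.outputAlphabet.invFun))
      (f (κ x) * p.eval (enc x).length))

end TeamSemantics

namespace TeamSemantics
open Turing StateTransition

/-! The theorem splits into two independent halves: model checking takes time polynomial in `2 ^ |T|
* |x|`, and each parameter bounds `|T|` by a primitive recursive function.

Algorithm. Let `t = |T|`. A subteam is a mask, that is, a word of `t` bits, and there are only `2 ^
t` of them. For each subformula the table of all masks of subteams satisfying it is computed
bottom-up. Conjunction and both kinds of split are positionwise conditions on three masks, so a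
table comes from the two tables below it by trying all triples. For an atom, each subteam is handed
to the given polynomial time machine. The team satisfies the formula iff the mask without zeros is
in the last table (`mask_mem_tableOf`, `exists_mem_tableOf_iff`).

To obtain an actual Turing machine with a step count, the algorithm is written as a stack program
whose costs are tracked by `Exec`. `Exec.reaches` shows that the translation into a multi-stack
machine, in which the atom checker is embedded as an oracle, needs no more steps. `Exec.modelCheck`
gives the cost of the whole program, and `exists_machine` states it as a polynomial in `2 ^ t * (|x|
+ 1)`. As `p (a * b) ≤ a ^ deg p * p b`, the factor `2 ^ t` can be separated from the input length,
which yields the FPT bound (`isFPT_of_teamSize_le`).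

Team size. A team over `v` variables has at most `2 ^ v` members, and `v` is bounded through the
leaves of the syntax tree. For treewidth, each assignment is adjacent to each variable. In a tree
decomposition one side of a complete bipartite graph lies in a single bag
(`TreeDecomposition.exists_bag_superset`), so `t ≤ tw + 1` or `v ≤ tw + 1`; either way `t ≤ 2 ^ (tw
+ 1)`. -/

instance : Finite Letter := by
  refine Finite.of_injective (β := Bool ⊕ Fin 9) (fun a => match a with
    | .bit b => .inl b | .top => .inr 0 | .bot => .inr 1 | .var => .inr 2 | .neg => .inr 3
    | .atom => .inr 4 | .and => .inr 5 | .or => .inr 6 | .row => .inr 7 | .sep => .inr 8) ?_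
  rintro (_ | _ | _ | _ | _ | _ | _ | _ | _ | _) (_ | _ | _ | _ | _ | _ | _ | _ | _ | _) h <;>
    simp_all

/-! ### Programs over a fixed family of stacks, with an oracle -/

/-- The names of the stacks. -/
inductive Stack : Type
  | input | tokens | vars | rows | masks | tables
  | maskTmp | maskRev | mask
  | left | leftTmp | leftRev | leftWord
  | right | rightTmp | rightRev | rightWord
  | fail | found | result | name | nameRev | flags | flagsTmp | query
  deriving DecidableEq

instance : Fintype Stack where
  elems := {.input, .tokens, .vars, .rows, .masks, .tables, .maskTmp, .maskRev, .mask, .left,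
    .leftTmp, .leftRev, .leftWord, .right, .rightTmp, .rightRev, .rightWord, .fail, .found,
    .result, .name, .nameRev, .flags, .flagsTmp, .query}
  complete k := by cases k <;> decide

/-- The contents of all stacks; the head of a list is the top of the stack. -/
def Store : Type := Stack → List Letter

namespace Store

/-- The store with empty stacks. -/
def empty : Store := fun _ => []

/-- The content of a stack. -/
def get (S : Store) (k : Stack) : List Letter := S k

/-- Replaces the content of a stack. -/
def set (S : Store) (k : Stack) (l : List Letter) : Store := Function.update S k l

@[simp] theorem get_empty (k : Stack) : empty.get k = [] := rfl

theorem get_set (S : Store) (k j : Stack) (l : List Letter) :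
    (S.set k l).get j = if j = k then l else S.get j := by
  by_cases h : j = k
  · subst h; simpa only [get, set, if_true] using Function.update_self _ _ _
  · simp only [get, set, if_neg h]
    exact Function.update_of_ne h _ _

theorem get_injective {S S' : Store} (h : ∀ k, S.get k = S'.get k) : S = S' := funext h

@[simp] theorem get_set_self (S : Store) (k : Stack) (l : List Letter) :
    (S.set k l).get k = l := by simp [get_set]

@[simp] theorem set_empty (k : Stack) : empty.set k [] = empty :=
  get_injective fun j => by simp [get_set]

theorem get_set_of_ne (S : Store) {k j : Stack} (h : j ≠ k) (l : List Letter) :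
    (S.set k l).get j = S.get j := by simp [get_set, h]

@[simp] theorem set_set (S : Store) (k : Stack) (l l' : List Letter) :
    (S.set k l).set k l' = S.set k l' :=
  get_injective fun j => by simp only [get_set]; split_ifs <;> rfl

theorem set_comm (S : Store) {k j : Stack} (h : k ≠ j) (l l' : List Letter) :
    (S.set k l).set j l' = (S.set j l').set k l :=
  get_injective fun i => by
    simp only [get_set]; split_ifs with h1 h2 <;> first | rfl | (subst h1; exact absurd h2.symm h)

theorem set_get (S : Store) (k : Stack) : S.set k (S.get k) = S :=
  get_injective fun j => by
    simp only [get_set]; split_ifs with h <;> simp_all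

end Store

/-- Structured stack programs. `pop k f` pops from `k` and continues with `f`; `loop k b f` pops
from `k` until the stack is empty or a letter in `b` was popped, and runs `f` on each other
letter; `ask k f` consumes `k` as a question to the oracle and continues with `f`. -/
inductive Prog : Type
  | nop : Prog
  | push (k : Stack) (a : Letter) : Prog
  | pop (k : Stack) (f : Option Letter → Prog) : Prog
  | seq (p q : Prog) : Prog
  | loop (k : Stack) (b : Letter → Bool) (f : Letter → Prog) : Prog
  | ask (k : Stack) (f : Bool → Prog) : Prog

infixr:60 " ;; " => Prog.seq

/-- An oracle: the answers to questions, with the time that they take. -/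
abbrev Oracle : Type := List Letter → Bool → ℕ → Prop

/-- `Exec O p S S' n`: the program `p` leads from `S` to `S'` in at most `n` steps. -/
inductive Exec (O : Oracle) : Prog → Store → Store → ℕ → Prop
  | nop (S) : Exec O .nop S S 1
  | push (k a S) : Exec O (.push k a) S (S.set k (a :: S.get k)) 1
  | pop {k f S S' n} : Exec O (f (S.get k).head?) (S.set k (S.get k).tail) S' n →
      Exec O (.pop k f) S S' (n + 1)
  | seq {p q S S' S'' n m} : Exec O p S S' n → Exec O q S' S'' m →
      Exec O (p ;; q) S S'' (n + m)
  | loop_nil {k b f S} : S.get k = [] → Exec O (.loop k b f) S S 1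
  | loop_halt {k b f S a l} : S.get k = a :: l → b a = true →
      Exec O (.loop k b f) S (S.set k l) 1
  | loop_cons {k b f S S' S'' a l n m} : S.get k = a :: l → b a = false →
      Exec O (f a) (S.set k l) S' n → Exec O (.loop k b f) S' S'' m →
      Exec O (.loop k b f) S S'' (n + m + 1)
  | ask {k f S S' c t n} : O (S.get k).reverse c t → Exec O (f c) (S.set k []) S' n →
      Exec O (.ask k f) S S' ((S.get k).length + t + n + 2)
  | mono {p S S' n m} : Exec O p S S' n → n ≤ m → Exec O p S S' m

/-! ### Translation of programs to Turing machines -/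

/-- The control positions inside a program, when the oracle machine has the labels `Λ`. -/
inductive Prog.Labels (Λ : Type) : Prog → Type
  | nop : Labels Λ .nop
  | push {k a} : Labels Λ (.push k a)
  | pop {k f} : Labels Λ (.pop k f)
  | popBody {k f} (o : Option Letter) (l : Labels Λ (f o)) : Labels Λ (.pop k f)
  | seqLeft {p q} (l : Labels Λ p) : Labels Λ (.seq p q)
  | seqRight {p q} (l : Labels Λ q) : Labels Λ (.seq p q)
  | loop {k b f} : Labels Λ (.loop k b f)
  | loopBody {k b f} (a : Letter) (l : Labels Λ (f a)) : Labels Λ (.loop k b f)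
  | feed {k f} : Labels Λ (.ask k f)
  | run {k f} (l : Λ) : Labels Λ (.ask k f)
  | read {k f} : Labels Λ (.ask k f)
  | askBody {k f} (c : Bool) (l : Labels Λ (f c)) : Labels Λ (.ask k f)

/-- Programs branch only on letters and bits, so each has finitely many continuations. This
finiteness is what makes `Prog.machine` a machine with finitely many labels. -/
theorem Prog.finite_labels (Λ : Type) [Finite Λ] (p : Prog) : Finite (p.Labels Λ) := by
  induction p with
  | nop => exact Finite.of_surjective (fun _ : Unit => Labels.nop) fun | .nop => ⟨(), rfl⟩
  | push k a => exact Finite.of_surjective (fun _ : Unit => Labels.push) fun | .push => ⟨(), rfl⟩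
  | pop k f ih =>
    exact Finite.of_surjective (α := Unit ⊕ Σ o, (f o).Labels Λ)
      (Sum.elim (fun _ => .pop) fun l => .popBody l.1 l.2) fun
        | .pop => ⟨.inl (), rfl⟩
        | .popBody o l => ⟨.inr ⟨o, l⟩, rfl⟩
  | seq p q hp hq =>
    exact Finite.of_surjective (α := p.Labels Λ ⊕ q.Labels Λ)
      (Sum.elim .seqLeft .seqRight) fun
        | .seqLeft l => ⟨.inl l, rfl⟩
        | .seqRight l => ⟨.inr l, rfl⟩
  | loop k b f ih =>
    exact Finite.of_surjective (α := Unit ⊕ Σ a, (f a).Labels Λ)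
      (Sum.elim (fun _ => .loop) fun l => .loopBody l.1 l.2) fun
        | .loop => ⟨.inl (), rfl⟩
        | .loopBody o l => ⟨.inr ⟨o, l⟩, rfl⟩
  | ask k f ih =>
    exact Finite.of_surjective (α := Unit ⊕ Unit ⊕ Λ ⊕ Σ c, (f c).Labels Λ)
      (Sum.elim (fun _ => .feed) (Sum.elim (fun _ => .read)
        (Sum.elim .run fun l => .askBody l.1 l.2))) fun
        | .feed => ⟨.inl (), rfl⟩
        | .read => ⟨.inr (.inl ()), rfl⟩
        | .run l => ⟨.inr (.inr (.inl l)), rfl⟩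
        | .askBody o l => ⟨.inr (.inr (.inr ⟨o, l⟩)), rfl⟩

/-- The first control position of a program. -/
def Prog.entry (Λ : Type) : (p : Prog) → p.Labels Λ
  | .nop => .nop
  | .push _ _ => .push
  | .pop _ _ => .pop
  | .seq p _ => .seqLeft (p.entry Λ)
  | .loop _ _ _ => .loop
  | .ask _ _ => .feed

section Compile

variable (N : TM2ComputableAux Letter Bool)

/-- The stack alphabets: the own stacks, and those of the oracle machine. -/
abbrev Alphabet : Stack ⊕ N.tm.K → Type
  | .inl _ => Letter
  | .inr k => N.tm.Γ k

/-- The internal states: those of the oracle machine, and the last letter read. -/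
abbrev Control : Type := N.tm.σ × Option Letter

variable {N} {Λ' : Type}

/-- Statements of the oracle machine as statements of the large machine, which go to `e` instead
of halting. -/
def liftStmt (ι : N.tm.Λ → Λ') (e : Λ') :
    TM2.Stmt N.tm.Γ N.tm.Λ N.tm.σ → TM2.Stmt (Alphabet N) Λ' (Control N)
  | .push k f q => .push (.inr k) (fun v => f v.1) (liftStmt ι e q)
  | .peek k f q => .peek (.inr k) (fun v o => (f v.1 o, v.2)) (liftStmt ι e q)
  | .pop k f q => .pop (.inr k) (fun v o => (f v.1 o, v.2)) (liftStmt ι e q)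
  | .load f q => .load (fun v => (f v.1, v.2)) (liftStmt ι e q)
  | .branch f q r => .branch (fun v => f v.1) (liftStmt ι e q) (liftStmt ι e r)
  | .goto l => .goto fun v => ι (l v.1)
  | .halt => .goto fun _ => e

/-- The machine code at a position of a program, when the positions are embedded by `ι` into the
labels of a machine that goes to `e` at the end. -/
def Prog.Labels.code : {p : Prog} → p.Labels N.tm.Λ → (p.Labels N.tm.Λ → Λ') → Λ' →
    TM2.Stmt (Alphabet N) Λ' (Control N)
  | _, .nop, _, e => .goto fun _ => e
  | _, .push (k := k) (a := a), _, e => .push (.inl k) (fun _ => a) (.goto fun _ => e)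
  | _, .pop (k := k) (f := f), ι, _ => .pop (.inl k) (fun v o => (v.1, o))
      (.goto fun v => ι (.popBody v.2 ((f v.2).entry _)))
  | _, .popBody o l, ι, e => l.code (fun l => ι (.popBody o l)) e
  | _, .seqLeft (q := q) l, ι, _ => l.code (fun l => ι (.seqLeft l)) (ι (.seqRight (q.entry _)))
  | _, .seqRight l, ι, e => l.code (fun l => ι (.seqRight l)) e
  | _, .loop (k := k) (b := b) (f := f), ι, e => .pop (.inl k) (fun v o => (v.1, o))
      (.goto fun v => match v.2 with
        | none => e
        | some a => if b a then e else ι (.loopBody a ((f a).entry _)))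
  | _, .loopBody a l, ι, _ => l.code (fun l => ι (.loopBody a l)) (ι .loop)
  | _, .feed (k := k), ι, _ => .pop (.inl k) (fun v o => (v.1, o))
      (.branch (fun v => v.2.isSome)
        (.push (.inr N.tm.k₀) (fun v => N.inputAlphabet.symm (v.2.getD .top))
          (.goto fun _ => ι .feed))
        (.load (fun _ => (N.tm.initialState, none)) (.goto fun _ => ι (.run N.tm.main))))
  | _, .run l, ι, _ => liftStmt (fun l => ι (.run l)) (ι .read) (N.tm.m l)
  | _, .read (f := f), ι, e =>
      .pop (.inr N.tm.k₁) (fun v o => (v.1, o.map fun y => .bit (N.outputAlphabet y)))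
        (.goto fun v => match v.2 with
          | some (.bit c) => ι (.askBody c ((f c).entry _))
          | _ => e)
  | _, .askBody c l, ι, e => l.code (fun l => ι (.askBody c l)) e

/-- Contents of all stacks of the large machine. -/
def joinStacks (S : Store) (s : ∀ k, List (N.tm.Γ k)) : ∀ k, List (Alphabet N k)
  | .inl k => S.get k
  | .inr k => s k

/-- Stacks of the oracle machine that are empty up to one. -/
def single (k : N.tm.K) (l : List (N.tm.Γ k)) : ∀ k, List (N.tm.Γ k) :=
  Function.update (fun _ => []) k l

theorem joinStacks_set (S : Store) (s : ∀ k, List (N.tm.Γ k)) (k : Stack) (l : List Letter) :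
    Function.update (joinStacks (N := N) S s) (.inl k) l = joinStacks (S.set k l) s := by
  funext j
  rcases j with j | j
  · by_cases h : j = k
    · subst h; simp [joinStacks]
    · rw [Function.update_of_ne (by simpa using h)]
      simp [joinStacks, Store.get_set, h]
  · rw [Function.update_of_ne (by simp)]; rfl

theorem joinStacks_update (S : Store) (s : ∀ k, List (N.tm.Γ k)) (k : N.tm.K)
    (l : List (N.tm.Γ k)) :
    Function.update (joinStacks (N := N) S s) (.inr k) l
      = joinStacks S (Function.update s k l) := by
  funext j
  rcases j with j | j
  · rw [Function.update_of_ne (by simp)]; rfl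
  · by_cases h : j = k
    · subst h; simp [joinStacks]
    · rw [Function.update_of_ne (by simpa using h)]
      simp [joinStacks, h]

/-- Reachability in at most `n` steps. -/
def Reaches {σ : Type} (f : σ → Option σ) (a b : σ) (n : ℕ) : Prop :=
  Nonempty (EvalsToInTime f a (some b) n)

theorem Reaches.refl {σ : Type} (f : σ → Option σ) (a : σ) : Reaches f a a 0 :=
  ⟨EvalsToInTime.refl f a⟩

theorem Reaches.trans {σ : Type} {f : σ → Option σ} {a b c : σ} {n m : ℕ}
    (h : Reaches f a b n) (h' : Reaches f b c m) : Reaches f a c (n + m) := by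
  obtain ⟨h⟩ := h
  obtain ⟨h'⟩ := h'
  exact ⟨by rw [add_comm]; exact EvalsToInTime.trans f _ _ a b _ h h'⟩

theorem Reaches.mono {σ : Type} {f : σ → Option σ} {a b : σ} {n m : ℕ}
    (h : Reaches f a b n) (hnm : n ≤ m) : Reaches f a b m := by
  obtain ⟨h⟩ := h
  exact ⟨⟨h.toEvalsTo, h.steps_le_m.trans hnm⟩⟩

theorem Reaches.single {σ : Type} {f : σ → Option σ} {a b : σ} (h : f a = some b) :
    Reaches f a b 1 := ⟨⟨⟨1, h⟩, le_rfl⟩⟩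

theorem Reaches.head {σ : Type} {f : σ → Option σ} {a b c : σ} {n : ℕ} (h : f a = some b)
    (h' : Reaches f b c n) : Reaches f a c (n + 1) := by
  rw [add_comm]; exact (Reaches.single h).trans h'

/-- Configurations of the oracle machine inside the large machine. -/
def liftCfg (ι : N.tm.Λ → Λ') (e : Λ') (S : Store) (o : Option Letter)
    (c : TM2.Cfg N.tm.Γ N.tm.Λ N.tm.σ) : TM2.Cfg (Alphabet N) Λ' (Control N) :=
  ⟨some (c.l.elim e ι), (c.var, o), joinStacks S c.stk⟩

/-- Lifted code touches only the stacks and the state component of the oracle machine, so the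
simulation is step by step; halting has become a jump to `e`. -/
theorem stepAux_liftStmt (ι : N.tm.Λ → Λ') (e : Λ') (S : Store) (o : Option Letter)
    (q : TM2.Stmt N.tm.Γ N.tm.Λ N.tm.σ) (v : N.tm.σ) (s : ∀ k, List (N.tm.Γ k)) :
    TM2.stepAux (liftStmt ι e q) (v, o) (joinStacks S s)
      = liftCfg ι e S o (TM2.stepAux q v s) := by
  induction q generalizing v s with
  | push k f q ih =>
    simp only [liftStmt, TM2.stepAux]
    rw [← ih, ← joinStacks_update]; rfl
  | peek k f q ih =>
    simp only [liftStmt, TM2.stepAux]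
    rw [← ih]; rfl
  | pop k f q ih =>
    simp only [liftStmt, TM2.stepAux]
    rw [← ih, ← joinStacks_update]; rfl
  | load f q ih => simp only [liftStmt, TM2.stepAux]; rw [← ih]
  | branch f q r hq hr =>
    simp only [liftStmt, TM2.stepAux]
    cases f v <;> simp [hq, hr]
  | goto l => rfl
  | halt => rfl

theorem reaches_liftCfg {M : Λ' → TM2.Stmt (Alphabet N) Λ' (Control N)} (ι : N.tm.Λ → Λ')
    (e : Λ') (hM : ∀ l, M (ι l) = liftStmt ι e (N.tm.m l)) (S : Store) (o : Option Letter)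
    (n : ℕ) (a b : TM2.Cfg N.tm.Γ N.tm.Λ N.tm.σ)
    (h : (flip bind (TM2.step N.tm.m))^[n] (some a) = some b) :
    Reaches (TM2.step M) (liftCfg ι e S o a) (liftCfg ι e S o b) n := by
  induction n generalizing a with
  | zero =>
    obtain rfl : a = b := by simpa using h
    exact Reaches.refl _ _
  | succ n ih =>
    rw [Function.iterate_succ_apply] at h
    rcases a with ⟨_ | l, v, s⟩
    -- A halted configuration has no successor, so it cannot reach `b` in a positive number of
    -- steps.
    · have h0 : ∀ n, (flip bind (TM2.step N.tm.m))^[n] none = none := by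
        intro n
        induction n with
        | zero => rfl
        | succ n ih => rw [Function.iterate_succ_apply]; exact ih
      change (flip bind (TM2.step N.tm.m))^[n] none = _ at h
      rw [h0] at h
      exact absurd h (by simp)
    · refine Reaches.head ?_ (ih (TM2.stepAux (N.tm.m l) v s) h)
      simp only [liftCfg, Option.elim, TM2.step, hM]
      rw [stepAux_liftStmt]; rfl

end Compile

/-- The oracle that is given by a Turing machine. -/
def machineOracle (N : TM2ComputableAux Letter Bool) : Oracle := fun l c t =>
  Nonempty (TM2OutputsInTime N.tm (l.map N.inputAlphabet.invFun)
    (some ((Computability.encodeBool c).map N.outputAlphabet.invFun)) t)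

theorem initList_stk (tm : FinTM2) (l : List (tm.Γ tm.k₀)) :
    initList tm l = ⟨some tm.main, tm.initialState, Function.update (fun _ => []) tm.k₀ l⟩ := by
  unfold initList
  congr 1
  funext k
  by_cases h : k = tm.k₀
  · subst h; simp
  · simp [h]

theorem haltList_stk (tm : FinTM2) (l : List (tm.Γ tm.k₁)) :
    haltList tm l = ⟨none, tm.initialState, Function.update (fun _ => []) tm.k₁ l⟩ := by
  unfold haltList
  congr 1
  funext k
  by_cases h : k = tm.k₁
  · subst h; simp
  · simp [h]

/-- Popping from one stack and pushing to another reverses a word; hence the oracle sees the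
reversed content in `Exec.ask`. The word `s` that was already transferred is kept general for the
induction. -/
theorem reaches_feed {N : TM2ComputableAux Letter Bool} {Λ' : Type}
    {M : Λ' → TM2.Stmt (Alphabet N) Λ' (Control N)} {k : Stack} {f : Bool → Prog}
    (ι : (Prog.ask k f).Labels N.tm.Λ → Λ') (e : Λ')
    (hM : ∀ l, M (ι l) = l.code ι e) (l : List Letter) (S : Store)
    (hS : S.get k = l) (s : List Letter) (v : Control N) :
    Reaches (TM2.step M)
      ⟨some (ι .feed), v,
        joinStacks S (single N.tm.k₀ (s.map N.inputAlphabet.symm))⟩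
      ⟨some (ι (.run N.tm.main)), (N.tm.initialState, none),
        joinStacks (S.set k [])
          (single N.tm.k₀ ((l.reverse ++ s).map N.inputAlphabet.symm))⟩ (l.length + 1) := by
  induction l generalizing S s v with
  | nil =>
    refine Reaches.single ?_
    simp only [TM2.step, hM, Prog.Labels.code, TM2.stepAux]
    simp only [joinStacks, hS]
    change some (TM2.Cfg.mk _ _ (Function.update (joinStacks S _) _ _)) = _
    rw [joinStacks_set]
    rfl
  | cons a l ih =>
    refine Reaches.head ?_ (by
      simpa using ih (S.set k l) (by simp) (a :: s) (v.1, some a))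
    simp only [TM2.step, hM, Prog.Labels.code, TM2.stepAux]
    simp only [joinStacks, hS]
    change some (TM2.Cfg.mk _ _ (Function.update (Function.update (joinStacks S _) _ _) _ _)) = _
    rw [joinStacks_set, joinStacks_update]
    simp [single, joinStacks]

/-- Induction on the execution. The invariant is that all oracle stacks are empty before and after
each program, so that the oracle can be asked again; the control state may be arbitrary, because
feeding the oracle resets it. -/
theorem Exec.reaches {N : TM2ComputableAux Letter Bool} {p : Prog} {S S' : Store} {n : ℕ}
    (h : Exec (machineOracle N) p S S' n) {Λ' : Type}
    (M : Λ' → TM2.Stmt (Alphabet N) Λ' (Control N)) (ι : p.Labels N.tm.Λ → Λ') (e : Λ')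
    (hM : ∀ l, M (ι l) = l.code ι e) (v : Control N) :
    ∃ v', Reaches (TM2.step M) ⟨some (ι (p.entry _)), v, joinStacks S fun _ => []⟩
      ⟨some e, v', joinStacks S' fun _ => []⟩ n := by
  induction h generalizing e v with
  | nop S => exact ⟨v, Reaches.single (by simp only [TM2.step, hM]; rfl)⟩
  | push k a S =>
    refine ⟨v, Reaches.single ?_⟩
    simp only [TM2.step, hM]
    rw [← joinStacks_set]; rfl
  | @pop k f S S' n _ ih =>
    obtain ⟨v', h⟩ := ih (fun l => ι (.popBody _ l)) e (fun l => hM (.popBody _ l))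
      (v.1, (S.get k).head?)
    refine ⟨v', Reaches.head ?_ h⟩
    simp only [TM2.step, Prog.entry, hM, Prog.Labels.code, TM2.stepAux]
    rw [← joinStacks_set]; rfl
  | @seq p q S S' S'' n m _ _ ihp ihq =>
    obtain ⟨v', h⟩ := ihp (fun l => ι (.seqLeft l)) (ι (.seqRight (q.entry _))) (fun l => hM (.seqLeft l)) v
    obtain ⟨v'', h'⟩ := ihq (fun l => ι (.seqRight l)) e (fun l => hM (.seqRight l)) v'
    exact ⟨v'', h.trans h'⟩
  | @loop_nil k b f S hS =>
    refine ⟨(v.1, none), Reaches.single ?_⟩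
    simp only [TM2.step, Prog.entry, hM, Prog.Labels.code, TM2.stepAux]
    simp only [joinStacks, hS]
    rw [joinStacks_set]
    simp only [List.head?_nil, List.tail_nil]
    rw [← hS, Store.set_get]
  | @loop_halt k b f S a l hS hb =>
    refine ⟨(v.1, some a), Reaches.single ?_⟩
    simp only [TM2.step, Prog.entry, hM, Prog.Labels.code, TM2.stepAux]
    simp only [joinStacks, hS]
    rw [joinStacks_set]
    simp [hb]
  | @loop_cons k b f S S' S'' a l n m hS hb _ _ ih₁ ih₂ =>
    obtain ⟨v', h⟩ := ih₁ (fun l => ι (.loopBody _ l)) (ι .loop) (fun l => hM (.loopBody _ l))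
      (v.1, some a)
    obtain ⟨v'', h'⟩ := ih₂ ι e hM v'
    refine ⟨v'', Reaches.head ?_ (h.trans h')⟩
    simp only [TM2.step, Prog.entry, hM, Prog.Labels.code, TM2.stepAux]
    simp only [joinStacks, hS]
    rw [joinStacks_set]
    simp [hb]
  | @ask k f S S' c t n hO _ ih =>
    obtain ⟨⟨s, hsteps⟩, hle⟩ := hO
    have h₁ := reaches_feed ι e hM _ S rfl [] v
    rw [Option.map_some, initList_stk, haltList_stk] at hsteps
    have h₂ := (reaches_liftCfg (M := M) (fun l => ι (.run l))
      (ι .read) (fun l => hM (.run l)) (S.set k []) none _ _ _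
      hsteps).mono hle
    obtain ⟨v', h₃⟩ := ih (fun l => ι (.askBody _ l)) e (fun l => hM (.askBody _ l))
      (N.tm.initialState, some (.bit c))
    refine ⟨v', ?_⟩
    -- The answer is a single letter on the output stack of the oracle, so popping it leaves all
    -- oracle stacks empty.
    have h₄ := Reaches.head (f := TM2.step M)
      (a := liftCfg (fun l => ι (.run l)) (ι .read) (S.set k [])
        none (⟨none, N.tm.initialState, Function.update (fun _ => []) N.tm.k₁
          ((Computability.encodeBool c).map N.outputAlphabet.invFun)⟩)) (by
      simp only [liftCfg, Option.elim, TM2.step, hM, Prog.Labels.code, TM2.stepAux]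
      rw [joinStacks_update]
      simp only [joinStacks, Computability.encodeBool]
      simp) h₃
    have h₁' : Reaches (TM2.step M)
        ⟨some (ι ((Prog.ask k f).entry _)), v, joinStacks S fun _ => []⟩
        (liftCfg (fun l => ι (.run l)) (ι .read) (S.set k []) none
          ⟨some N.tm.main, N.tm.initialState, Function.update (fun _ => []) N.tm.k₀
            ((S.get k).reverse.map N.inputAlphabet.invFun)⟩) ((S.get k).length + 1) := by
      convert! h₁ using 2
      · simp [single]
      · simp [single, liftCfg]
    -- The word length plus one for feeding, `t` for the oracle, one for reading the answer, and `n`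
    -- for the continuation.
    exact ((h₁'.trans h₂).trans h₄).mono (by omega)
  | mono _ hnm ih =>
    obtain ⟨v', h⟩ := ih ι e hM v
    exact ⟨v', h.mono hnm⟩

/-- The Turing machine that runs a program and outputs whether the stack `found` is non-empty. -/
noncomputable def Prog.machine (N : TM2ComputableAux Letter Bool) (p : Prog) :
    TM2ComputableAux Letter Bool where
  tm :=
    haveI : Finite N.tm.Λ := @Finite.of_fintype _ N.tm.ΛFin
    haveI : Finite N.tm.σ := @Finite.of_fintype _ N.tm.σFin
    haveI := p.finite_labels N.tm.Λ
    haveI := N.tm.kFin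
    { K := Stack ⊕ N.tm.K
      k₀ := .inl .input
      k₁ := .inr N.tm.k₁
      Γ := Alphabet N
      Λ := Option (p.Labels N.tm.Λ)
      main := some (p.entry _)
      ΛFin := Fintype.ofFinite _
      σ := Control N
      initialState := (N.tm.initialState, none)
      σFin := Fintype.ofFinite _
      Γk₀Fin := Fintype.ofFinite Letter
      m := fun l => match l with
        | some l => l.code some none
        | none => .pop (.inl .found) (fun v o => (v.1, o))
            (.push (.inr N.tm.k₁) (fun v => N.outputAlphabet.symm v.2.isSome)
              (.load (fun _ => (N.tm.initialState, none)) .halt)) }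
  inputAlphabet := Equiv.refl _
  outputAlphabet := N.outputAlphabet

theorem joinStacks_empty {N : TM2ComputableAux Letter Bool} :
    (joinStacks Store.empty fun _ => []) = fun k : Stack ⊕ N.tm.K => ([] : List (Alphabet N k)) := by
  funext j
  rcases j with j | j
  · rfl
  · rfl

theorem Prog.machine_haltList (N : TM2ComputableAux Letter Bool) (p : Prog)
    (l : List (N.tm.Γ N.tm.k₁)) :
    haltList (p.machine N).tm l
      = (⟨none, (N.tm.initialState, none), joinStacks .empty (single N.tm.k₁ l)⟩ :
        TM2.Cfg (Alphabet N) (Option (p.Labels N.tm.Λ)) (Control N)) := by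
  refine (haltList_stk (p.machine N).tm l).trans ?_
  change (⟨none, (N.tm.initialState, none),
    Function.update (fun _ => []) (Sum.inr N.tm.k₁) l⟩ :
        TM2.Cfg (Alphabet N) (Option (p.Labels N.tm.Λ)) (Control N)) = _
  rw [single, ← joinStacks_update, joinStacks_empty]

theorem Prog.machine_initList (N : TM2ComputableAux Letter Bool) (p : Prog) (l : List Letter) :
    initList (p.machine N).tm l
      = (⟨some (some (p.entry _)), (N.tm.initialState, none),
          joinStacks (Store.empty.set .input l) fun _ => []⟩ :
        TM2.Cfg (Alphabet N) (Option (p.Labels N.tm.Λ)) (Control N)) := by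
  refine (initList_stk (p.machine N).tm l).trans ?_
  change (⟨some (some (p.entry _)), (N.tm.initialState, none),
    Function.update (fun _ => []) (Sum.inl Stack.input) l⟩ :
        TM2.Cfg (Alphabet N) (Option (p.Labels N.tm.Λ)) (Control N)) = _
  rw [← joinStacks_empty, joinStacks_set]

/-- `haltList` requires every stack except the output to be empty. Hence the program has to end with
at most one letter on `found` and nothing elsewhere. The extra step turns `found` into the output
bit. -/
theorem Prog.machine_outputs (N : TM2ComputableAux Letter Bool) (p : Prog) (l : List Letter)
    (c : Bool) (n : ℕ)
    (h : Exec (machineOracle N) p (Store.empty.set .input l)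
      (Store.empty.set .found (if c then [.top] else [])) n) :
    Nonempty (TM2OutputsInTime (p.machine N).tm (l.map (p.machine N).inputAlphabet.invFun)
      (some ((Computability.encodeBool c).map (p.machine N).outputAlphabet.invFun)) (n + 1)) := by
  let M : Option (p.Labels N.tm.Λ) → TM2.Stmt (Alphabet N) (Option (p.Labels N.tm.Λ)) (Control N) :=
    (p.machine N).tm.m
  obtain ⟨v, h⟩ := h.reaches M some none (fun l => rfl) (N.tm.initialState, none)
  have h' := h.trans (Reaches.single (f := TM2.step M) (b := ⟨none, (N.tm.initialState, none),
      joinStacks .empty (single N.tm.k₁ [N.outputAlphabet.symm c])⟩) (by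
    change some (TM2.stepAux (M none) _ _) = _
    simp only [M, Prog.machine, TM2.stepAux]
    congr 2
    change Function.update (Function.update (joinStacks _ _) _ _) _ _ = _
    rw [joinStacks_set, joinStacks_update]
    simp only [joinStacks, Store.get_set_self]
    cases c <;> simp [single]))
  have hl : l.map (p.machine N).inputAlphabet.invFun = l := List.map_id l
  have h₁ := (congrArg (initList (p.machine N).tm) hl).trans (p.machine_initList N l)
  have h₂ := p.machine_haltList N [N.outputAlphabet.symm c]
  obtain ⟨⟨⟨s, hs⟩, hle⟩⟩ := h'
  exact ⟨⟨⟨s, (congrArg (fun c => (flip bind (TM2.step M))^[s] (some c)) h₁).trans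
    (hs.trans (congrArg some h₂.symm))⟩, hle⟩⟩

end TeamSemantics

namespace TeamSemantics

/-! ### Basic routines -/

variable {O : Oracle}

theorem Exec.cast {p : Prog} {S S' S'' : Store} {n m : ℕ} (h : Exec O p S S' n) (hS : S' = S'')
    (hn : n ≤ m) : Exec O p S S'' m := hS ▸ h.mono hn

theorem Exec.conv {p : Prog} {S₀ S S' S'' : Store} {n m : ℕ} (h : Exec O p S S' n) (hS₀ : S₀ = S)
    (hS : S' = S'') (hn : n ≤ m) : Exec O p S₀ S'' m := hS₀ ▸ h.cast hS hn

/-- Some rounds of the loop `loop k b f` lead from `S` to `S'` in at most `n` steps. -/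
def Iter (O : Oracle) (k : Stack) (b : Letter → Bool) (f : Letter → Prog) (S S' : Store)
    (n : ℕ) : Prop :=
  ∀ S'' m, Exec O (.loop k b f) S' S'' m → Exec O (.loop k b f) S S'' (n + m)

namespace Iter

variable {k : Stack} {b : Letter → Bool} {f : Letter → Prog} {S S' S'' : Store} {n m : ℕ}

theorem refl : Iter O k b f S S 0 := fun _ _ h => h.mono (by omega)

theorem trans (h : Iter O k b f S S' n) (h' : Iter O k b f S' S'' m) :
    Iter O k b f S S'' (n + m) := fun _ _ h'' => (h _ _ (h' _ _ h'')).mono (by omega)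

theorem cast (h : Iter O k b f S S' n) (hS : S' = S'') (hn : n ≤ m) : Iter O k b f S S'' m :=
  fun _ _ h'' => (h _ _ (hS ▸ h'')).mono (by omega)

theorem step {a : Letter} {l : List Letter} (hS : S.get k = a :: l) (hb : b a = false)
    (h : Exec O (f a) (S.set k l) S' n) : Iter O k b f S S' (n + 1) :=
  fun _ _ h' => (Exec.loop_cons hS hb h h').mono (by omega)

theorem exec (h : Iter O k b f S S' n) (hS : S'.get k = []) :
    Exec O (.loop k b f) S S' (n + 1) := h _ _ (.loop_nil hS)

theorem exec_halt {a : Letter} {l : List Letter} (h : Iter O k b f S S' n)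
    (hS : S'.get k = a :: l) (hb : b a = true) :
    Exec O (.loop k b f) S (S'.set k l) (n + 1) := h _ _ (.loop_halt hS hb)

/-- `st d l` is the store when the items `d` are done and `l` remain. An item may take several
rounds of the loop, which is why the hypothesis is an `Iter` and not a single execution of the body.
-/
theorem list {ι : Type} (st : List ι → List ι → Store) (c : ℕ) (ws : List ι)
    (h : ∀ d x l, d ++ x :: l = ws → Iter O k b f (st d (x :: l)) (st (d ++ [x]) l) c) :
    Iter O k b f (st [] ws) (st ws []) (ws.length * c) := by
  suffices H : ∀ l d, d ++ l = ws → Iter O k b f (st d l) (st ws []) (l.length * c) from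
    H ws [] rfl
  intro l
  induction l with
  | nil => rintro d rfl; simpa using refl
  | cons x l ih =>
    intro d hd
    refine ((h d x l hd).trans (ih (d ++ [x]) (by simpa using hd))).cast rfl ?_
    simp only [List.length_cons]
    ring_nf; rfl

end Iter

/-- A loop without exit letters. -/
abbrev Prog.each (k : Stack) (f : Letter → Prog) : Prog := .loop k (fun _ => false) f

/-- Moves the content of a stack on top of another one, in reversed order. -/
def Prog.move (k j : Stack) : Prog := .each k fun a => .push j a

/-- Empties a stack. -/
def Prog.clear (k : Stack) : Prog := .each k fun _ => .nop

theorem Exec.move {k j : Stack} (hkj : k ≠ j) (S : Store) :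
    Exec O (.move k j) S ((S.set j ((S.get k).reverse ++ S.get j)).set k [])
      (2 * (S.get k).length + 1) := by
  generalize hl : S.get k = l
  induction l generalizing S with
  | nil =>
    refine (Exec.loop_nil hl).cast ?_ (by simp)
    simp only [List.reverse_nil, List.nil_append, Store.set_get]
    rw [← hl, Store.set_get]
  | cons a l ih =>
    refine (Exec.loop_cons hl rfl (.push j a _) (ih _ ?_)).cast ?_ ?_
    · rw [Store.get_set_of_ne _ hkj, Store.get_set_self]
    · rw [Store.get_set_self, Store.set_set, Store.get_set_of_ne _ hkj.symm,
        Store.set_comm _ hkj, Store.set_set]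
      simp
    · simp; omega

theorem Exec.clear (k : Stack) (S : Store) :
    Exec O (.clear k) S (S.set k []) (2 * (S.get k).length + 1) := by
  generalize hl : S.get k = l
  induction l generalizing S with
  | nil =>
    refine (Exec.loop_nil hl).cast ?_ (by simp)
    rw [← hl, Store.set_get]
  | cons a l ih =>
    refine (Exec.loop_cons hl rfl (.nop _) (ih _ (Store.get_set_self _ _ _))).cast ?_ ?_
    · rw [Store.set_set]
    · simp; omega

/-! ### Words and tables on stacks -/

/-- A word of bits as a list of letters. -/
abbrev bits (w : List Bool) : List Letter := w.map .bit

/-- A list of words, each of which is terminated by the letter `sep`. -/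
def encodeWords (ws : List (List Bool)) : List Letter := ws.flatMap fun w => bits w ++ [.sep]

@[simp] theorem encodeWords_nil : encodeWords [] = [] := rfl

@[simp] theorem encodeWords_cons (w : List Bool) (ws : List (List Bool)) :
    encodeWords (w :: ws) = bits w ++ .sep :: encodeWords ws := by simp [encodeWords]

@[simp] theorem encodeWords_append (ws us : List (List Bool)) :
    encodeWords (ws ++ us) = encodeWords ws ++ encodeWords us := by simp [encodeWords]

theorem length_encodeWords_le {g : ℕ} {ws : List (List Bool)} (h : ∀ w ∈ ws, w.length ≤ g) :
    (encodeWords ws).length ≤ ws.length * (g + 1) := by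
  induction ws with
  | nil => simp
  | cons w ws ih =>
    have h₁ := ih fun v hv => h v (List.mem_cons_of_mem _ hv)
    have h₂ := h w List.mem_cons_self
    simp only [encodeWords_cons, List.length_append, List.length_map, List.length_cons]
    rw [Nat.add_mul]
    omega

/-- Runs `body` for each word on the stack `k`, which is handed over on the stack `r`. The stacks
`t` and `w` are auxiliary. -/
def Prog.forWords (k t w r : Stack) (body : Prog) : Prog :=
  .each k (fun a => .push t a ;; match a with
    | .bit b => .push w (.bit b)
    | _ => .move w r ;; body) ;;
  .move t k

theorem Iter.forWords_bits {k t w r : Stack} {body : Prog} (hkt : k ≠ t) (hkw : k ≠ w)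
    (htw : t ≠ w) (x : List Bool) (l : List Letter) (S : Store) (hS : S.get k = bits x ++ l) :
    Iter O k (fun _ => false) (fun a => .push t a ;; match a with
      | .bit b => .push w (.bit b)
      | _ => .move w r ;; body) S
      (((S.set k l).set t ((bits x).reverse ++ S.get t)).set w ((bits x).reverse ++ S.get w))
      (3 * x.length) := by
  induction x generalizing S with
  | nil =>
    refine Iter.refl.cast ?_ (by simp)
    simp only [List.map_nil, List.nil_append] at hS
    refine Store.get_injective fun j => ?_
    simp only [Store.get_set]
    split_ifs with h₁ h₂ h₃
    · subst h₁; simp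
    · subst h₂; simp
    · subst h₃; exact hS
    · rfl
  | cons b x ih =>
    refine ((Iter.step (l := bits x ++ l) (a := .bit b) (by simpa using hS) rfl
      (.seq (.push _ _ _) (.push _ _ _))).trans (ih _ ?_)).cast ?_ (by simp; omega)
    · rw [Store.get_set_of_ne _ hkw, Store.get_set_of_ne _ hkt, Store.get_set_self]
    · refine Store.get_injective fun j => ?_
      simp only [Store.get_set, hkt.symm, hkw.symm, htw.symm, if_false, if_true]
      split_ifs <;> simp

/-- `st d` is the store after the words `d`, up to the stacks `k` and `t`. The words already read
pile up on `t` in reversed order, and the final move restores `k`. The body has to leave `r` empty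
for the next word. -/
theorem Exec.forWords {k t w r : Stack} {body : Prog} (hkt : k ≠ t) (hkw : k ≠ w) (hkr : k ≠ r)
    (htw : t ≠ w) (htr : t ≠ r) (hwr : w ≠ r) (ws : List (List Bool)) (c g : ℕ)
    (hg : ∀ x ∈ ws, x.length ≤ g) (st : List (List Bool) → Store)
    (ht : ∀ d, (st d).get t = []) (hw : ∀ d, (st d).get w = []) (hr : ∀ d, (st d).get r = [])
    (hbody : ∀ d x l, d ++ x :: l = ws →
      Exec O body
        ((((st d).set k (encodeWords l)).set t (encodeWords (d ++ [x])).reverse).set r (bits x))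
        (((st (d ++ [x])).set k (encodeWords l)).set t (encodeWords (d ++ [x])).reverse) c) :
    Exec O (.forWords k t w r body) ((st []).set k (encodeWords ws))
      ((st ws).set k (encodeWords ws)) (ws.length * (c + 7 * g + 8) + 2) := by
  have hloop := Iter.list (O := O) (k := k) (b := fun _ => false)
    (f := fun a => .push t a ;; match a with
      | .bit b => .push w (.bit b)
      | _ => .move w r ;; body)
    (fun d l => ((st d).set k (encodeWords l)).set t (encodeWords d).reverse)
    -- Per word: three steps per letter to collect it, two per letter to turn it round onto `r`, and
    -- `c` for the body.
    (c + 5 * g + 4) ws (by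
      intro d x l hd
      have hx : x.length ≤ g := hg x (by rw [← hd]; simp)
      have e₁ := (Iter.forWords_bits (O := O) (r := r) (body := body) hkt hkw htw x
        (.sep :: encodeWords l)
        (((st d).set k (encodeWords (x :: l))).set t (encodeWords d).reverse)
        (by simp [Store.get_set, hkt])).cast (S'' := (((st d).set k (.sep :: encodeWords l)).set t
          ((bits x).reverse ++ (encodeWords d).reverse)).set w (bits x).reverse) (by
        refine Store.get_injective fun j => ?_
        simp only [Store.get_set, hkw.symm, htw.symm, if_false, if_true, hw]
        split_ifs <;> simp) le_rfl
      have e₂ := (Exec.push (O := O) t .sep (((((st d).set k (.sep :: encodeWords l)).set t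
          ((bits x).reverse ++ (encodeWords d).reverse)).set w (bits x).reverse).set k
          (encodeWords l))).cast (S'' := (((st d).set k (encodeWords l)).set t
            (encodeWords (d ++ [x])).reverse).set w (bits x).reverse) (by
        refine Store.get_injective fun j => ?_
        simp only [Store.get_set, hkt.symm, htw, if_false, if_true]
        split_ifs <;> simp_all) le_rfl
      have e₃ := (Exec.move (O := O) hwr ((((st d).set k (encodeWords l)).set t
            (encodeWords (d ++ [x])).reverse).set w (bits x).reverse)).cast
            (m := 2 * x.length + 1) (S'' := (((st d).set k (encodeWords l)).set t
            (encodeWords (d ++ [x])).reverse).set r (bits x)) (by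
        refine Store.get_injective fun j => ?_
        simp only [Store.get_set, hkr.symm, htr.symm, hwr.symm, if_false, if_true, hr]
        split_ifs <;> simp_all) (by simp)
      exact (e₁.trans (Iter.step (by simp [Store.get_set, hkt, hkw]) rfl
        (.seq e₂ (.seq e₃ (hbody d x l hd))))).cast rfl (by omega))
  have hlen := length_encodeWords_le hg
  refine (Exec.seq ((hloop.cast rfl le_rfl).exec ?_) (.move hkt.symm _)).conv ?_ ?_ ?_
  · simp [Store.get_set, hkt]
  · refine Store.get_injective fun j => ?_
    simp only [Store.get_set]
    split_ifs <;> simp_all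
  · refine Store.get_injective fun j => ?_
    simp only [Store.get_set]
    split_ifs <;> simp_all
  · simp only [Store.get_set_self, List.length_reverse]
    nlinarith

theorem Exec.pop_some {k : Stack} {f : Option Letter → Prog} {S S' : Store} {n : ℕ} {a : Letter}
    {l : List Letter} (hS : S.get k = a :: l) (h : Exec O (f (some a)) (S.set k l) S' n) :
    Exec O (.pop k f) S S' (n + 1) := .pop (by simpa [hS] using h)

theorem Exec.pop_none {k : Stack} {f : Option Letter → Prog} {S S' : Store} {n : ℕ}
    (hS : S.get k = []) (h : Exec O (f none) S S' n) :
    Exec O (.pop k f) S S' (n + 1) := .pop (by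
      have : S.set k [] = S := by rw [← hS, Store.set_get]
      simpa [hS, this] using h)

/-! ### Combination of tables -/

/-- The number of positions at which `c` fails. -/
def failures (c : Bool → Bool → Bool → Bool) : List Bool → List Bool → List Bool → ℕ
  | x :: xs, y :: ys, z :: zs => failures c xs ys zs + if c x y z then 0 else 1
  | _, _, _ => 0

theorem failures_le (c : Bool → Bool → Bool → Bool) (xs ys zs : List Bool) :
    failures c xs ys zs ≤ ys.length := by
  induction ys generalizing xs zs with
  | nil => cases xs <;> simp [failures]
  | cons y ys ih =>
    rcases xs with _ | ⟨x, xs⟩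
    · simp [failures]
    rcases zs with _ | ⟨z, zs⟩
    · simp [failures]
    have := ih xs zs
    simp only [failures, List.length_cons]
    split_ifs <;> omega

/-- Pushes a letter, if there is one. -/
def Prog.pushOption (k : Stack) : Option Letter → Prog
  | none => .nop
  | some a => .push k a

/-- Whether the condition `c` holds for the bits that were read. -/
def checkBits (c : Bool → Bool → Bool → Bool) : Option Letter → Letter → Option Letter → Bool
  | some (.bit x), .bit y, some (.bit z) => c x y z
  | _, _, _ => true

/-- One round of the comparison. -/
def Prog.compareBody (c : Bool → Bool → Bool → Bool) (a : Letter) : Prog :=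
  .push .rightRev a ;; .pop .mask fun z => .pop .leftWord fun x =>
    .pushOption .maskRev z ;; .pushOption .leftRev x ;;
      bif checkBits c x a z then .nop else .push .fail .top

/-- Pushes a letter on `found` if the words on `leftWord`, `rightWord` and `mask` satisfy `c` at
each position. -/
def Prog.compare (c : Bool → Bool → Bool → Bool) : Prog :=
  .each .rightWord (.compareBody c) ;; .move .rightRev .rightWord ;; .move .maskRev .mask ;;
    .move .leftRev .leftWord ;;
    .pop .fail fun
      | none => .push .found .top
      | some _ => .clear .fail

theorem Iter.compareBody (c : Bool → Bool → Bool → Bool) (xs ys zs : List Bool) (S : Store)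
    (hx : S.get .leftWord = bits xs) (hy : S.get .rightWord = bits ys) (hz : S.get .mask = bits zs)
    (hxy : xs.length = ys.length) (hzy : zs.length = ys.length) :
    Iter O .rightWord (fun _ => false) (.compareBody c) S
      (((((((S.set .leftWord []).set .rightWord []).set .mask []).set
        .leftRev ((bits xs).reverse ++ S.get .leftRev)).set
        .rightRev ((bits ys).reverse ++ S.get .rightRev)).set
        .maskRev ((bits zs).reverse ++ S.get .maskRev)).set
        .fail (List.replicate (failures c xs ys zs) .top ++ S.get .fail)) (8 * ys.length) := by
  induction ys generalizing xs zs S with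
  | nil =>
    obtain rfl : xs = [] := by simpa using hxy
    obtain rfl : zs = [] := by simpa using hzy
    refine Iter.refl.cast (Store.get_injective fun j => ?_) (by simp)
    cases j <;> simp [Store.get_set, failures, hx, hy, hz]
  | cons y ys ih =>
    rcases xs with _ | ⟨x, xs⟩
    · simp at hxy
    rcases zs with _ | ⟨z, zs⟩
    · simp at hzy
    have hlast (S : Store) : Exec O (bif c x y z then .nop else .push .fail .top) S
        (S.set .fail (List.replicate (if c x y z then 0 else 1) .top ++ S.get .fail)) 1 := by
      cases c x y z
      · exact Exec.push _ _ _
      · refine (Exec.nop S).cast ?_ le_rfl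
        simp [Store.set_get]
    refine ((Iter.step (a := .bit y) (l := bits ys) hy rfl (.seq (.push _ _ _)
      (.pop_some (a := .bit z) (l := bits zs) ?_ (.pop_some (a := .bit x) (l := bits xs) ?_
          (.seq (.push _ _ _) (.seq (.push _ _ _) (hlast _))))))).trans (ih xs zs _ ?_ ?_ ?_
      (by simpa using hxy) (by simpa using hzy))).cast (Store.get_injective fun j => ?_)
      (by simp; omega)
    iterate 5 simp [Store.get_set, hx, hz]
    cases j <;> simp [Store.get_set, failures, -List.replicate_append_replicate, List.replicate_add]

/-- `fail` is a unary counter of the bad positions. The three words are consumed into their reversed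
copies and moved back, so that they can be compared again. -/
theorem Exec.compare (c : Bool → Bool → Bool → Bool) (xs ys zs : List Bool) (S : Store)
    (hx : S.get .leftWord = bits xs) (hy : S.get .rightWord = bits ys) (hz : S.get .mask = bits zs)
    (hxy : xs.length = ys.length) (hzy : zs.length = ys.length) (hl : S.get .leftRev = [])
    (hr : S.get .rightRev = []) (hm : S.get .maskRev = []) (hf : S.get .fail = []) :
    Exec O (.compare c) S (S.set .found
      (List.replicate (if failures c xs ys zs = 0 then 1 else 0) .top ++ S.get .found))
      (20 * ys.length + 20) := by
  have hfail := failures_le c xs ys zs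
  have hlast (S : Store)
      (hS : S.get .fail = List.replicate (failures c xs ys zs) .top) :
      Exec O (.pop .fail fun
      | none => .push .found .top
      | some _ => .clear .fail) S
      ((S.set .fail []).set .found
        (List.replicate (if failures c xs ys zs = 0 then 1 else 0) .top ++ S.get .found))
      (2 * ys.length + 2) := by
    rcases h : failures c xs ys zs with _ | k
    · simp only [h, List.replicate_zero] at hS
      refine (Exec.pop_none hS (.push _ _ _)).cast (Store.get_injective fun j => ?_)
        (by omega)
      cases j <;> simp [Store.get_set, hS]
    · simp only [h, List.replicate_succ] at hS
      refine (Exec.pop_some hS (.clear _ _)).cast (Store.get_injective fun j => ?_) ?_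
      · cases j <;> simp [Store.get_set]
      · simp; omega
  refine (Exec.seq ((Iter.compareBody (O := O) c xs ys zs S hx hy hz hxy hzy).exec (by
    simp [Store.get_set])) (.seq (.move (by decide) _) (.seq (.move (by decide) _)
    (.seq (.move (by decide) _) (hlast _ ?_))))).cast (Store.get_injective fun j => ?_) ?_
  · simp [Store.get_set, hf]
  · cases j <;> simp [Store.get_set, hl, hr, hm, hf, hx, hy, hz]
  · simp [Store.get_set, hl, hr, hm, hxy, hzy]; omega

theorem replicate_append_left_comm {α : Type} (m n : ℕ) (a : α) (l : List α) :
    List.replicate m a ++ (List.replicate n a ++ l)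
      = List.replicate n a ++ (List.replicate m a ++ l) := by
  rw [← List.append_assoc, ← List.append_assoc, List.replicate_append_replicate,
    List.replicate_append_replicate, Nat.add_comm]

/-- For each word on `right`, pushes a letter on `found` if the words on `leftWord` and `mask`
satisfy `c` together with it. -/
def Prog.searchRight (c : Bool → Bool → Bool → Bool) : Prog :=
  .forWords .right .rightTmp .rightRev .rightWord (.compare c ;; .clear .rightWord)

/-- For each pair of words on `left` and `right`, pushes a letter on `found` if the word on `mask`
satisfies `c` together with them. -/
def Prog.searchLeft (c : Bool → Bool → Bool → Bool) : Prog :=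
  .forWords .left .leftTmp .leftRev .leftWord (.searchRight c ;; .clear .leftWord)

/-- The number of `ys` that fit to `x` and `z`. -/
def matches₁ (c : Bool → Bool → Bool → Bool) (x : List Bool) (ys : List (List Bool))
    (z : List Bool) : ℕ := ys.countP fun y => failures c x y z = 0

/-- The number of pairs from `xs` and `ys` that fit to `z`. -/
def matches₂ (c : Bool → Bool → Bool → Bool) (xs ys : List (List Bool)) (z : List Bool) : ℕ :=
  (xs.map fun x => matches₁ c x ys z).sum

/-- `found` counts matches in unary instead of storing a flag: the count is additive over the words,
so the loop invariant is simply the count for the words read so far. -/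
theorem Exec.searchRight (c : Bool → Bool → Bool → Bool) (t : ℕ) (x : List Bool)
    (ys : List (List Bool)) (z : List Bool) (S : Store)
    (hx : S.get .leftWord = bits x) (hy : S.get .right = encodeWords ys)
    (hz : S.get .mask = bits z) (hxt : x.length = t) (hyt : ∀ y ∈ ys, y.length = t)
    (hzt : z.length = t) (hl : S.get .leftRev = []) (hr : S.get .rightRev = [])
    (hm : S.get .maskRev = []) (hf : S.get .fail = []) (hrt : S.get .rightTmp = [])
    (hrw : S.get .rightWord = []) :
    Exec O (.searchRight c) S
      (S.set .found (List.replicate (matches₁ c x ys z) .top ++ S.get .found))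
      (ys.length * (29 * t + 29) + 2) := by
  refine (Exec.forWords (by decide) (by decide) (by decide) (by decide) (by decide) (by decide) ys
    (22 * t + 21) t (fun y hy => (hyt y hy).le) (fun d => (S.set .right []).set .found
      (List.replicate (matches₁ c x d z) .top ++ S.get .found))
    (fun d => by simp [Store.get_set, hrt]) (fun d => by simp [Store.get_set, hr])
    (fun d => by simp [Store.get_set, hrw]) (fun d y l hd => ?_)).conv
      (Store.get_injective fun j => ?_) (Store.get_injective fun j => ?_) ?_
  · have hyt' : y.length = t := hyt y (by rw [← hd]; simp)
    refine (Exec.seq (.compare c x y z _ ?_ ?_ ?_ (by omega) (by omega) ?_ ?_ ?_ ?_)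
      (.clear _ _)).cast (Store.get_injective fun j => ?_) ?_
    iterate 7 simp [Store.get_set, hx, hz, hl, hr, hm, hf]
    · cases j <;> simp [Store.get_set, hrw, matches₁, List.countP_append, List.countP_cons,
        -List.replicate_append_replicate, List.replicate_add]
      exact replicate_append_left_comm _ _ _ _
    · simp [Store.get_set, hyt']; omega
  · cases j <;> simp [Store.get_set, matches₁, hy]
  · cases j <;> simp [Store.get_set, hy]
  · ring_nf; omega

theorem Exec.searchLeft (c : Bool → Bool → Bool → Bool) (t : ℕ) (xs ys : List (List Bool))
    (z : List Bool) (S : Store)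
    (hx : S.get .left = encodeWords xs) (hy : S.get .right = encodeWords ys)
    (hz : S.get .mask = bits z) (hxt : ∀ x ∈ xs, x.length = t) (hyt : ∀ y ∈ ys, y.length = t)
    (hzt : z.length = t) (hl : S.get .leftRev = []) (hr : S.get .rightRev = [])
    (hm : S.get .maskRev = []) (hf : S.get .fail = []) (hrt : S.get .rightTmp = [])
    (hrw : S.get .rightWord = []) (hlt : S.get .leftTmp = []) (hlw : S.get .leftWord = []) :
    Exec O (.searchLeft c) S
      (S.set .found (List.replicate (matches₂ c xs ys z) .top ++ S.get .found))
      (xs.length * (ys.length * (29 * t + 29) + 9 * t + 11) + 2) := by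
  refine (Exec.forWords (by decide) (by decide) (by decide) (by decide) (by decide) (by decide) xs
    (ys.length * (29 * t + 29) + 2 * t + 3) t (fun y hy => (hxt y hy).le) (fun d =>
      (S.set .left []).set .found (List.replicate (matches₂ c d ys z) .top ++ S.get .found))
    (fun d => by simp [Store.get_set, hlt]) (fun d => by simp [Store.get_set, hl])
    (fun d => by simp [Store.get_set, hlw]) (fun d x l hd => ?_)).conv
      (Store.get_injective fun j => ?_) (Store.get_injective fun j => ?_) ?_
  · have hxt' : x.length = t := hxt x (by rw [← hd]; simp)
    refine (Exec.seq (.searchRight c t x ys z _ ?_ ?_ ?_ hxt' hyt hzt ?_ ?_ ?_ ?_ ?_ ?_)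
      (.clear _ _)).cast (Store.get_injective fun j => ?_) ?_
    iterate 9 simp [Store.get_set, hy, hz, hl, hr, hm, hf, hrt, hrw]
    · cases j <;> simp [Store.get_set, hlw, matches₂,
        -List.replicate_append_replicate, List.replicate_add]
      exact replicate_append_left_comm _ _ _ _
    · simp [Store.get_set, hxt']; omega
  · cases j <;> simp [Store.get_set, matches₂, hx]
  · cases j <;> simp [Store.get_set, hx]
  · ring_nf; omega

/-- Appends the word on `mask` to the words on `result`, which are in reversed order. -/
def Prog.emit : Prog := .move .mask .result ;; .push .result .sep

/-- Empties `found`, and emits the word on `mask` if `found` was not empty. -/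
def Prog.emitIfFound : Prog :=
  .pop .found fun
    | none => .clear .mask
    | some _ => .clear .found ;; .emit

/-- Stores the words on `result` as a new table. -/
def Prog.store : Prog := .push .tables .row ;; .move .result .tables

/-- Replaces the tables on `left` and `right` by the table of all masks that satisfy `c` together
with some of their words. -/
def Prog.combine (c : Bool → Bool → Bool → Bool) : Prog :=
  .forWords .masks .maskTmp .maskRev .mask (.searchLeft c ;; .emitIfFound) ;;
    .clear .left ;; .clear .right ;; .store

/-- The words among `zs` that satisfy `c` together with some words from `xs` and `ys`. -/
def combineTables (c : Bool → Bool → Bool → Bool) (xs ys zs : List (List Bool)) :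
    List (List Bool) := zs.filter fun z => matches₂ c xs ys z ≠ 0

theorem Exec.emit (z : List Bool) (zs : List (List Bool)) (S : Store) (hz : S.get .mask = bits z)
    (hr : S.get .result = (encodeWords zs).reverse) :
    Exec O .emit S ((S.set .mask []).set .result (encodeWords (zs ++ [z])).reverse)
      (2 * z.length + 2) := by
  refine (Exec.seq (.move (by decide) _) (.push _ _ _)).cast (Store.get_injective fun j => ?_) ?_
  · cases j <;> simp [Store.get_set, hz, hr]
  · simp [hz]

theorem Exec.emitIfFound (k : ℕ) (z : List Bool) (zs : List (List Bool)) (S : Store)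
    (hz : S.get .mask = bits z) (hf : S.get .found = List.replicate k .top)
    (hr : S.get .result = (encodeWords zs).reverse) :
    Exec O .emitIfFound S (((S.set .mask []).set .found []).set .result
      (encodeWords (zs ++ if k ≠ 0 then [z] else [])).reverse) (2 * k + 2 * z.length + 4) := by
  rcases k with _ | k
  · refine (Exec.pop_none (by simpa using hf) (.clear _ _)).cast
      (Store.get_injective fun j => ?_) ?_
    · cases j <;> simp [Store.get_set, hf, hr]
    · simp [hz]
  · rw [List.replicate_succ] at hf
    refine (Exec.pop_some hf (.seq (.clear _ _) (.emit z zs _ ?_ ?_))).cast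
      (Store.get_injective fun j => ?_) ?_
    · simp [Store.get_set, hz]
    · simp [Store.get_set, hr]
    · cases j <;> simp [Store.get_set]
    · simp; omega

theorem Exec.store (zs : List (List Bool)) (S : Store) {g : ℕ}
    (hr : S.get .result = (encodeWords zs).reverse) (hg : (encodeWords zs).length ≤ g) :
    Exec O .store S ((S.set .result []).set .tables (encodeWords zs ++ .row :: S.get .tables))
      (2 * g + 2) := by
  refine (Exec.seq (.push _ _ _) (.move (by decide) _)).cast (Store.get_injective fun j => ?_) ?_
  · cases j <;> simp [Store.get_set, hr]
  · simp [Store.get_set, hr]; omega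

theorem matches₁_le (c : Bool → Bool → Bool → Bool) (x : List Bool) (ys : List (List Bool))
    (z : List Bool) : matches₁ c x ys z ≤ ys.length := List.countP_le_length

/-- Bounds the height of `found`, and so the cost of emptying it. -/
theorem matches₂_le (c : Bool → Bool → Bool → Bool) (xs ys : List (List Bool)) (z : List Bool) :
    matches₂ c xs ys z ≤ xs.length * ys.length := by
  unfold matches₂
  induction xs with
  | nil => simp
  | cons x xs ih =>
    have := matches₁_le c x ys z
    simp only [List.map_cons, List.sum_cons, List.length_cons, Nat.add_mul]
    omega

/-- The auxiliary stacks that are empty between the routines. -/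
def Store.Clean (S : Store) : Prop :=
  ∀ k ∉ [Stack.input, .tokens, .vars, .rows, .masks, .tables, .left, .right, .name], S.get k = []

/-- Three nested loops over at most `g` words each, with comparisons of words of length below `g`:
this is the fourth power. -/
theorem Exec.combine (c : Bool → Bool → Bool → Bool) (t g : ℕ) (xs ys zs : List (List Bool))
    (S : Store) (hS : S.Clean) (hx : S.get .left = encodeWords xs)
    (hy : S.get .right = encodeWords ys) (hz : S.get .masks = encodeWords zs)
    (hxt : ∀ x ∈ xs, x.length = t) (hyt : ∀ y ∈ ys, y.length = t) (hzt : ∀ z ∈ zs, z.length = t)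
    (ht : t + 1 ≤ g) (hxg : xs.length ≤ g) (hyg : ys.length ≤ g) (hzg : zs.length ≤ g) :
    Exec O (.combine c) S (((S.set .left []).set .right []).set .tables
      (encodeWords (combineTables c xs ys zs) ++ .row :: S.get .tables)) (100 * g ^ 4) := by
  have h (k) (hk : k ∉ [Stack.input, .tokens, .vars, .rows, .masks, .tables, .left, .right,
    .name]) : S.get k = [] := hS k hk
  have hrt := h .rightTmp (by decide)
  have hrr := h .rightRev (by decide)
  have hrw := h .rightWord (by decide)
  have hlt := h .leftTmp (by decide)
  have hlr := h .leftRev (by decide)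
  have hlw := h .leftWord (by decide)
  have hmt := h .maskTmp (by decide)
  have hmr := h .maskRev (by decide)
  have hmw := h .mask (by decide)
  have hf := h .fail (by decide)
  have hfo := h .found (by decide)
  have hre := h .result (by decide)
  have hxl := length_encodeWords_le fun x hx => (hxt x hx).le
  have hyl := length_encodeWords_le fun x hx => (hyt x hx).le
  have hzl := length_encodeWords_le (ws := combineTables c xs ys zs) (g := t) fun x hx =>
    (hzt x (List.mem_of_mem_filter hx)).le
  have hzl' : (combineTables c xs ys zs).length ≤ g := (List.length_filter_le _ _).trans hzg
  have hloop := Exec.forWords (O := O) (k := .masks) (t := .maskTmp) (w := .maskRev) (r := .mask)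
    (body := .searchLeft c ;; .emitIfFound)
    (by decide) (by decide) (by decide) (by decide) (by decide) (by decide) zs
    (g * (g * (29 * g) + 11 * g) + 2 + (2 * (g * g) + 2 * g + 4)) t (fun z hz => (hzt z hz).le)
    (fun d => (S.set .masks []).set .result (encodeWords (combineTables c xs ys d)).reverse)
    (fun d => by simp [Store.get_set, hmt]) (fun d => by simp [Store.get_set, hmr])
    (fun d => by simp [Store.get_set, hmw]) (fun d z l hd => by
      have hzt' : z.length = t := hzt z (by rw [← hd]; simp)
      have hm := matches₂_le c xs ys z
      refine (Exec.seq (.searchLeft c t xs ys z _ ?_ ?_ ?_ hxt hyt hzt' ?_ ?_ ?_ ?_ ?_ ?_ ?_ ?_)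
        (.emitIfFound (matches₂ c xs ys z) z (combineTables c xs ys d) _ ?_ ?_ ?_)).cast
        (Store.get_injective fun j => ?_) ?_
      iterate 14 simp [Store.get_set, hx, hy, hlr, hrr, hmr, hf, hrt, hrw, hlt, hlw, hfo]
      · cases j <;> simp [Store.get_set, combineTables, hfo, hmw]
        by_cases h0 : matches₂ c xs ys z = 0 <;> simp [h0]
      · have h₁ : xs.length * ys.length ≤ g * g := Nat.mul_le_mul hxg hyg
        have h₂ : ys.length * (29 * t + 29) ≤ g * (29 * g) := Nat.mul_le_mul hyg (by omega)
        have h₃ : xs.length * (ys.length * (29 * t + 29) + 9 * t + 11)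
          ≤ g * (g * (29 * g) + 11 * g) := Nat.mul_le_mul hxg (by omega)
        omega)
  refine (Exec.seq (hloop.conv (S₀ := S) (S'' := S.set .result
    (encodeWords (combineTables c xs ys zs)).reverse) (Store.get_injective fun j => ?_)
      (Store.get_injective fun j => ?_) le_rfl)
    (.seq (.clear _ _) (.seq (.clear _ _) (.store (combineTables c xs ys zs) (g := g * g) _ ?_
      ?_)))).cast (Store.get_injective fun j => ?_) ?_
  · cases j <;> simp [Store.get_set, combineTables, hre, hz]
  · cases j <;> simp [Store.get_set, hz]
  · simp [Store.get_set]
  · exact hzl.trans (Nat.mul_le_mul hzl' ht)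
  · cases j <;> simp [Store.get_set, hre]
  · simp only [Store.get_set, reduceCtorEq, if_false, hx, hy]
    have h₁ := hxl.trans (Nat.mul_le_mul hxg ht)
    have h₂ := hyl.trans (Nat.mul_le_mul hyg ht)
    have h₃ : zs.length * (g * (g * (29 * g) + 11 * g) + 2 + (2 * (g * g) + 2 * g + 4)
        + 7 * t + 8) ≤ g * (g * (g * (29 * g) + 11 * g) + 2 + (2 * (g * g) + 2 * g + 4)
        + 7 * g + 8) := Nat.mul_le_mul hzg (by omega)
    -- In terms of `e = g - 1` the inequality holds coefficient by coefficient, so linear arithmetic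
    -- in the powers of `e` suffices.
    obtain ⟨e, rfl⟩ : ∃ e, g = e + 1 := ⟨g - 1, by omega⟩
    have key : (e + 1) * ((e + 1) * ((e + 1) * (29 * (e + 1)) + 11 * (e + 1)) + 2
        + (2 * ((e + 1) * (e + 1)) + 2 * (e + 1) + 4) + 7 * (e + 1) + 8) + 2
        + (2 * ((e + 1) * (e + 1)) + 1 + (2 * ((e + 1) * (e + 1)) + 1
        + (2 * ((e + 1) * (e + 1)) + 2))) ≤ 100 * (e + 1) ^ 4 := by
      have := Nat.zero_le (e ^ 2)
      have := Nat.zero_le (e ^ 3)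
      have := Nat.zero_le (e ^ 4)
      linarith
    omega

/-! ### Leaves that do not depend on variables, and stored tables -/

theorem Iter.moveList {k j : Stack} (hkj : k ≠ j) {b : Letter → Bool} (l r : List Letter)
    (hb : ∀ a ∈ l, b a = false) (S : Store) (hS : S.get k = l ++ r) :
    Iter O k b (fun a => .push j a) S ((S.set k r).set j (l.reverse ++ S.get j))
      (2 * l.length) := by
  induction l generalizing S with
  | nil =>
    refine Iter.refl.cast (Store.get_injective fun i => ?_) (by simp)
    simp only [Store.get_set]
    split_ifs <;> simp_all
  | cons a l ih =>
    refine ((Iter.step (l := l ++ r) hS (hb a (by simp)) (.push _ _ _)).trans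
      (ih (fun a ha => hb a (by simp [ha])) _ ?_)).cast (Store.get_injective fun i => ?_)
      (by simp; omega)
    · simp [Store.get_set, hkj]
    · simp only [Store.get_set, hkj.symm, if_true, if_false]
      split_ifs <;> simp

/-- Copies all masks to `left` and `right`. -/
def Prog.copyMasks : Prog :=
  .move .masks .maskTmp ;;
    .each .maskTmp fun a => .push .masks a ;; .push .left a ;; .push .right a

theorem Iter.copyMasks (l : List Letter) (S : Store) (hS : S.get .maskTmp = l) :
    Iter O .maskTmp (fun _ => false) (fun a => .push .masks a ;; .push .left a ;; .push .right a)
      S ((((S.set .maskTmp []).set .masks (l.reverse ++ S.get .masks)).set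
        .left (l.reverse ++ S.get .left)).set .right (l.reverse ++ S.get .right))
      (4 * l.length) := by
  induction l generalizing S with
  | nil =>
    refine Iter.refl.cast (Store.get_injective fun j => ?_) (by simp)
    cases j <;> simp [Store.get_set, hS]
  | cons a l ih =>
    refine ((Iter.step hS rfl (.seq (.push _ _ _) (.seq (.push _ _ _) (.push _ _ _)))).trans
      (ih _ ?_)).cast (Store.get_injective fun j => ?_) (by simp; omega)
    · simp [Store.get_set]
    · cases j <;> simp [Store.get_set]

theorem Exec.copyMasks (S : Store) (l : List Letter) (hS : S.Clean) (hz : S.get .masks = l)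
    (hl : S.get .left = []) (hr : S.get .right = []) :
    Exec O .copyMasks S ((S.set .left l).set .right l) (6 * l.length + 2) := by
  have hmt := hS .maskTmp (by decide)
  refine (Exec.seq (.move (by decide) _) ((Iter.copyMasks l.reverse _ ?_).exec ?_)).cast
    (Store.get_injective fun j => ?_) ?_
  · simp [Store.get_set, hz, hmt]
  · simp [Store.get_set]
  · cases j <;> simp [Store.get_set, hz, hmt, hl, hr]
  · simp [hz]; omega

/-- Whether a letter ends a table on `tables`. -/
def isRow : Letter → Bool
  | .row => true
  | _ => false

/-- Moves the topmost table to the stack `k`. -/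
def Prog.load (k : Stack) : Prog :=
  .loop .tables isRow (fun a => .push .leftTmp a) ;; .move .leftTmp k

/-- Tables consist of bits and `sep` only, so the letter `row` below a table marks its end
unambiguously. -/
theorem isRow_of_mem_encodeWords {ws : List (List Bool)} {a : Letter} (h : a ∈ encodeWords ws) :
    isRow a = false := by
  simp only [encodeWords, List.mem_flatMap, List.mem_append, List.mem_map, List.mem_singleton] at h
  obtain ⟨w, -, ⟨b, -, rfl⟩ | rfl⟩ := h <;> rfl

theorem Exec.load {k : Stack} (hk : k ≠ .tables) (hk' : k ≠ .leftTmp) (ws : List (List Bool))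
    (ts : List Letter) (S : Store) (hS : S.get .tables = encodeWords ws ++ .row :: ts)
    (ht : S.get .leftTmp = []) (h : S.get k = []) :
    Exec O (.load k) S ((S.set .tables ts).set k (encodeWords ws))
      (4 * (encodeWords ws).length + 2) := by
  refine (Exec.seq ((Iter.moveList (by decide) (encodeWords ws) (.row :: ts)
    (fun a => isRow_of_mem_encodeWords) S hS).exec_halt (a := .row) (l := ts) ?_ rfl)
    (.move hk'.symm _)).cast (Store.get_injective fun j => ?_) ?_
  · simp [Store.get_set]
  · simp only [Store.get_set]
    split_ifs <;> simp_all
  · simp [Store.get_set, ht]; omega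

/-! ### The values of a variable -/

/-- A list of words, each of which starts with the letter `a`. -/
def encodeTagged (a : Letter) (ws : List (List Bool)) : List Letter :=
  ws.flatMap fun w => a :: bits w

@[simp] theorem encodeTagged_nil (a : Letter) : encodeTagged a [] = [] := rfl

@[simp] theorem encodeTagged_cons (a : Letter) (w : List Bool) (ws : List (List Bool)) :
    encodeTagged a (w :: ws) = a :: (bits w ++ encodeTagged a ws) := by simp [encodeTagged]

@[simp] theorem encodeTagged_append (a : Letter) (ws us : List (List Bool)) :
    encodeTagged a (ws ++ us) = encodeTagged a ws ++ encodeTagged a us := by simp [encodeTagged]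

theorem length_le_encodeTagged (a : Letter) (ws : List (List Bool)) :
    ws.length ≤ (encodeTagged a ws).length := by
  induction ws with
  | nil => simp
  | cons w ws ih => simp; omega

theorem length_le_encodeTagged_of_mem (a : Letter) {w : List Bool} {ws : List (List Bool)}
    (h : w ∈ ws) : w.length ≤ (encodeTagged a ws).length := by
  induction ws with
  | nil => simp at h
  | cons v ws ih =>
    rcases List.mem_cons.1 h with rfl | h
    · simp; omega
    · have := ih h
      simp; omega

/-- The number of mismatches between a word and the beginning of another word. -/
def mismatches : List Bool → List Bool → ℕ
  | [], _ => 0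
  | _ :: ys, [] => mismatches ys [] + 1
  | y :: ys, z :: zs => mismatches ys zs + if z == y then 0 else 1

theorem mismatches_le (ys zs : List Bool) : mismatches ys zs ≤ ys.length := by
  induction ys generalizing zs with
  | nil => simp [mismatches]
  | cons y ys ih =>
    rcases zs with _ | ⟨z, zs⟩
    · simpa [mismatches] using ih []
    · have := ih zs
      simp only [mismatches, List.length_cons]
      split_ifs <;> omega

/-- Surplus letters of `ys` already count as mismatches, whereas surplus letters of `zs` do not; the
second condition excludes them. The program tests it by looking at what is left on `nameRev`. -/
theorem mismatches_eq_zero_iff (ys zs : List Bool) :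
    (mismatches ys zs = 0 ∧ zs.drop ys.length = []) ↔ ys = zs := by
  induction ys generalizing zs with
  | nil => simp [mismatches, eq_comm]
  | cons y ys ih =>
    rcases zs with _ | ⟨z, zs⟩
    · simp [mismatches]
    · simp only [mismatches, List.length_cons, List.drop_succ_cons, List.cons.injEq, ← ih zs]
      by_cases h : z = y
      · simp [h]
      · simp [h, Ne.symm h]

/-- Whether a letter is the bit `b`. -/
def isBit (b : Bool) : Letter → Bool
  | .bit c => c == b
  | _ => false

/-- One round of the comparison of the name on `nameRev` with the variables on `vars`. -/
def Prog.compareName (a : Letter) : Prog :=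
  .push .rightTmp a ;; match a with
    | .bit y => .pop .nameRev fun
      | none => .push .fail .top
      | some z => .push .name z ;; bif isBit y z then .nop else .push .fail .top
    | _ => .pop .nameRev (fun
        | none => .nop
        | some z => .push .nameRev z ;; .push .fail .top) ;;
      .move .nameRev .name ;; .move .name .nameRev ;;
      .pop .fail fun
        | none => .push .flags (.bit true)
        | some _ => .clear .fail ;; .push .flags (.bit false)

theorem Iter.compareName_bits (ys zs : List Bool) (l : List Letter) (S : Store)
    (hv : S.get .vars = bits ys ++ l) (hz : S.get .nameRev = bits zs) :
    Iter O .vars (fun _ => false) .compareName S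
      (((((S.set .vars l).set .nameRev (bits (zs.drop ys.length))).set
        .name ((bits (zs.take ys.length)).reverse ++ S.get .name)).set
        .rightTmp ((bits ys).reverse ++ S.get .rightTmp)).set
        .fail (List.replicate (mismatches ys zs) .top ++ S.get .fail)) (5 * ys.length) := by
  induction ys generalizing zs S with
  | nil =>
    refine Iter.refl.cast (Store.get_injective fun j => ?_) (by simp)
    cases j <;> simp [Store.get_set, hv, hz, mismatches]
  | cons y ys ih =>
    rcases zs with _ | ⟨z, zs⟩
    · refine ((Iter.step (l := bits ys ++ l) (a := .bit y) hv rfl (.seq (.push _ _ _)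
        (.pop_none ?_ (.push _ _ _)))).trans
        (ih [] _ ?_ ?_)).cast (Store.get_injective fun j => ?_) (by simp; omega)
      · simpa [Store.get_set] using hz
      · simp [Store.get_set]
      · simpa [Store.get_set] using hz
      · cases j <;> simp [Store.get_set, mismatches, List.replicate_succ']
    · have hlast (S : Store) : Exec O (bif isBit y (.bit z) then .nop else .push .fail .top) S
          (S.set .fail (List.replicate (if z == y then 0 else 1) .top ++ S.get .fail)) 1 := by
        simp only [isBit]
        cases z == y
        · exact Exec.push _ _ _
        · refine (Exec.nop S).cast ?_ le_rfl
          simp [Store.set_get]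
      refine ((Iter.step (l := bits ys ++ l) (a := .bit y) hv rfl (.seq (.push _ _ _)
        (.pop_some (a := .bit z) (l := bits zs) ?_ (.seq (.push _ _ _) (hlast _))))).trans
        (ih zs _ ?_ ?_)).cast (Store.get_injective fun j => ?_) (by simp; omega)
      · simpa [Store.get_set] using hz
      · simp [Store.get_set]
      · simp [Store.get_set]
      · cases j <;> simp [Store.get_set, mismatches, -List.replicate_append_replicate,
          List.replicate_add]

theorem Iter.compareName (ys zs : List Bool) (l : List Letter) (S : Store)
    (hv : S.get .vars = bits ys ++ .var :: l) (hz : S.get .nameRev = bits zs)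
    (hn : S.get .name = []) (hf : S.get .fail = []) {g : ℕ} (hyg : ys.length ≤ g)
    (hzg : zs.length ≤ g) :
    Iter O .vars (fun _ => false) .compareName S
      (((S.set .vars l).set .rightTmp (.var :: (bits ys).reverse ++ S.get .rightTmp)).set
        .flags (.bit (ys == zs) :: S.get .flags)) (12 * g + 20) := by
  have hm := mismatches_le ys zs
  have hiff := mismatches_eq_zero_iff ys zs
  set S₁ := (((((S.set .vars (.var :: l)).set .nameRev (bits (zs.drop ys.length))).set
        .name ((bits (zs.take ys.length)).reverse ++ S.get .name)).set
        .rightTmp ((bits ys).reverse ++ S.get .rightTmp)).set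
        .fail (List.replicate (mismatches ys zs) .top ++ S.get .fail)) with hS₁
  set S₂ := ((S₁.set .vars l).set .rightTmp (.var :: S₁.get .rightTmp)) with hS₂
  -- `k` is the final height of `fail`: the number of mismatches, plus one if the name on `nameRev`
  -- is not used up.
  obtain ⟨k, hk, hk0, h₁⟩ : ∃ k, k ≤ g + 1 ∧ (k = 0 ↔ ys = zs) ∧ Exec O (.pop .nameRev (fun
        | none => .nop
        | some z => .push .nameRev z ;; .push .fail .top)) S₂
        (S₂.set .fail (List.replicate k .top)) 3 := by
    rcases hd : zs.drop ys.length with _ | ⟨z, zs'⟩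
    · refine ⟨mismatches ys zs, by omega, by simpa [hd] using hiff,
        (Exec.pop_none ?_ (.nop _)).cast (Store.get_injective fun j => ?_) (by omega)⟩
      · simp [hS₂, hS₁, Store.get_set, hd]
      · cases j <;> simp [hS₂, hS₁, Store.get_set, hf]
    · refine ⟨mismatches ys zs + 1, by omega, by simpa [hd] using hiff,
        (Exec.pop_some (a := .bit z) (l := bits zs') ?_ (.seq (.push _ _ _) (.push _ _ _))).cast
        (Store.get_injective fun j => ?_) (by omega)⟩
      · simp [hS₂, hS₁, Store.get_set, hd]
      · cases j <;> simp [hS₂, hS₁, Store.get_set, hf, hd, List.replicate_succ]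
  have hlast (S : Store) (hS : S.get .fail = List.replicate k .top) :
      Exec O (.pop .fail fun
        | none => .push .flags (.bit true)
        | some _ => .clear .fail ;; .push .flags (.bit false)) S
        ((S.set .fail []).set .flags (.bit (ys == zs) :: S.get .flags)) (2 * g + 6) := by
    rcases k with _ | k
    · have : (ys == zs) = true := by simpa using hk0
      rw [this]
      refine (Exec.pop_none (by simpa using hS) (.push _ _ _)).cast
        (Store.get_injective fun j => ?_) (by omega)
      cases j <;> simp [Store.get_set, hS]
    · have : (ys == zs) = false := by simpa using hk0
      rw [this]
      rw [List.replicate_succ] at hS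
      refine (Exec.pop_some hS (.seq (.clear _ _) (.push _ _ _))).cast
        (Store.get_injective fun j => ?_) ?_
      · cases j <;> simp [Store.get_set]
      · simp; omega
  refine ((Iter.compareName_bits ys zs (.var :: l) S hv hz).trans
    (Iter.step (a := .var) (l := l) ?_ rfl (.seq (.push _ _ _) (.seq h₁ (.seq (.move (by decide) _)
    (.seq (.move (by decide) _) (hlast _ ?_))))))).cast (Store.get_injective fun j => ?_) ?_
  · simp [Store.get_set]
  · simp [Store.get_set]
  · cases j <;> simp [hS₂, hS₁, Store.get_set, hn, hf, hz, -List.map_append]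
  · simp [hS₂, hS₁, Store.get_set, hn]; omega

/-- The bits of a row that are selected by a list of flags. -/
def pick : List Bool → List Bool → List Bool
  | p :: ps, y :: ys => (if p then [y] else []) ++ pick ps ys
  | _, _ => []

/-- One round of the selection of the bits from the rows. -/
def Prog.pickBits (a : Letter) : Prog :=
  .push .leftTmp a ;; match a with
    | .bit y => .pop .flags fun
      | some (.bit p) => .push .flagsTmp (.bit p) ;; bif p then .push .leftRev (.bit y) else .nop
      | _ => .nop
    | _ => .move .flagsTmp .flags

theorem length_pick_le (ps ys : List Bool) : (pick ps ys).length ≤ ys.length := by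
  induction ps generalizing ys with
  | nil => simp [pick]
  | cons p ps ih =>
    rcases ys with _ | ⟨y, ys⟩
    · simp [pick]
    · have := ih ys
      simp only [pick, List.length_append, List.length_cons]
      split_ifs <;> simp <;> omega

theorem Iter.pickBits_bits (ps ys : List Bool) (l : List Letter) (S : Store)
    (hr : S.get .rows = bits ys ++ l) (hp : S.get .flags = bits ps) (hlen : ys.length = ps.length) :
    Iter O .rows (fun _ => false) .pickBits S
      (((((S.set .rows l).set .flags []).set
        .flagsTmp ((bits ps).reverse ++ S.get .flagsTmp)).set
        .leftTmp ((bits ys).reverse ++ S.get .leftTmp)).set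
        .leftRev ((bits (pick ps ys)).reverse ++ S.get .leftRev)) (5 * ys.length) := by
  induction ys generalizing ps S with
  | nil =>
    obtain rfl : ps = [] := by simpa [eq_comm] using hlen
    refine Iter.refl.cast (Store.get_injective fun j => ?_) (by simp)
    cases j <;> simp [Store.get_set, hr, hp, pick]
  | cons y ys ih =>
    rcases ps with _ | ⟨p, ps⟩
    · simp at hlen
    have hlast (S : Store) : Exec O (bif p then .push .leftRev (.bit y) else .nop) S
        (S.set .leftRev (bits (if p then [y] else []) ++ S.get .leftRev)) 1 := by
      cases p
      · refine (Exec.nop S).cast ?_ le_rfl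
        simp [Store.set_get]
      · exact Exec.push _ _ _
    refine ((Iter.step (l := bits ys ++ l) (a := .bit y) hr rfl (.seq (.push _ _ _)
      (.pop_some (a := .bit p) (l := bits ps) ?_ (.seq (.push _ _ _) (hlast _))))).trans
      (ih ps _ ?_ ?_ (by simpa using hlen))).cast (Store.get_injective fun j => ?_)
      (by simp; omega)
    · simpa [Store.get_set] using hp
    · simp [Store.get_set]
    · simp [Store.get_set]
    · cases j <;> simp [Store.get_set, pick]
      cases p <;> simp

theorem Iter.pickBits (ps ys : List Bool) (l : List Letter) (S : Store)
    (hr : S.get .rows = .row :: (bits ys ++ l)) (hp : S.get .flagsTmp = (bits ps).reverse)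
    (hf : S.get .flags = []) (hlen : ys.length = ps.length) {g : ℕ} (hg : ys.length ≤ g) :
    Iter O .rows (fun _ => false) .pickBits S
      (((S.set .rows l).set
        .leftTmp ((.row :: bits ys).reverse ++ S.get .leftTmp)).set
        .leftRev ((bits (pick ps ys)).reverse ++ S.get .leftRev)) (7 * g + 3) := by
  refine ((Iter.step hr rfl (.seq (.push _ _ _) (.move (by decide) _))).trans
    (Iter.pickBits_bits ps ys l _ ?_ ?_ hlen)).cast (Store.get_injective fun j => ?_) ?_
  · simp [Store.get_set]
  · simp [Store.get_set, hp, hf]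
  · cases j <;> simp [Store.get_set, hf, hp]
  · simp [Store.get_set, hp]; omega

/-- Puts the column of the variable on `name` to `left` and to `right`, as the only word. -/
def Prog.column : Prog :=
  .move .name .nameRev ;; .each .vars .compareName ;; .move .rightTmp .vars ;; .clear .nameRev ;;
    .move .flags .flagsTmp ;; .each .rows .pickBits ;; .move .leftTmp .rows ;; .clear .flagsTmp ;;
    .push .left .sep ;; .push .right .sep ;;
    .each .leftRev fun a => .push .left a ;; .push .right a

/-- `vars` holds the list of names reversed, so each name is read backwards and before its tag, and
is compared with the reversed `w`. The last name comes first; since flags are pushed, they end up in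
the order of `ns`. This explains the induction from the right. -/
theorem Iter.compareNames (ns : List (List Bool)) (w : List Bool) (S : Store)
    (hv : S.get .vars = (encodeTagged .var ns).reverse) (hz : S.get .nameRev = (bits w).reverse)
    (hn : S.get .name = []) (hf : S.get .fail = []) {g : ℕ} (hng : ∀ n ∈ ns, n.length ≤ g)
    (hzg : w.length ≤ g) :
    Iter O .vars (fun _ => false) .compareName S
      (((S.set .vars []).set .rightTmp (encodeTagged .var ns ++ S.get .rightTmp)).set
        .flags (bits (ns.map (· == w)) ++ S.get .flags)) (ns.length * (12 * g + 20)) := by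
  induction ns using List.reverseRecOn generalizing S with
  | nil =>
    refine Iter.refl.cast (Store.get_injective fun j => ?_) (by simp)
    cases j <;> simp [Store.get_set, hv]
  | append_singleton ns n ih =>
    refine ((Iter.compareName n.reverse w.reverse (encodeTagged .var ns).reverse S ?_ ?_ hn hf
      (g := g) ?_ ?_).trans (ih _ ?_ ?_ ?_ ?_ ?_)).cast (Store.get_injective fun j => ?_) ?_
    · simp [hv]
    · simp [hz]
    · simpa using hng n (by simp)
    · simpa using hzg
    iterate 4 simp [Store.get_set, hz, hn, hf]
    · exact fun m hm => hng m (by simp [hm])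
    · cases j <;> simp [Store.get_set]
    · simp only [List.length_append, List.length_singleton]
      ring_nf; rfl

theorem Iter.pickRows (ps : List Bool) (rs : List (List Bool)) (S : Store)
    (hr : S.get .rows = encodeTagged .row rs) (hp : S.get .flagsTmp = (bits ps).reverse)
    (hf : S.get .flags = []) (hlen : ∀ r ∈ rs, r.length = ps.length) :
    Iter O .rows (fun _ => false) .pickBits S
      (((S.set .rows []).set
        .leftTmp ((encodeTagged .row rs).reverse ++ S.get .leftTmp)).set
        .leftRev ((bits (rs.flatMap (pick ps))).reverse ++ S.get .leftRev))
      (rs.length * (7 * ps.length + 3)) := by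
  induction rs generalizing S with
  | nil =>
    refine Iter.refl.cast (Store.get_injective fun j => ?_) (by simp)
    cases j <;> simp [Store.get_set, hr]
  | cons r rs ih =>
    have hr' := hlen r (by simp)
    refine ((Iter.pickBits ps r (encodeTagged .row rs) S (by simpa using hr) hp hf hr' hr'.le).trans
      (ih _ ?_ ?_ ?_ fun r hr => hlen r (by simp [hr]))).cast (Store.get_injective fun j => ?_) ?_
    iterate 3 simp [Store.get_set, hp, hf]
    · cases j <;> simp [Store.get_set]
    · simp only [List.length_cons]
      ring_nf; rfl

theorem Iter.fork {k i j : Stack} (hki : k ≠ i) (hkj : k ≠ j) (hij : i ≠ j) (l : List Letter)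
    (S : Store) (hS : S.get k = l) :
    Iter O k (fun _ => false) (fun a => .push i a ;; .push j a)
      S (((S.set k []).set i (l.reverse ++ S.get i)).set j (l.reverse ++ S.get j))
      (3 * l.length) := by
  induction l generalizing S with
  | nil =>
    refine Iter.refl.cast (Store.get_injective fun h => ?_) (by simp)
    simp only [Store.get_set]
    split_ifs <;> simp_all
  | cons a l ih =>
    refine ((Iter.step hS rfl (.seq (.push _ _ _) (.push _ _ _))).trans
      (ih _ ?_)).cast (Store.get_injective fun h => ?_) (by simp; omega)
    · simp [Store.get_set, hki, hkj]
    · simp only [Store.get_set, hki.symm, hkj.symm, hij, hij.symm, if_true, if_false]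
      split_ifs <;> simp

/-- The values of the variable with name `w`, according to the names and rows of a table. -/
def column (ns : List (List Bool)) (rs : List (List Bool)) (w : List Bool) : List Bool :=
  rs.flatMap (pick (ns.map (· == w)))

theorem length_column_le (ns : List (List Bool)) (rs : List (List Bool)) (w : List Bool) :
    (column ns rs w).length ≤ (encodeTagged .row rs).length := by
  unfold column
  induction rs with
  | nil => simp
  | cons r rs ih =>
    have := length_pick_le (ns.map (· == w)) r
    simp only [List.flatMap_cons, List.length_append, encodeTagged_cons, List.length_cons,
      List.length_map]
    omega

/-- The names are compared once, and the resulting flags are reused for every row. The column goes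
to both `left` and `right`, because a literal is evaluated by the same routine `combine` as a
connective. -/
theorem Exec.column (ns rs : List (List Bool)) (w : List Bool) (S : Store) (hS : S.Clean)
    (hw : S.get .name = bits w) (hv : S.get .vars = (encodeTagged .var ns).reverse)
    (hr : S.get .rows = encodeTagged .row rs) (hl : S.get .left = []) (hri : S.get .right = [])
    (hlen : ∀ r ∈ rs, r.length = ns.length) {g : ℕ} (hwg : w.length ≤ g)
    (hvg : (encodeTagged .var ns).length ≤ g) (hrg : (encodeTagged .row rs).length ≤ g) :
    Exec O .column S (((S.set .name []).set .left (encodeWords [column ns rs w])).set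
      .right (encodeWords [column ns rs w])) (100 * (g + 1) ^ 2) := by
  have hrt := hS .rightTmp (by decide)
  have hlt := hS .leftTmp (by decide)
  have hlr := hS .leftRev (by decide)
  have hf := hS .fail (by decide)
  have hnr := hS .nameRev (by decide)
  have hfl := hS .flags (by decide)
  have hft := hS .flagsTmp (by decide)
  have hnl := length_le_encodeTagged .var ns
  have hrl := length_le_encodeTagged .row rs
  have hcl := length_column_le ns rs w
  refine (Exec.seq (.move (by decide) _) (.seq ((Iter.compareNames ns w _ ?_ ?_ ?_ ?_ (g := g) ?_
    hwg).exec ?_) (.seq (.move (by decide) _) (.seq (.clear _ _) (.seq (.move (by decide) _) (.seq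
    ((Iter.pickRows (ns.map (· == w)) rs _ ?_ ?_ ?_ ?_).exec ?_) (.seq (.move (by decide) _) (.seq
    (.clear _ _) (.seq (.push _ _ _) (.seq (.push _ _ _)
    ((Iter.fork (by decide) (by decide) (by decide)
    (bits (TeamSemantics.column ns rs w)).reverse _ ?_).exec ?_))))))))))).cast
    (Store.get_injective fun j => ?_) ?_
  iterate 4 simp [Store.get_set, hw, hv, hnr, hf]
  · exact fun n hn => (length_le_encodeTagged_of_mem _ hn).trans hvg
  iterate 4 simp [Store.get_set, hr, hfl, hft]
  · simpa using hlen
  iterate 3 simp [Store.get_set, hlr, TeamSemantics.column]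
  · cases j <;> simp [Store.get_set, hv, hr, hlr, hnr, hfl, hft, hlt, hrt, hl, hri,
      TeamSemantics.column]
  · simp [Store.get_set, hw, hrt, hlt, hnr, hfl, hft]
    have h₁ : ns.length * (12 * g + 20) ≤ g * (12 * g + 20) := by gcongr; omega
    have h₂ : rs.length * (7 * ns.length + 3) ≤ g * (7 * g + 3) := by gcongr <;> omega
    nlinarith

/-! ### The tables of atoms -/

/-- The elements of a list that are selected by a mask. -/
def select {α : Type} : List Bool → List α → List α
  | b :: bs, r :: rs => (if b then [r] else []) ++ select bs rs
  | _, _ => []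

theorem length_encodeTagged_select_le (a : Letter) (z : List Bool) (rs : List (List Bool)) :
    (encodeTagged a (select z rs)).length ≤ (encodeTagged a rs).length := by
  induction rs generalizing z with
  | nil => cases z <;> simp [select]
  | cons r rs ih =>
    rcases z with _ | ⟨b, z⟩
    · simp [select]
    · have := ih z
      cases b <;> simp [select] <;> omega

/-- Copies a letter of the table of the team to `query`, if it belongs to a row that is selected by
the mask. -/
def Prog.copyRow (a : Letter) : Prog :=
  .push .leftTmp a ;;
    (match a with
      | .row => .pop .mask (.pushOption .maskRev)
      | _ => .nop) ;;
    .pop .maskRev fun z => .pushOption .maskRev z ;;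
      bif isBit true (z.getD .top) then .push .query a else .nop

theorem Exec.copyLetter (a : Letter) (z : Bool) (mr : List Letter) (S : Store)
    (hm : S.get .maskRev = .bit z :: mr) :
    Exec O (.pop .maskRev fun z => .pushOption .maskRev z ;;
      bif isBit true (z.getD .top) then .push .query a else .nop) S
      (S.set .query ((if z then [a] else []) ++ S.get .query)) 3 := by
  have hlast (S : Store) : Exec O (bif isBit true (.bit z) then .push .query a else .nop) S
      (S.set .query ((if z then [a] else []) ++ S.get .query)) 1 := by
    cases z
    · refine (Exec.nop S).cast ?_ le_rfl
      simp [Store.set_get]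
    · exact Exec.push _ _ _
  refine (Exec.pop_some hm (.seq (.push _ _ _) (hlast _))).cast
    (Store.get_injective fun j => ?_) (by omega)
  cases j <;> simp [Store.get_set, hm]

/-- While a row is read, the top of `maskRev` is its mask bit, which decides for each letter whether
it is copied. -/
theorem Iter.copyRow_bits (ys : List Bool) (z : Bool) (mr l : List Letter) (S : Store)
    (hr : S.get .rows = bits ys ++ l) (hm : S.get .maskRev = .bit z :: mr) :
    Iter O .rows (fun _ => false) .copyRow S
      (((S.set .rows l).set .leftTmp ((bits ys).reverse ++ S.get .leftTmp)).set
        .query ((if z then (bits ys).reverse else []) ++ S.get .query)) (6 * ys.length) := by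
  induction ys generalizing S with
  | nil =>
    refine Iter.refl.cast (Store.get_injective fun j => ?_) (by simp)
    cases j <;> simp [Store.get_set, hr]
  | cons y ys ih =>
    refine ((Iter.step (l := bits ys ++ l) (a := .bit y) hr rfl (.seq (.push _ _ _)
      (.seq (.nop _) (.copyLetter (.bit y) z mr _ ?_)))).trans
      (ih _ ?_ ?_)).cast (Store.get_injective fun j => ?_) (by simp; omega)
    iterate 3 simp [Store.get_set, hm]
    · cases j <;> cases z <;> simp [Store.get_set]

theorem Iter.copyRow (ys : List Bool) (z : Bool) (mr l : List Letter) (S : Store)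
    (hr : S.get .rows = .row :: (bits ys ++ l)) (hm : S.get .mask = .bit z :: mr) :
    Iter O .rows (fun _ => false) .copyRow S
      (((((S.set .rows l).set .mask mr).set .maskRev (.bit z :: S.get .maskRev)).set
        .leftTmp ((.row :: bits ys).reverse ++ S.get .leftTmp)).set
        .query ((if z then (.row :: bits ys).reverse else []) ++ S.get .query))
      (6 * ys.length + 7) := by
  refine ((Iter.step hr rfl (.seq (.push _ _ _)
      (.seq (.pop_some (a := .bit z) (l := mr) ?_ (.push _ _ _))
      (.copyLetter .row z (S.get .maskRev) _ ?_)))).trans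
      (Iter.copyRow_bits ys z (S.get .maskRev) l _ ?_ ?_)).cast
      (Store.get_injective fun j => ?_) (by omega)
  iterate 4 simp [Store.get_set, hm]
  cases j <;> cases z <;> simp [Store.get_set]

theorem Iter.copyRows (rs : List (List Bool)) (zs : List Bool) (S : Store)
    (hr : S.get .rows = encodeTagged .row rs) (hm : S.get .mask = bits zs)
    (hlen : zs.length = rs.length) :
    Iter O .rows (fun _ => false) .copyRow S
      (((((S.set .rows []).set .mask []).set .maskRev ((bits zs).reverse ++ S.get .maskRev)).set
        .leftTmp ((encodeTagged .row rs).reverse ++ S.get .leftTmp)).set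
        .query ((encodeTagged .row (select zs rs)).reverse ++ S.get .query))
      (7 * (encodeTagged .row rs).length) := by
  induction rs generalizing zs S with
  | nil =>
    obtain rfl : zs = [] := by simpa using hlen
    refine Iter.refl.cast (Store.get_injective fun j => ?_) (by simp)
    cases j <;> simp [Store.get_set, hr, hm, select]
  | cons r rs ih =>
    rcases zs with _ | ⟨z, zs⟩
    · simp at hlen
    refine ((Iter.copyRow r z (bits zs) (encodeTagged .row rs) S (by simpa using hr) hm).trans
      (ih zs _ ?_ ?_ (by simpa using hlen))).cast (Store.get_injective fun j => ?_)
      (by simp; omega)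
    iterate 2 simp [Store.get_set]
    cases j <;> cases z <;> simp [Store.get_set, select]

/-- Writes the question whether the subteam that is selected by `mask` satisfies the atom on `name`
to `query`. -/
def Prog.buildQuery : Prog :=
  .each .name (fun a => .push .nameRev a ;; .push .query a) ;; .move .nameRev .name ;;
    .push .query .sep ;; .move .vars .rightTmp ;;
    .each .rightTmp (fun a => .push .vars a ;; .push .query a) ;; .each .rows .copyRow ;;
    .move .leftTmp .rows ;; .move .maskRev .mask

/-- The query is written in reversed order because asking reverses it once more. Name, variables,
rows and mask are all restored for the next mask. -/
theorem Exec.buildQuery (vs : List Letter) (rs : List (List Bool)) (w zs : List Bool) (S : Store)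
    (hw : S.get .name = bits w) (hv : S.get .vars = vs.reverse)
    (hr : S.get .rows = encodeTagged .row rs) (hm : S.get .mask = bits zs)
    (hlen : zs.length = rs.length) (hnr : S.get .nameRev = []) (hrt : S.get .rightTmp = [])
    (hlt : S.get .leftTmp = []) (hmr : S.get .maskRev = []) (hq : S.get .query = []) {g : ℕ}
    (hwg : w.length ≤ g) (hvg : vs.length ≤ g) (hrg : (encodeTagged .row rs).length ≤ g) :
    Exec O .buildQuery S (S.set .query
      (bits w ++ .sep :: (vs ++ encodeTagged .row (select zs rs))).reverse) (23 * g + 8) := by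
  have hrl := length_le_encodeTagged .row rs
  refine (Exec.seq ((Iter.fork (by decide) (by decide) (by decide) (bits w) S hw).exec ?_)
    (.seq (.move (by decide) _) (.seq (.push _ _ _) (.seq (.move (by decide) _)
    (.seq ((Iter.fork (by decide) (by decide) (by decide) vs _ ?_).exec ?_)
    (.seq ((Iter.copyRows rs zs _ ?_ ?_ hlen).exec ?_) (.seq (.move (by decide) _)
    (.move (by decide) _)))))))).cast (Store.get_injective fun j => ?_) ?_
  iterate 6 simp [Store.get_set, hv, hr, hm, hrt]
  · cases j <;> simp [Store.get_set, hw, hv, hr, hm, hnr, hrt, hlt, hmr, hq]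
  · simp [Store.get_set, hv, hnr, hlt, hmr]; omega

/-- Computes the table of the atom on `name`. -/
def Prog.atomTable : Prog :=
  .forWords .masks .maskTmp .maskRev .mask
    (.buildQuery ;; .ask .query fun b => bif b then .emit else .clear .mask) ;;
  .clear .name ;; .store

/-- One oracle call per mask, each within the common time bound `τ`; this gives the summand `g * τ`.
-/
theorem Exec.atomTable (vs : List Letter) (rs zs : List (List Bool)) (w : List Bool)
    (sat : List Bool → Bool) (τ : ℕ) (S : Store) (hS : S.Clean)
    (hO : ∀ z ∈ zs, O (bits w ++ .sep :: (vs ++ encodeTagged .row (select z rs))) (sat z) τ)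
    (hw : S.get .name = bits w) (hv : S.get .vars = vs.reverse)
    (hr : S.get .rows = encodeTagged .row rs) (hz : S.get .masks = encodeWords zs)
    (hlen : ∀ z ∈ zs, z.length = rs.length) {g : ℕ}
    (hwg : w.length ≤ g) (hvg : vs.length ≤ g) (hrg : (encodeTagged .row rs).length ≤ g)
    (hzg : zs.length ≤ g) :
    Exec O .atomTable S ((S.set .name []).set .tables
      (encodeWords (zs.filter sat) ++ .row :: S.get .tables))
      (100 * (g + 1) ^ 2 + g * τ) := by
  have hrt := hS .rightTmp (by decide)
  have hlt := hS .leftTmp (by decide)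
  have hmt := hS .maskTmp (by decide)
  have hmr := hS .maskRev (by decide)
  have hmw := hS .mask (by decide)
  have hnr := hS .nameRev (by decide)
  have hq := hS .query (by decide)
  have hre := hS .result (by decide)
  have hrl := length_le_encodeTagged .row rs
  have hzl := length_encodeWords_le (ws := zs.filter sat) (g := g) fun x hx =>
    ((hlen x (List.mem_of_mem_filter hx)).le.trans hrl).trans hrg
  have hzl' : (zs.filter sat).length ≤ g := (List.length_filter_le _ _).trans hzg
  have hloop := Exec.forWords (O := O) (k := .masks) (t := .maskTmp) (w := .maskRev) (r := .mask)
    (body := .buildQuery ;; .ask .query fun b => bif b then .emit else .clear .mask)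
    (by decide) (by decide) (by decide) (by decide) (by decide) (by decide) zs
    (28 * g + 13 + τ) g (fun z hz => ((hlen z hz).le.trans hrl).trans hrg)
    (fun d => (S.set .masks []).set .result (encodeWords (d.filter sat)).reverse)
    (fun d => by simp [Store.get_set, hmt]) (fun d => by simp [Store.get_set, hmr])
    (fun d => by simp [Store.get_set, hmw]) (fun d z l hd => by
      have hz' : z ∈ zs := by rw [← hd]; simp
      have hzt' : z.length = rs.length := hlen z hz'
      have hsl := length_encodeTagged_select_le .row z rs
      have hlast (S : Store) (hm : S.get .mask = bits z)
          (hre : S.get .result = (encodeWords (d.filter sat)).reverse) :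
          Exec O (bif sat z then .emit else .clear .mask) S ((S.set .mask []).set .result
            (encodeWords ((d ++ [z]).filter sat)).reverse) (2 * g + 2) := by
        rcases h : sat z with _ | _
        · refine (Exec.clear _ _).cast (Store.get_injective fun j => ?_) (by simp [hm]; omega)
          cases j <;> simp [Store.get_set, h, hre]
        · refine (Exec.emit z (d.filter sat) S hm hre).cast ?_ (by omega)
          simp [h]
      refine (Exec.seq (.buildQuery vs rs w z _ ?_ ?_ ?_ ?_ hzt' ?_ ?_ ?_ ?_ ?_ hwg hvg hrg)
        (.ask (c := sat z) (t := τ) ?_ (hlast _ ?_ ?_))).cast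
        (Store.get_injective fun j => ?_) ?_
      iterate 9 simp [Store.get_set, hw, hv, hr, hnr, hrt, hlt, hmr, hq]
      · simpa [Store.get_set] using hO z hz'
      iterate 2 simp [Store.get_set]
      · cases j <;> simp [Store.get_set, hmw, hq]
      · simp; omega)
  refine (Exec.seq (hloop.conv (S₀ := S) (S'' := S.set .result
    (encodeWords (zs.filter sat)).reverse) (Store.get_injective fun j => ?_)
      (Store.get_injective fun j => ?_) le_rfl)
    (.seq (.clear _ _) (.store (zs.filter sat) (g := g * (g + 1)) _ ?_
      ?_))).cast (Store.get_injective fun j => ?_) ?_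
  · cases j <;> simp [Store.get_set, hre, hz]
  · cases j <;> simp [Store.get_set, hz]
  · simp [Store.get_set]
  · exact hzl.trans (Nat.mul_le_mul hzl' le_rfl)
  · cases j <;> simp [Store.get_set, hre]
  · have h₃ : zs.length * (28 * g + 13 + τ + 7 * g + 8) ≤ g * (28 * g + 13 + τ + 7 * g + 8) :=
      Nat.mul_le_mul hzg le_rfl
    simp only [Store.get_set, reduceCtorEq, if_false, hw, List.length_map]
    nlinarith

/-! ### Preparation -/

/-- Whether a letter separates formula and team. -/
def isSep : Letter → Bool
  | .sep => true
  | _ => false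

/-- One round of the separation of the variables of a team from its rows. -/
def Prog.splitTeam (a : Letter) : Prog :=
  match a with
  | .row => .push .leftTmp .row
  | a => .pop .leftTmp fun
    | none => .push .vars a
    | some z => .push .leftTmp z ;; .push .leftTmp a

/-- `leftTmp` serves as a flag: as long as it is empty no row has begun, and letters belong to the
list of variables. -/
theorem Iter.splitTeam_vars (l r : List Letter) (hl : ∀ a ∈ l, isRow a = false) (S : Store)
    (hi : S.get .input = l ++ r) (ht : S.get .leftTmp = []) :
    Iter O .input (fun _ => false) .splitTeam S
      ((S.set .input r).set .vars (l.reverse ++ S.get .vars)) (3 * l.length) := by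
  induction l generalizing S with
  | nil =>
    refine Iter.refl.cast (Store.get_injective fun j => ?_) (by simp)
    cases j <;> simp [Store.get_set, hi]
  | cons a l ih =>
    have hstep : Exec O (.splitTeam a) (S.set .input (l ++ r))
        ((S.set .input (l ++ r)).set .vars (a :: (S.set .input (l ++ r)).get .vars)) 2 := by
      have ha := hl a (by simp)
      cases a
      case row => simp [isRow] at ha
      all_goals exact .pop_none (by simpa [Store.get_set] using ht) (.push _ _ _)
    refine ((Iter.step hi rfl hstep).trans (ih (fun a ha => hl a (by simp [ha])) _ ?_ ?_)).cast
      (Store.get_injective fun j => ?_) (by simp; omega)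
    iterate 2 simp [Store.get_set, ht]
    cases j <;> simp [Store.get_set]

theorem Iter.splitTeam_bits (w : List Bool) (r : List Letter) (S : Store)
    (hi : S.get .input = bits w ++ r) (ht : S.get .leftTmp ≠ []) :
    Iter O .input (fun _ => false) .splitTeam S
      ((S.set .input r).set .leftTmp ((bits w).reverse ++ S.get .leftTmp)) (4 * w.length) := by
  induction w generalizing S with
  | nil =>
    refine Iter.refl.cast (Store.get_injective fun j => ?_) (by simp)
    cases j <;> simp [Store.get_set, hi]
  | cons b w ih =>
    obtain ⟨a, l, ht⟩ := List.exists_cons_of_ne_nil ht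
    refine ((Iter.step (a := .bit b) (l := bits w ++ r) hi rfl (.pop_some (a := a) (l := l) ?_
      (.seq (.push _ _ _) (.push _ _ _)))).trans (ih _ ?_ ?_)).cast
      (Store.get_injective fun j => ?_) (by simp; omega)
    iterate 3 simp [Store.get_set, ht]
    cases j <;> simp [Store.get_set, ht]

theorem Iter.splitTeam_rows (rs : List (List Bool)) (S : Store)
    (hi : S.get .input = encodeTagged .row rs) :
    Iter O .input (fun _ => false) .splitTeam S
      ((S.set .input []).set .leftTmp ((encodeTagged .row rs).reverse ++ S.get .leftTmp))
      (4 * (encodeTagged .row rs).length) := by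
  induction rs generalizing S with
  | nil =>
    refine Iter.refl.cast (Store.get_injective fun j => ?_) (by simp)
    cases j <;> simp [Store.get_set, hi]
  | cons r rs ih =>
    refine ((Iter.step (f := .splitTeam) (a := .row) (by simpa using hi) rfl (.push _ _ _)).trans
      ((Iter.splitTeam_bits r (encodeTagged .row rs) _ ?_ ?_).trans (ih _ ?_))).cast
      (Store.get_injective fun j => ?_) ?_
    iterate 3 simp [Store.get_set]
    · cases j <;> simp [Store.get_set]
    · simp; omega

/-- Distributes the input to `tokens`, `vars`, and `leftTmp`. -/
def Prog.split : Prog :=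
  .loop .input isSep (fun a => .push .tokens a) ;; .each .input .splitTeam

theorem Exec.split (fs vs : List Letter) (rs : List (List Bool)) (hf : ∀ a ∈ fs, isSep a = false)
    (hv : ∀ a ∈ vs, isRow a = false) :
    Exec O .split (Store.empty.set .input (fs ++ .sep :: (vs ++ encodeTagged .row rs)))
      (((Store.empty.set .tokens fs.reverse).set .vars vs.reverse).set
        .leftTmp (encodeTagged .row rs).reverse)
      (4 * (fs ++ .sep :: (vs ++ encodeTagged .row rs)).length) := by
  refine (Exec.seq ((Iter.moveList (by decide) fs (.sep :: (vs ++ encodeTagged .row rs)) hf _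
    ?_).exec_halt (a := .sep) (l := vs ++ encodeTagged .row rs) ?_ rfl)
    (((Iter.splitTeam_vars vs (encodeTagged .row rs) hv _ ?_ ?_).trans
    (Iter.splitTeam_rows rs _ ?_)).exec ?_)).cast (Store.get_injective fun j => ?_) ?_
  iterate 6 simp [Store.get_set]
  · cases j <;> simp [Store.get_set]
  · simp; omega

/-- All words of a given length. -/
def allMasks : ℕ → List (List Bool)
  | 0 => [[]]
  | t + 1 => (allMasks t).map (· ++ [true]) ++ (allMasks t).map (· ++ [false])

theorem length_allMasks (t : ℕ) : (allMasks t).length = 2 ^ t := by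
  induction t with
  | zero => rfl
  | succ t ih => simp [allMasks, ih, pow_succ]; omega

theorem mem_allMasks {t : ℕ} {w : List Bool} : w ∈ allMasks t ↔ w.length = t := by
  induction t generalizing w with
  | zero => simp [allMasks]
  | succ t ih =>
    simp only [allMasks, List.mem_append, List.mem_map, ih]
    constructor
    · rintro (⟨v, rfl, rfl⟩ | ⟨v, rfl, rfl⟩) <;> simp
    · intro h
      rcases List.eq_nil_or_concat w with rfl | ⟨v, b, rfl⟩
      · simp at h
      · have hv : v.length = t := by simpa using h
        cases b
        · exact .inr ⟨v, hv, by simp⟩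
        · exact .inl ⟨v, hv, by simp⟩

theorem length_encodeWords_allMasks_le (t : ℕ) :
    (encodeWords (allMasks t)).length ≤ 2 ^ t * (t + 1) := by
  rw [← length_allMasks]
  exact length_encodeWords_le fun w hw => (mem_allMasks.1 hw).le

/-- One round of the extension of all masks by a further bit. -/
def Prog.extendMask : Letter → Prog
  | .bit b => .push .maskTmp (.bit b) ;; .push .maskRev (.bit b)
  | _ => .push .maskTmp (.bit false) ;; .push .maskTmp .sep ;; .push .maskRev (.bit true) ;;
      .push .maskRev .sep

/-- Replaces each mask by its two extensions. -/
def Prog.extendMasks : Prog :=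
  .each .masks .extendMask ;; .move .maskTmp .masks ;; .move .maskRev .masks

theorem Iter.extendMask_bits (w : List Bool) (l : List Letter) (S : Store)
    (hm : S.get .masks = bits w ++ l) :
    Iter O .masks (fun _ => false) .extendMask S
      (((S.set .masks l).set .maskTmp ((bits w).reverse ++ S.get .maskTmp)).set
        .maskRev ((bits w).reverse ++ S.get .maskRev)) (3 * w.length) := by
  induction w generalizing S with
  | nil =>
    refine Iter.refl.cast (Store.get_injective fun j => ?_) (by simp)
    cases j <;> simp [Store.get_set, hm]
  | cons b w ih =>
    refine ((Iter.step (a := .bit b) (l := bits w ++ l) hm rfl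
      (.seq (.push _ _ _) (.push _ _ _))).trans (ih _ ?_)).cast
      (Store.get_injective fun j => ?_) (by simp; omega)
    · simp [Store.get_set]
    · cases j <;> simp [Store.get_set]

theorem Iter.extendMask (zs : List (List Bool)) (S : Store)
    (hm : S.get .masks = encodeWords zs) :
    Iter O .masks (fun _ => false) .extendMask S
      (((S.set .masks []).set
        .maskTmp ((encodeWords (zs.map (· ++ [false]))).reverse ++ S.get .maskTmp)).set
        .maskRev ((encodeWords (zs.map (· ++ [true]))).reverse ++ S.get .maskRev))
      (5 * (encodeWords zs).length) := by
  induction zs generalizing S with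
  | nil =>
    refine Iter.refl.cast (Store.get_injective fun j => ?_) (by simp)
    cases j <;> simp [Store.get_set, hm]
  | cons z zs ih =>
    refine ((Iter.extendMask_bits z (.sep :: encodeWords zs) S (by simpa using hm)).trans
      ((Iter.step (a := .sep) (l := encodeWords zs) ?_ rfl (.seq (.push _ _ _) (.seq (.push _ _ _)
      (.seq (.push _ _ _) (.push _ _ _))))).trans (ih _ ?_))).cast
      (Store.get_injective fun j => ?_) (by simp; omega)
    iterate 2 simp [Store.get_set]
    cases j <;> simp [Store.get_set]

theorem length_encodeWords_map_append (zs : List (List Bool)) (b : Bool) :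
    (encodeWords (zs.map (· ++ [b]))).length ≤ 2 * (encodeWords zs).length := by
  induction zs with
  | nil => simp
  | cons z zs ih => simp; omega

/-- The extensions by 0 are collected on `maskTmp` and those by 1 on `maskRev`. The latter are moved
back last and lie on top, which is the order fixed in `allMasks`. -/
theorem Exec.extendMasks (t : ℕ) (S : Store) (hm : S.get .masks = encodeWords (allMasks t))
    (ht : S.get .maskTmp = []) (hr : S.get .maskRev = []) :
    Exec O .extendMasks S (S.set .masks (encodeWords (allMasks (t + 1))))
      (13 * (encodeWords (allMasks t)).length + 3) := by
  have h₁ := length_encodeWords_map_append (allMasks t) true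
  have h₂ := length_encodeWords_map_append (allMasks t) false
  refine (Exec.seq ((Iter.extendMask _ S hm).exec ?_) (.seq (.move (by decide) _)
    (.move (by decide) _))).cast (Store.get_injective fun j => ?_) ?_
  · simp [Store.get_set]
  · cases j <;> simp [Store.get_set, ht, hr, allMasks]
  · simp only [Store.get_set, ht, hr]
    simp
    omega

/-- Moves the rows to their stack, and generates all masks. -/
def Prog.prepareMasks : Prog :=
  .push .masks .sep ;;
    .each .leftTmp fun a => .push .rows a ;;
      match a with
      | .row => .extendMasks
      | _ => .nop

/-- Each row tag doubles the list of masks. The bound `g` refers to the final list and thus covers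
all intermediate ones. -/
theorem Iter.prepareMasks (rs : List (List Bool)) (t : ℕ) (S : Store)
    (hl : S.get .leftTmp = (encodeTagged .row rs).reverse)
    (hm : S.get .masks = encodeWords (allMasks t))
    (ht : S.get .maskTmp = []) (hr : S.get .maskRev = []) {g : ℕ}
    (hg : 2 ^ (t + rs.length) * (t + rs.length + 1) ≤ g) :
    Iter O .leftTmp (fun _ => false) (fun a => .push .rows a ;;
      match a with
      | .row => .extendMasks
      | _ => .nop) S
      (((S.set .leftTmp []).set .rows (encodeTagged .row rs ++ S.get .rows)).set
        .masks (encodeWords (allMasks (t + rs.length))))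
      ((encodeTagged .row rs).length * (13 * g + 5)) := by
  induction rs using List.reverseRecOn generalizing S t with
  | nil =>
    refine Iter.refl.cast (Store.get_injective fun j => ?_) (by simp)
    cases j <;> simp [Store.get_set, hl, hm]
  | append_singleton rs r ih =>
    have hbits (w : List Bool) (l : List Letter) (S : Store)
        (hm : S.get .leftTmp = bits w ++ l) :
        Iter O .leftTmp (fun _ => false) (fun a => .push .rows a ;;
          match a with
          | .row => .extendMasks
          | _ => .nop) S
          ((S.set .leftTmp l).set .rows ((bits w).reverse ++ S.get .rows)) (3 * w.length) := by
      induction w generalizing S with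
      | nil =>
        refine Iter.refl.cast (Store.get_injective fun j => ?_) (by simp)
        cases j <;> simp [Store.get_set, hm]
      | cons b w ih =>
        refine ((Iter.step (a := .bit b) (l := bits w ++ l) hm rfl
          (.seq (.push _ _ _) (.nop _))).trans (ih _ ?_)).cast
          (Store.get_injective fun j => ?_) (by simp; omega)
        · simp [Store.get_set]
        · cases j <;> simp [Store.get_set]
    -- The rows are read from the last one; after it the masks have length `t + 1`, and the
    -- induction hypothesis is used with that value.
    have hlen : t + (rs ++ [r]).length = t + 1 + rs.length := by simp; omega
    rw [hlen] at hg ⊢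
    have hmt : (encodeWords (allMasks t)).length ≤ g := by
      refine (length_encodeWords_allMasks_le t).trans (le_trans ?_ hg)
      gcongr <;> omega
    refine ((hbits r.reverse (.row :: (encodeTagged .row rs).reverse) S ?_).trans
      ((Iter.step (a := .row) (l := (encodeTagged .row rs).reverse) ?_ rfl
      (.seq (.push _ _ _) (.extendMasks t _ ?_ ?_ ?_))).trans (ih (t + 1) _ ?_ ?_ ?_ ?_ hg))).cast
      (Store.get_injective fun j => ?_) ?_
    iterate 9 simp [Store.get_set, hl, hm, ht, hr]
    · cases j <;> simp [Store.get_set]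
    · simp only [encodeTagged_append, encodeTagged_cons, encodeTagged_nil, List.length_append,
        List.length_cons, List.length_map, List.length_reverse, List.append_nil]
      nlinarith

theorem Exec.prepareMasks (rs : List (List Bool)) (S : Store)
    (hl : S.get .leftTmp = (encodeTagged .row rs).reverse) (hm : S.get .masks = [])
    (ht : S.get .maskTmp = []) (hr : S.get .maskRev = []) (hro : S.get .rows = []) {g : ℕ}
    (hg : 2 ^ rs.length * (rs.length + 1) ≤ g) (hrg : (encodeTagged .row rs).length ≤ g) :
    Exec O .prepareMasks S (((S.set .leftTmp []).set .rows (encodeTagged .row rs)).set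
        .masks (encodeWords (allMasks rs.length))) (g * (13 * g + 5) + 2) := by
  refine (Exec.seq (.push _ _ _) ((Iter.prepareMasks rs 0 _ ?_ ?_ ?_ ?_ (g := g) ?_).exec ?_)).cast
    (Store.get_injective fun j => ?_) ?_
  iterate 4 simp [Store.get_set, hl, hm, ht, hr, allMasks]
  · simpa using hg
  · simp [Store.get_set]
  · cases j <;> simp [Store.get_set, hro]
  · have : (encodeTagged .row rs).length * (13 * g + 5) ≤ g * (13 * g + 5) := by gcongr
    omega

/-! ### The final answer -/

/-- One round of the search for the word without zeros. -/
def Prog.findOnes : Letter → Prog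
  | .bit true => .nop
  | .bit false => .push .fail .top
  | .sep => .pop .fail fun
    | none => .push .found .top
    | some _ => .clear .fail
  | _ => .nop

/-- Leaves a letter on `found` if the table contains the word without zeros, and empties all other
stacks. -/
def Prog.finish : Prog :=
  .each .tables .findOnes ;;
    .pop .found (fun
      | none => .nop
      | some _ => .clear .found ;; .push .found .top) ;;
    .clear .vars ;; .clear .rows ;; .clear .masks

theorem Iter.findOnes_bits (w : List Bool) (l : List Letter) (S : Store)
    (hm : S.get .tables = bits w ++ l) :
    Iter O .tables (fun _ => false) .findOnes S
      ((S.set .tables l).set .fail (List.replicate (w.count false) .top ++ S.get .fail))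
      (2 * w.length) := by
  induction w generalizing S with
  | nil =>
    refine Iter.refl.cast (Store.get_injective fun j => ?_) (by simp)
    cases j <;> simp [Store.get_set, hm]
  | cons b w ih =>
    rcases b with _ | _
    · refine ((Iter.step (f := .findOnes) (a := .bit false) (l := bits w ++ l) hm rfl (.push _ _ _)).trans
        (ih _ ?_)).cast (Store.get_injective fun j => ?_) ?_
      · simp [Store.get_set]
      · cases j <;> simp [Store.get_set, List.replicate_succ']
      · simp; omega
    · refine ((Iter.step (a := .bit true) (l := bits w ++ l) hm rfl (.nop _)).trans
        (ih _ ?_)).cast (Store.get_injective fun j => ?_) (by simp; omega)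
      · simp
      · cases j <;> simp [Store.get_set]

theorem Iter.findOnes (ws : List (List Bool)) (l : List Letter) (S : Store)
    (hm : S.get .tables = encodeWords ws ++ l) (hf : S.get .fail = []) :
    Iter O .tables (fun _ => false) .findOnes S
      ((S.set .tables l).set .found
        (List.replicate (ws.countP fun w => w.count false = 0) .top ++ S.get .found))
      (5 * (encodeWords ws).length) := by
  induction ws generalizing S with
  | nil =>
    refine Iter.refl.cast (Store.get_injective fun j => ?_) (by simp)
    cases j <;> simp [Store.get_set, hm]
  | cons w ws ih =>
    have hlast (S : Store) (hS : S.get .fail = List.replicate (w.count false) .top) :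
        Exec O (.findOnes .sep) S ((S.set .fail []).set .found
          (List.replicate (if w.count false = 0 then 1 else 0) .top ++ S.get .found))
          (2 * w.length + 2) := by
      have hle := List.count_le_length (a := false) (l := w)
      rcases h : w.count false with _ | k
      · rw [h] at hS
        refine (Exec.pop_none (by simpa using hS) (.push _ _ _)).cast
          (Store.get_injective fun j => ?_) (by omega)
        cases j <;> simp [Store.get_set, hS]
      · rw [h, List.replicate_succ] at hS
        refine (Exec.pop_some hS (.clear _ _)).cast (Store.get_injective fun j => ?_) ?_
        · cases j <;> simp [Store.get_set]
        · simp; omega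
    refine ((Iter.findOnes_bits w (.sep :: (encodeWords ws ++ l)) S (by simpa using hm)).trans
      ((Iter.step (a := .sep) (l := encodeWords ws ++ l) ?_ rfl (hlast _ ?_)).trans
      (ih _ ?_ ?_))).cast (Store.get_injective fun j => ?_) (by simp; omega)
    iterate 4 simp [Store.get_set, hf]
    cases j <;> simp [Store.get_set, hf, List.countP_cons, -List.replicate_append_replicate,
      List.replicate_add]

/-- The mask without zeros stands for the full team. The remaining work brings the store into the
form that `Prog.machine_outputs` requires. -/
theorem Exec.finish (ws : List (List Bool)) (S : Store) (hS : S.Clean)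
    (ht : S.get .tables = encodeWords ws ++ [.row]) (hi : S.get .input = [])
    (hto : S.get .tokens = []) (hl : S.get .left = []) (hr : S.get .right = [])
    (hn : S.get .name = []) {g : ℕ} (hvg : (S.get .vars).length ≤ g)
    (hrg : (S.get .rows).length ≤ g) (hmg : (S.get .masks).length ≤ g) (hwg : ws.length ≤ g)
    (hlg : (encodeWords ws).length ≤ g) :
    Exec O .finish S (Store.empty.set .found
      (if ∃ w ∈ ws, false ∉ w then [.top] else [])) (20 * g + 20) := by
  have hf := hS .fail (by decide)
  have hfo := hS .found (by decide)
  set k := ws.countP fun w => w.count false = 0 with hk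
  have hkle : k ≤ ws.length := List.countP_le_length
  have hk0 : k = 0 ↔ ¬ ∃ w ∈ ws, false ∉ w := by
    simp [hk, List.countP_eq_zero, List.count_eq_zero]
  have hlast (S : Store) (hS : S.get .found = List.replicate k .top) :
      Exec O (.pop .found (fun
      | none => .nop
      | some _ => .clear .found ;; .push .found .top)) S (S.set .found
        (if ∃ w ∈ ws, false ∉ w then [.top] else [])) (2 * g + 4) := by
    rcases h : k with _ | k'
    · rw [if_neg (hk0.1 h)]
      rw [h] at hS
      refine (Exec.pop_none (by simpa using hS) (.nop _)).cast
        (Store.get_injective fun j => ?_) (by omega)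
      cases j <;> simp [Store.get_set, hS]
    · rw [if_pos (by by_contra h'; rw [← hk0] at h'; omega)]
      rw [h, List.replicate_succ] at hS
      refine (Exec.pop_some hS (.seq (.clear _ _) (.push _ _ _))).cast
        (Store.get_injective fun j => ?_) ?_
      · cases j <;> simp [Store.get_set]
      · simp; omega
  refine (Exec.seq (((Iter.findOnes ws [.row] S ht hf).trans (Iter.step (a := .row) (l := []) ?_
    rfl (.nop _))).exec ?_) (.seq (hlast _ ?_) (.seq (.clear _ _) (.seq (.clear _ _)
    (.clear _ _))))).cast (Store.get_injective fun j => ?_) ?_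
  iterate 3 simp [Store.get_set, hfo, hk]
  · cases j
    case input | tokens | vars | rows | masks | tables | left | right | name | found =>
      simp [Store.get_set, *]
    all_goals
      simp only [Store.get_set, Store.get_empty, reduceCtorEq, if_false]
      exact hS _ (by decide)
  · simp only [Store.get_set, reduceCtorEq, if_false]
    omega

/-! ### Model checking -/

/-- The condition on the masks of the two parts of a split. -/
def splitCondition : Semantics → Bool → Bool → Bool → Bool
  | .lax, x, y, z => z == (x || y)
  | .strict, x, y, z => z == (x || y) && !(x && y)

/-- One round of the evaluation of the formula. -/
def Prog.token (m : Semantics) : Letter → Prog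
  | .bit b => .push .name (.bit b)
  | .top => .copyMasks ;; .combine fun _ _ _ => true
  | .bot => .copyMasks ;; .combine fun _ _ z => !z
  | .var => .column ;; .combine fun x _ z => !z || x
  | .neg => .column ;; .combine fun x _ z => !z || !x
  | .atom => .atomTable
  | .and => .load .left ;; .load .right ;; .combine fun x y z => x == z && y == z
  | .or => .load .left ;; .load .right ;; .combine (splitCondition m)
  | _ => .nop

/-- The model checking program: it reads the formula from its end, and computes for each subformula
the table of the subteams that satisfy it. -/
def Prog.modelCheck (m : Semantics) : Prog :=
  .split ;; .prepareMasks ;; .each .tokens (.token m) ;; .finish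

/-- The table of a formula, as it is computed from the tables of its subformulas. -/
def tableOf {L : TeamLogic} (m : Semantics) (ns rs zs : List (List Bool))
    (sat : L.Atom → List Bool → Bool) : Formula L → List (List Bool)
  | .top => combineTables (fun _ _ _ => true) zs zs zs
  | .bot => combineTables (fun _ _ z => !z) zs zs zs
  | .var x => combineTables (fun x _ z => !z || x) [column ns rs (Nat.bits x)]
      [column ns rs (Nat.bits x)] zs
  | .neg x => combineTables (fun x _ z => !z || !x) [column ns rs (Nat.bits x)]
      [column ns rs (Nat.bits x)] zs
  | .atom a => zs.filter (sat a)
  | .and φ ψ => combineTables (fun x y z => x == z && y == z) (tableOf m ns rs zs sat φ)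
      (tableOf m ns rs zs sat ψ) zs
  | .or φ ψ => combineTables (splitCondition m) (tableOf m ns rs zs sat φ)
      (tableOf m ns rs zs sat ψ) zs

/-- Every table is obtained by filtering the list of all masks. This keeps the tables small,
whatever the size of the formula. -/
theorem tableOf_sublist {L : TeamLogic} (m : Semantics) (ns rs zs : List (List Bool))
    (sat : L.Atom → List Bool → Bool) (φ : Formula L) :
    (tableOf m ns rs zs sat φ).Sublist zs := by
  cases φ <;> exact List.filter_sublist

/-- The store between the rounds of the evaluation. -/
structure Store.Ready (ns rs zs : List (List Bool)) (S : Store) : Prop where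
  clean : S.Clean
  vars : S.get .vars = (encodeTagged .var ns).reverse
  rows : S.get .rows = encodeTagged .row rs
  masks : S.get .masks = encodeWords zs
  left : S.get .left = []
  right : S.get .right = []
  input : S.get .input = []

theorem Store.Clean.set {S : Store} (h : S.Clean) {k : Stack} (l : List Letter)
    (hk : k ∈ [Stack.input, .tokens, .vars, .rows, .masks, .tables, .left, .right, .name]) :
    (S.set k l).Clean := fun j hj => by
  rw [Store.get_set_of_ne _ (by rintro rfl; exact hj hk)]
  exact h j hj

theorem Store.Ready.set {ns rs zs : List (List Bool)} {S : Store} (h : S.Ready ns rs zs)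
    {k : Stack} (l : List Letter) (hk : k ∈ [Stack.tokens, .tables, .name]) :
    (S.set k l).Ready ns rs zs := by
  obtain ⟨hc, h₁, h₂, h₃, h₄, h₅, h₆⟩ := h
  refine ⟨hc.set l ?_, ?_, ?_, ?_, ?_, ?_, ?_⟩
  · revert hk; revert k; decide
  all_goals
    rw [Store.get_set_of_ne _ (by rintro rfl; revert hk; decide)]
    assumption

theorem Iter.pushName (m : Semantics) (w : List Bool) (l : List Letter) (S : Store)
    (ht : S.get .tokens = bits w ++ l) :
    Iter O .tokens (fun _ => false) (.token m) S
      ((S.set .tokens l).set .name ((bits w).reverse ++ S.get .name)) (2 * w.length) := by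
  induction w generalizing S with
  | nil =>
    refine Iter.refl.cast (Store.get_injective fun j => ?_) (by simp)
    cases j <;> simp [Store.get_set, ht]
  | cons b w ih =>
    refine ((Iter.step (f := .token m) (a := .bit b) (l := bits w ++ l) ht rfl
      (.push _ _ _)).trans (ih _ ?_)).cast (Store.get_injective fun j => ?_) ?_
    · simp [Store.get_set]
    · cases j <;> simp [Store.get_set]
    · simp; omega

/-- A bound for the time that is spent for a letter of the formula. -/
def tokenCost (g τ : ℕ) : ℕ := 300 * (g + 1) ^ 4 + g * τ

/-! ### Cost of evaluating a formula on the stacks -/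

section Evaluation

variable {L : TeamLogic} {m : Semantics} {ns rs zs : List (List Bool)}
  {sat : L.Atom → List Bool → Bool} {g τ : ℕ}

/-- The assumptions on the data of an instance and on the bounds for them. -/
structure Bounded (ns rs zs : List (List Bool)) (g : ℕ) : Prop where
  length_row : ∀ r ∈ rs, r.length = ns.length
  length_mask : ∀ z ∈ zs, z.length = rs.length
  vars_le : (encodeTagged .var ns).length ≤ g
  rows_le : (encodeTagged .row rs).length ≤ g
  masks_le : zs.length ≤ g
  words_le : (encodeWords zs).length ≤ g
  lt : rs.length + 1 ≤ g

theorem le_tokenCost_combine (hg : 1 ≤ g) :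
    100 * (g + 1) ^ 2 + 100 * g ^ 4 + 20 * g + 20 ≤ tokenCost g τ := by
  have h₁ : (g + 1) ^ 2 ≤ (g + 1) ^ 4 := Nat.pow_le_pow_right (by omega) (by omega)
  have h₂ : g ^ 4 ≤ (g + 1) ^ 4 := Nat.pow_le_pow_left (by omega) _
  have h₃ : g + 1 ≤ (g + 1) ^ 4 := Nat.le_self_pow (by omega) _
  unfold tokenCost
  have := Nat.zero_le (g * τ)
  omega

/-- For constants the condition ignores the two operands, but `combine` needs non-empty operand
tables to find a match; the list of all masks plays this role. -/
theorem Iter.formula_constant (hb : Bounded ns rs zs g) {a : Letter}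
    {c : Bool → Bool → Bool → Bool} (ha : Prog.token m a = (.copyMasks ;; .combine c))
    {l : List Letter} {S : Store} (hS : S.Ready ns rs zs) (ht : S.get .tokens = a :: l) :
    Iter O .tokens (fun _ => false) (.token m) S
      ((S.set .tokens l).set .tables
        (encodeWords (combineTables c zs zs zs) ++ .row :: S.get .tables))
      (tokenCost g τ) := by
  have hcost := le_tokenCost_combine (g := g) (τ := τ) (by have := hb.lt; omega)
  have hS' := hS.set (k := .tokens) l (by decide)
  refine (Iter.step ht rfl (n := 6 * (encodeWords zs).length + 2 + 100 * g ^ 4) (by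
    rw [ha]
    exact .seq (.copyMasks _ (encodeWords zs) hS'.clean hS'.masks hS'.left hS'.right)
      (.combine c rs.length g zs zs zs _ ((hS'.clean.set _ (by decide)).set _ (by decide))
        (by simp [Store.get_set]) (by simp)
        (by simpa [Store.get_set] using hS.masks) hb.length_mask hb.length_mask hb.length_mask
        hb.lt hb.masks_le hb.masks_le hb.masks_le))).cast (Store.get_injective fun j => ?_) ?_
  · cases j <;> simp [Store.get_set, hS.left, hS.right]
  · have := hb.words_le
    omega

theorem Iter.formula_literal (hb : Bounded ns rs zs g) {a : Letter} {w : List Bool}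
    {c : Bool → Bool → Bool → Bool} (ha : Prog.token m a = (.column ;; .combine c))
    (hw : (column ns rs w).length = rs.length) (hwg : w.length ≤ g)
    {l : List Letter} {S : Store} (hS : S.Ready ns rs zs) (hn : S.get .name = [])
    (ht : S.get .tokens = (a :: bits w).reverse ++ l) :
    Iter O .tokens (fun _ => false) (.token m) S
      ((S.set .tokens l).set .tables
        (encodeWords (combineTables c [column ns rs w] [column ns rs w] zs)
          ++ .row :: S.get .tables))
      (tokenCost g τ) := by
  have hlt := hb.lt
  have hcost := le_tokenCost_combine (g := g) (τ := τ) (by omega)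
  have hS' := ((hS.set (k := .tokens) (a :: l) (by decide)).set (k := .name)
    (bits w) (by decide)).set (k := .tokens) l (by decide)
  refine (((Iter.pushName m w.reverse (a :: l) S (by simpa using ht)).cast
    (S'' := (S.set .tokens (a :: l)).set .name (bits w)) (by simp [hn]) le_rfl).trans
    (Iter.step (a := a) (l := l) (by simp [Store.get_set]) rfl
      (n := 100 * (g + 1) ^ 2 + 100 * g ^ 4) (by
    rw [ha]
    exact .seq (.column ns rs w _ hS'.clean (by simp [Store.get_set]) hS'.vars hS'.rows hS'.left
        hS'.right hb.length_row hwg hb.vars_le hb.rows_le)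
      (.combine c rs.length g [column ns rs w] [column ns rs w] zs _
        (((hS'.clean.set _ (by decide)).set _ (by decide)).set _ (by decide))
        (by simp [Store.get_set]) (by simp)
        (by simpa [Store.get_set] using hS.masks) (by simpa using hw) (by simpa using hw)
        hb.length_mask hlt (by simp; omega) (by simp; omega) hb.masks_le)))).cast
    (Store.get_injective fun j => ?_) ?_
  · cases j <;> simp [Store.get_set, hS.left, hS.right, hn]
  · simp only [List.length_reverse]
    omega

theorem Iter.formula_connective (hb : Bounded ns rs zs g) {a : Letter} {xs ys : List (List Bool)}
    {c : Bool → Bool → Bool → Bool}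
    (ha : Prog.token m a = (.load .left ;; .load .right ;; .combine c))
    (hx : xs.Sublist zs) (hy : ys.Sublist zs) {l ts : List Letter} {S : Store}
    (hS : S.Ready ns rs zs) (ht : S.get .tokens = a :: l)
    (hts : S.get .tables = encodeWords xs ++ .row :: (encodeWords ys ++ .row :: ts)) :
    Iter O .tokens (fun _ => false) (.token m) S
      ((S.set .tokens l).set .tables (encodeWords (combineTables c xs ys zs) ++ .row :: ts))
      (tokenCost g τ) := by
  have hlt := hb.lt
  have hcost := le_tokenCost_combine (g := g) (τ := τ) (by omega)
  have hS' := hS.set (k := .tokens) l (by decide)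
  have hlTmp := hS.clean .leftTmp (by decide)
  have hsub {xs : List (List Bool)} (hx : xs.Sublist zs) : (encodeWords xs).length ≤ g :=
    (List.Sublist.length_le (hx.flatMap _)).trans hb.words_le
  have hxg := hsub hx
  have hyg := hsub hy
  refine (Iter.step ht rfl (n := 4 * (encodeWords xs).length + 2 + (4 * (encodeWords ys).length + 2
      + 100 * g ^ 4)) (by
    rw [ha]
    exact .seq (.load (by decide) (by decide) xs (encodeWords ys ++ .row :: ts) _
        (by simpa [Store.get_set] using hts) (by simpa [Store.get_set] using hlTmp) hS'.left)
      (.seq (.load (by decide) (by decide) ys ts _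
        (by simp [Store.get_set]) (by simpa [Store.get_set] using hlTmp)
        (by simpa [Store.get_set] using hS.right))
      (.combine c rs.length g xs ys zs _
        ((((hS'.clean.set _ (by decide)).set _ (by decide)).set _ (by decide)).set _ (by decide))
        (by simp [Store.get_set]) (by simp)
        (by simpa [Store.get_set] using hS.masks)
        (fun x h => hb.length_mask x (hx.subset h)) (fun x h => hb.length_mask x (hy.subset h))
        hb.length_mask hlt (hx.length_le.trans hb.masks_le) (hy.length_le.trans hb.masks_le)
        hb.masks_le)))).cast (Store.get_injective fun j => ?_) ?_
  · cases j <;> simp [Store.get_set, hS.left, hS.right]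
  · omega

/-- Prefix notation read from its end is postfix evaluation: the right operand is treated first,
then the left one, whose table therefore lies on top when the connective is reached. -/
theorem Iter.formula_binary (hb : Bounded ns rs zs g) {a : Letter} {xs ys : List (List Bool)}
    {c : Bool → Bool → Bool → Bool}
    (ha : Prog.token m a = (.load .left ;; .load .right ;; .combine c))
    (hx : xs.Sublist zs) (hy : ys.Sublist zs) {us vs : List Letter}
    (hu : ∀ (l : List Letter) (S : Store), S.Ready ns rs zs → S.get .name = [] →
      S.get .tokens = us.reverse ++ l → Iter O .tokens (fun _ => false) (.token m) S
        ((S.set .tokens l).set .tables (encodeWords xs ++ .row :: S.get .tables))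
        (us.length * tokenCost g τ))
    (hv : ∀ (l : List Letter) (S : Store), S.Ready ns rs zs → S.get .name = [] →
      S.get .tokens = vs.reverse ++ l → Iter O .tokens (fun _ => false) (.token m) S
        ((S.set .tokens l).set .tables (encodeWords ys ++ .row :: S.get .tables))
        (vs.length * tokenCost g τ))
    {l : List Letter} {S : Store} (hS : S.Ready ns rs zs) (hn : S.get .name = [])
    (ht : S.get .tokens = (a :: (us ++ vs)).reverse ++ l) :
    Iter O .tokens (fun _ => false) (.token m) S
      ((S.set .tokens l).set .tables
        (encodeWords (combineTables c xs ys zs) ++ .row :: S.get .tables))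
      ((us.length + vs.length + 1) * tokenCost g τ) := by
  have h₁ := hv (us.reverse ++ a :: l) S hS hn (by simp [ht])
  have hS₁ := (hS.set (k := .tokens) (us.reverse ++ a :: l) (by decide)).set (k := .tables)
    (encodeWords ys ++ .row :: S.get .tables) (by decide)
  have h₂ := hu (a :: l) _ hS₁ (by simpa [Store.get_set] using hn) (by simp [Store.get_set])
  have hS₂ := (hS₁.set (k := .tokens) (a :: l) (by decide)).set (k := .tables)
    (encodeWords xs ++ .row :: (encodeWords ys ++ .row :: S.get .tables)) (by decide)
  have h₃ := Iter.formula_connective (O := O) (m := m) (g := g) (τ := τ) (l := l)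
    (ts := S.get .tables) hb ha hx hy hS₂ (by simp [Store.get_set]) (by simp)
  refine ((h₁.trans (h₂.cast ?_ le_rfl)).trans h₃).cast (Store.get_injective fun j => ?_) ?_
  · simp
  · cases j <;> simp [Store.get_set]
  · exact le_of_eq (by ring)

/-- Induction on the formula, with the remaining tokens and the store kept general. The oracle is
assumed correct only for atoms over `D` with short words, since only these are legitimate instances
of atom checking with a known time bound. -/
theorem Iter.formula (hb : Bounded ns rs zs g) (D : Finset ℕ)
    (hO : ∀ a : L.Atom, (∀ x ∈ L.args a, x ∈ D) → (L.word a).length ≤ g → ∀ z ∈ zs,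
      O (bits (L.word a) ++ .sep :: (encodeTagged .var ns ++ encodeTagged .row (select z rs)))
        (sat a z) τ)
    (hcol : ∀ x ∈ D, (TeamSemantics.column ns rs (Nat.bits x)).length = rs.length)
    (φ : Formula L) (hφ : φ.vars ⊆ D) (hg : (encodeFormula φ).length ≤ g)
    (l : List Letter) (S : Store) (hS : S.Ready ns rs zs) (hn : S.get .name = [])
    (ht : S.get .tokens = (encodeFormula φ).reverse ++ l) :
    Iter O .tokens (fun _ => false) (.token m) S
      ((S.set .tokens l).set .tables
        (encodeWords (tableOf m ns rs zs sat φ) ++ .row :: S.get .tables))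
      ((encodeFormula φ).length * tokenCost g τ) := by
  induction φ generalizing l S with
  | top => exact (Iter.formula_constant (τ := τ) hb rfl hS ht).cast rfl (by simp [encodeFormula])
  | bot => exact (Iter.formula_constant (τ := τ) hb rfl hS ht).cast rfl (by simp [encodeFormula])
  | var x =>
    exact (Iter.formula_literal (τ := τ) hb rfl (hcol x (hφ (by simp [Formula.vars])))
      (by simp [encodeFormula] at hg; omega) hS hn ht).cast rfl
      (Nat.le_mul_of_pos_left _ (by simp [encodeFormula]))
  | neg x =>
    exact (Iter.formula_literal (τ := τ) hb rfl (hcol x (hφ (by simp [Formula.vars])))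
      (by simp [encodeFormula] at hg; omega) hS hn ht).cast rfl
      (Nat.le_mul_of_pos_left _ (by simp [encodeFormula]))
  | atom a =>
    have hwg : (L.word a).length ≤ g := by simp [encodeFormula] at hg; omega
    have hS' := ((hS.set (k := .tokens) (.atom :: l) (by decide)).set (k := .name)
      (bits (L.word a)) (by decide)).set (k := .tokens) l (by decide)
    refine (((Iter.pushName m (L.word a).reverse (.atom :: l) S (by
      simpa [encodeFormula] using ht)).cast
      (S'' := (S.set .tokens (.atom :: l)).set .name (bits (L.word a))) (by simp [hn]) le_rfl).trans
      (Iter.step (f := .token m) (a := .atom) (l := l) (by simp [Store.get_set]) rfl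
        (.atomTable (encodeTagged .var ns) rs zs (L.word a) (sat a) τ _ hS'.clean
          (hO a (fun x hx => hφ (by simpa [Formula.vars] using hx)) hwg)
          (by simp [Store.get_set]) hS'.vars hS'.rows hS'.masks hb.length_mask hwg hb.vars_le
          hb.rows_le hb.masks_le))).cast
      (Store.get_injective fun j => ?_) ?_
    · cases j <;> simp [Store.get_set, hn, tableOf]
    · refine le_trans ?_ (Nat.le_mul_of_pos_left _ (by simp [encodeFormula]))
      have h₁ : (g + 1) ^ 2 ≤ (g + 1) ^ 4 := Nat.pow_le_pow_right (by omega) (by omega)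
      have h₃ : g + 1 ≤ (g + 1) ^ 4 := Nat.le_self_pow (by omega) _
      simp only [tokenCost, List.length_reverse]
      omega
  | and φ ψ ihφ ihψ =>
    have hlen : (encodeFormula (φ.and ψ)).length
      = (encodeFormula φ).length + (encodeFormula ψ).length + 1 := by simp [encodeFormula]
    rw [hlen] at hg ⊢
    simp only [Formula.vars, Finset.union_subset_iff] at hφ
    exact Iter.formula_binary hb rfl (tableOf_sublist m ns rs zs sat φ)
      (tableOf_sublist m ns rs zs sat ψ) (ihφ hφ.1 (by omega)) (ihψ hφ.2 (by omega)) hS hn ht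
  | or φ ψ ihφ ihψ =>
    have hlen : (encodeFormula (φ.or ψ)).length
      = (encodeFormula φ).length + (encodeFormula ψ).length + 1 := by simp [encodeFormula]
    rw [hlen] at hg ⊢
    simp only [Formula.vars, Finset.union_subset_iff] at hφ
    exact Iter.formula_binary hb rfl (tableOf_sublist m ns rs zs sat φ)
      (tableOf_sublist m ns rs zs sat ψ) (ihφ hφ.1 (by omega)) (ihψ hφ.2 (by omega)) hS hn ht

theorem isSep_of_mem_encodeFormula (φ : Formula L) : ∀ a ∈ encodeFormula φ, isSep a = false := by
  induction φ with
  | and φ ψ ihφ ihψ | or φ ψ ihφ ihψ =>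
    simp only [encodeFormula, List.mem_cons, List.mem_append]
    rintro a (rfl | h | h)
    · rfl
    · exact ihφ a h
    · exact ihψ a h
  | top | bot => simp [encodeFormula, isSep]
  | var | neg | atom =>
    simp only [encodeFormula, List.mem_cons, List.mem_map]
    rintro a (rfl | ⟨b, -, rfl⟩) <;> rfl

theorem isRow_of_mem_encodeTagged_var (ns : List (List Bool)) :
    ∀ a ∈ encodeTagged .var ns, isRow a = false := by
  induction ns with
  | nil => simp
  | cons n ns ih =>
    simp only [encodeTagged_cons, List.mem_cons, List.mem_append, List.mem_map]
    rintro a (rfl | ⟨b, -, rfl⟩ | h)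
    · rfl
    · rfl
    · exact ih a h

theorem Exec.modelCheck (hb : Bounded ns rs (allMasks rs.length) g) (D : Finset ℕ)
    (hO : ∀ a : L.Atom, (∀ x ∈ L.args a, x ∈ D) → (L.word a).length ≤ g →
      ∀ z ∈ allMasks rs.length,
      O (bits (L.word a) ++ .sep :: (encodeTagged .var ns ++ encodeTagged .row (select z rs)))
        (sat a z) τ)
    (hcol : ∀ x ∈ D, (TeamSemantics.column ns rs (Nat.bits x)).length = rs.length)
    (φ : Formula L) (hφ : φ.vars ⊆ D) (hg : (encodeFormula φ).length ≤ g)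
    (hg' : 2 ^ rs.length * (rs.length + 1) ≤ g) :
    Exec O (.modelCheck m) (Store.empty.set .input
      (encodeFormula φ ++ .sep :: (encodeTagged .var ns ++ encodeTagged .row rs)))
      (Store.empty.set .found (if ∃ w ∈ tableOf m ns rs (allMasks rs.length) sat φ, false ∉ w
        then [.top] else [])) (100 * (g + 1) ^ 2 + g * tokenCost g τ) := by
  set S : Store := (((Store.empty.set .tokens (encodeFormula φ).reverse).set .vars
    (encodeTagged .var ns).reverse).set .rows (encodeTagged .row rs)).set .masks
      (encodeWords (allMasks rs.length)) with hSdef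
  have hready : S.Ready ns rs (allMasks rs.length) := by
    refine ⟨?_, ?_, ?_, ?_, ?_, ?_, ?_⟩
    · have h : Store.empty.Clean := fun _ _ => rfl
      exact (((h.set _ (by decide)).set _ (by decide)).set _ (by decide)).set _ (by decide)
    all_goals simp [hSdef, Store.get_set]
  have hb₁ := hb.vars_le
  have hb₂ := hb.rows_le
  have hb₃ := hb.words_le
  have hsub := tableOf_sublist m ns rs (allMasks rs.length) sat φ
  refine (Exec.seq (.split (encodeFormula φ) (encodeTagged .var ns) rs
    (isSep_of_mem_encodeFormula φ) (isRow_of_mem_encodeTagged_var ns)) (.seq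
    ((Exec.prepareMasks rs _ ?_ ?_ ?_ ?_ ?_ hg' hb.rows_le).cast
      (S'' := S) (Store.get_injective fun j => ?_) le_rfl)
    (.seq ((Iter.formula (m := m) hb D hO hcol φ hφ hg [] S hready ?_ ?_).exec ?_)
    (.finish (tableOf m ns rs (allMasks rs.length) sat φ) _ ?_ ?_ ?_ ?_ ?_ ?_ ?_ (g := g)
      ?_ ?_ ?_ ?_ ?_)))).mono ?_
  iterate 5 simp [Store.get_set]
  · cases j <;> simp [hSdef, Store.get_set]
  iterate 3 simp [hSdef, Store.get_set]
  · exact (hready.clean.set _ (by decide)).set _ (by decide)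
  iterate 6 simp [hSdef, Store.get_set]
  · simpa [hSdef, Store.get_set] using hb₁
  · simpa [hSdef, Store.get_set] using hb₂
  · simpa [hSdef, Store.get_set] using hb₃
  · exact hsub.length_le.trans hb.masks_le
  · exact (List.Sublist.length_le (hsub.flatMap _)).trans hb.words_le
  · have h₁ : (encodeFormula φ).length * tokenCost g τ ≤ g * tokenCost g τ := by gcongr
    simp only [List.length_append, List.length_cons]
    nlinarith

end Evaluation

/-! ### Tables and teams -/

section Masks

variable {α : Type}

theorem select_sublist (z : List Bool) (l : List α) : (select z l).Sublist l := by
  induction l generalizing z with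
  | nil => cases z <;> simp [select]
  | cons r l ih =>
    rcases z with _ | ⟨b, z⟩
    · simp [select]
    · cases b
      · simpa [select] using (ih z).cons r
      · simpa [select] using (ih z)

theorem select_map {β : Type} (f : α → β) (z : List Bool) (l : List α) :
    select z (l.map f) = (select z l).map f := by
  induction l generalizing z with
  | nil => cases z <;> simp [select]
  | cons r l ih =>
    rcases z with _ | ⟨b, z⟩
    · simp [select]
    · cases b <;> simp [select, ih]

theorem select_map_self (p : α → Bool) (l : List α) : select (l.map p) l = l.filter p := by
  induction l with
  | nil => simp [select]
  | cons r l ih => cases h : p r <;> simp [select, ih, h]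

theorem failures_map_eq_zero (c : Bool → Bool → Bool → Bool) (p q r : α → Bool) (l : List α) :
    failures c (l.map p) (l.map q) (l.map r) = 0 ↔ ∀ s ∈ l, c (p s) (q s) (r s) = true := by
  induction l with
  | nil => simp [failures]
  | cons s l ih => simp [failures, ih, and_comm]

/-- Without repetitions in `l`, a mask can be recovered from the set that it selects; masks and
subteams thus correspond one to one. -/
theorem map_mem_select [DecidableEq α] {l : List α} (hl : l.Nodup) {z : List Bool}
    (hz : z.length = l.length) : l.map (fun s => decide (s ∈ (select z l).toFinset)) = z := by
  induction l generalizing z with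
  | nil => simpa using (List.length_eq_zero_iff.1 hz).symm
  | cons r l ih =>
    rcases z with _ | ⟨b, z⟩
    · simp at hz
    · rw [List.nodup_cons] at hl
      have hr : r ∉ select z l := fun h => hl.1 ((select_sublist z l).subset h)
      conv_rhs => rw [← ih hl.2 (z := z) (by simpa using hz)]
      cases b
      · simp [select, hr]
      · simp only [select, if_true, List.map_cons, List.cons.injEq]
        refine ⟨by simp, List.map_congr_left fun s hs => ?_⟩
        have : s ≠ r := by rintro rfl; exact hl.1 hs
        simp [this]

/-- The variables of a team are distinct, so the flags select at most one bit per row. -/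
theorem pick_map_beq {f : ℕ → Bool} {l : List ℕ} (hl : l.Nodup) (x : ℕ) :
    pick (l.map fun v => v == x) (l.map f) = if x ∈ l then [f x] else [] := by
  induction l with
  | nil => simp [pick]
  | cons v l ih =>
    rw [List.nodup_cons] at hl
    by_cases h : v = x
    · subst h
      simp [pick, ih hl.2, hl.1]
    · simp [pick, ih hl.2, h, Ne.symm h]

end Masks

theorem mem_combineTables {c : Bool → Bool → Bool → Bool} {xs ys zs : List (List Bool)}
    {z : List Bool} : z ∈ combineTables c xs ys zs ↔
      z ∈ zs ∧ ∃ x ∈ xs, ∃ y ∈ ys, failures c x y z = 0 := by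
  simp [combineTables, matches₂, matches₁, List.sum_eq_zero_iff, List.countP_eq_zero]

theorem bits_injective : Function.Injective Nat.bits := fun x y h => by
  have := Nat.digits_two_eq_bits x
  rw [h, ← Nat.digits_two_eq_bits y] at this
  exact Nat.digits_inj_iff.1 this

/-! ### Correctness of the tables, and encodings of subteams -/

section Teams

variable {D : Finset ℕ}

theorem Assignment.values_injective : Function.Injective (Assignment.values (D := D)) :=
  fun s t h => by
  funext ⟨x, hx⟩
  have := (List.map_inj_left.1 h) x (by simpa using hx)
  simpa [Assignment.val, hx] using this

theorem column_values (ls : List (Assignment D)) {x : ℕ} (hx : x ∈ D) :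
    column ((D.sort (· ≤ ·)).map Nat.bits) (ls.map Assignment.values) (Nat.bits x)
      = ls.map fun s => s.val x := by
  have h (v : ℕ) : (Nat.bits v == Nat.bits x) = (v == x) := by
    rw [Bool.eq_iff_iff]; simp [bits_injective.eq_iff]
  induction ls with
  | nil => rfl
  | cons s ls ih =>
    simp only [column, List.map_cons, List.flatMap_cons] at ih ⊢
    rw [ih]
    simp only [List.map_map, Function.comp_def, h, Assignment.values,
      pick_map_beq (D.sort_nodup _)]
    simp [hx]

/-- The mask of a subteam. -/
def mask (ls : List (Assignment D)) (T : Team D) : List Bool := ls.map fun s => decide (s ∈ T)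

/-- Replaces the search over words by one over subteams. Operands contain only masks of the right
length, so each of their words is the mask of the subteam that it selects. -/
theorem exists_mem_combineTables {c : Bool → Bool → Bool → Bool} {ls : List (Assignment D)}
    (hl : ls.Nodup) {xs ys : List (List Bool)} (hx : xs.Sublist (allMasks ls.length))
    (hy : ys.Sublist (allMasks ls.length)) (T : Team D) :
    mask ls T ∈ combineTables c xs ys (allMasks ls.length) ↔
      ∃ T₁ ⊆ ls.toFinset, ∃ T₂ ⊆ ls.toFinset, mask ls T₁ ∈ xs ∧ mask ls T₂ ∈ ys ∧
        ∀ s ∈ ls, c (decide (s ∈ T₁)) (decide (s ∈ T₂)) (decide (s ∈ T)) = true := by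
  rw [mem_combineTables, mem_allMasks]
  have hsub (z : List Bool) : (select z ls).toFinset ⊆ ls.toFinset := fun s hs => by
    simpa using (select_sublist z ls).subset (by simpa using hs)
  constructor
  · rintro ⟨-, x, hxs, y, hys, h⟩
    have hx' := map_mem_select hl (mem_allMasks.1 (hx.subset hxs))
    have hy' := map_mem_select hl (mem_allMasks.1 (hy.subset hys))
    refine ⟨_, hsub x, _, hsub y, by rwa [mask, hx'], by rwa [mask, hy'], ?_⟩
    rw [← hx', ← hy', mask, failures_map_eq_zero] at h
    exact h
  · rintro ⟨T₁, -, T₂, -, h₁, h₂, h⟩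
    exact ⟨by simp [mask], _, h₁, _, h₂, (failures_map_eq_zero ..).2 h⟩

theorem exists_mem_combineTables_singleton {c : Bool → Bool → Bool → Bool}
    {ls : List (Assignment D)} (p : Assignment D → Bool) (T : Team D) :
    mask ls T ∈ combineTables c [ls.map p] [ls.map p] (allMasks ls.length) ↔
      ∀ s ∈ ls, c (p s) (p s) (decide (s ∈ T)) = true := by
  simp only [mem_combineTables, mem_allMasks, mask, List.length_map, true_and,
    List.mem_singleton, exists_eq_left, failures_map_eq_zero]

open Classical in
-- Correctness of the algorithm. The statement is for all subteams at once, since a split refers to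
-- arbitrary subteams of the given one.
theorem mask_mem_tableOf {L : TeamLogic} (m : Semantics) {ls : List (Assignment D)}
    (hl : ls.Nodup) (φ : Formula L) (hφ : φ.vars ⊆ D) {T : Team D} (hT : T ⊆ ls.toFinset) :
    mask ls T ∈ tableOf m ((D.sort (· ≤ ·)).map Nat.bits) (ls.map Assignment.values)
      (allMasks ls.length) (fun a z => decide (L.AtomSat D (select z ls).toFinset a)) φ ↔
      φ.Sat m T := by
  have hT' : ∀ s ∈ T, s ∈ ls := fun s hs => by simpa using hT hs
  have hmask : ∀ T : Team D, mask ls T ∈ allMasks ls.length := fun T => by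
    simp [mem_allMasks, mask]
  induction φ generalizing T with
  | top =>
    simp only [tableOf, Formula.Sat, exists_mem_combineTables hl (.refl _) (.refl _), iff_true]
    exact ⟨∅, by simp, ∅, by simp, hmask _, hmask _, fun _ _ => trivial⟩
  | bot =>
    simp only [tableOf, Formula.Sat, exists_mem_combineTables hl (.refl _) (.refl _)]
    constructor
    · rintro ⟨_, -, _, -, -, -, h⟩
      exact Finset.eq_empty_of_forall_notMem fun s hs => by simpa [hs] using h s (hT' s hs)
    · rintro rfl
      exact ⟨∅, by simp, ∅, by simp, hmask _, hmask _, fun _ _ => by simp⟩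
  | var x =>
    rw [tableOf, column_values ls (hφ (by simp [Formula.vars])), exists_mem_combineTables_singleton]
    simp only [Formula.Sat]
    refine ⟨fun h s hs => by simpa [hs] using h s (hT' s hs), fun h s _ => ?_⟩
    by_cases hs : s ∈ T <;> simp [hs]
    exact h s hs
  | neg x =>
    rw [tableOf, column_values ls (hφ (by simp [Formula.vars])), exists_mem_combineTables_singleton]
    simp only [Formula.Sat]
    refine ⟨fun h s hs => by simpa [hs] using h s (hT' s hs), fun h s _ => ?_⟩
    by_cases hs : s ∈ T <;> simp [hs]
    exact h s hs
  | atom a =>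
    have : (select (mask ls T) ls).toFinset = T := by
      rw [mask, select_map_self]
      ext s
      simpa using hT' s
    simp [tableOf, Formula.Sat, hmask, this]
  | and φ ψ ihφ ihψ =>
    simp only [Formula.vars, Finset.union_subset_iff] at hφ
    rw [tableOf, exists_mem_combineTables hl (tableOf_sublist ..) (tableOf_sublist ..), Formula.Sat]
    constructor
    · rintro ⟨T₁, h₁, T₂, h₂, hT₁, hT₂, h⟩
      simp only [Bool.and_eq_true, beq_iff_eq, decide_eq_decide] at h
      -- The condition for conjunction forces both operand masks to agree with that of `T`.
      have e₂ : T₂ = T := by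
        ext s
        refine ⟨fun hs => ?_, fun hs => ?_⟩
        · exact (h s (by simpa using h₂ hs)).2.1 hs
        · exact (h s (hT' s hs)).2.2 hs
      have e₁ : T₁ = T := by
        ext s
        refine ⟨fun hs => ?_, fun hs => ?_⟩
        · have := h s (by simpa using h₁ hs)
          exact this.1.1 hs
        · have := h s (hT' s hs)
          exact this.1.2 hs
      subst e₁ e₂
      exact ⟨(ihφ hφ.1 hT hT').1 hT₁, (ihψ hφ.2 hT hT').1 hT₂⟩
    · rintro ⟨h₁, h₂⟩
      exact ⟨T, hT, T, hT, (ihφ hφ.1 hT hT').2 h₁, (ihψ hφ.2 hT hT').2 h₂, by simp⟩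
  | or φ ψ ihφ ihψ =>
    simp only [Formula.vars, Finset.union_subset_iff] at hφ
    rw [tableOf, exists_mem_combineTables hl (tableOf_sublist ..) (tableOf_sublist ..), Formula.Sat]
    have hcond (x y z : Bool) : splitCondition m x y z = true ↔
        z = (x || y) ∧ (m = .strict → (x && y) = false) := by
      cases m <;> cases x <;> simp [splitCondition]
    simp only [hcond]
    constructor
    · rintro ⟨T₁, h₁, T₂, h₂, hT₁, hT₂, h⟩
      refine ⟨T₁, T₂, ?_, fun hm => ?_, (ihφ hφ.1 h₁ fun s hs => by simpa using h₁ hs).1 hT₁,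
        (ihψ hφ.2 h₂ fun s hs => by simpa using h₂ hs).1 hT₂⟩
      · ext s
        by_cases hs : s ∈ ls
        · have := (h s hs).1
          rw [← Bool.decide_or, decide_eq_decide] at this
          rw [Finset.mem_union, this]
        -- The condition speaks only of assignments in `ls`; outside of it all three teams are
        -- empty.
        · have hs₁ : s ∉ T₁ := fun hh => hs (by simpa using h₁ hh)
          have hs₂ : s ∉ T₂ := fun hh => hs (by simpa using h₂ hh)
          have hs₃ : s ∉ T := fun hh => hs (hT' s hh)
          simp [hs₁, hs₂, hs₃]
      · rw [Finset.disjoint_left]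
        intro s hs₁ hs₂
        simpa [hs₁, hs₂] using (h s (by simpa using h₁ hs₁)).2 hm
    · rintro ⟨T₁, T₂, rfl, hd, hs₁, hs₂⟩
      have h₁ := Finset.union_subset_left hT
      have h₂ := Finset.union_subset_right hT
      refine ⟨T₁, h₁, T₂, h₂, (ihφ hφ.1 h₁ fun s hs => by simpa using h₁ hs).2 hs₁,
        (ihψ hφ.2 h₂ fun s hs => by simpa using h₂ hs).2 hs₂, fun s hs => ⟨by simp, fun hm => ?_⟩⟩
      have : s ∈ T₁ → s ∉ T₂ := fun h => Finset.disjoint_left.1 (hd hm) h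
      by_cases h : s ∈ T₁ <;> simp_all

open Classical in
theorem exists_mem_tableOf_iff {L : TeamLogic} (m : Semantics) {ls : List (Assignment D)}
    (hl : ls.Nodup) (φ : Formula L) (hφ : φ.vars ⊆ D) :
    (∃ w ∈ tableOf m ((D.sort (· ≤ ·)).map Nat.bits) (ls.map Assignment.values)
      (allMasks ls.length) (fun a z => decide (L.AtomSat D (select z ls).toFinset a)) φ, false ∉ w) ↔
      φ.Sat m ls.toFinset := by
  rw [← mask_mem_tableOf m hl φ hφ (Finset.Subset.refl _)]
  constructor
  · rintro ⟨w, hw, hf⟩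
    have hlen := mem_allMasks.1 ((tableOf_sublist ..).subset hw)
    convert hw
    have h₁ : mask ls ls.toFinset = List.replicate ls.length true := by
      rw [List.eq_replicate_iff]; simp [mask]
    rw [h₁, ← hlen, eq_comm, List.eq_replicate_iff]
    exact ⟨rfl, fun b hb => by cases b <;> simp_all⟩
  · exact fun h => ⟨_, h, by simp [mask]⟩

theorem encodeTeam_eq (T : Team D) : encodeTeam T
    = encodeTagged .var ((D.sort (· ≤ ·)).map Nat.bits)
      ++ encodeTagged .row ((T.image Assignment.values).sort (· ≤ ·)) := by
  simp [encodeTeam, encodeTagged, List.flatMap_map]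

/-- Lists the team in the order of the rows in its encoding, so that positions in masks match rows
of the table. -/
theorem exists_list_values (T : Team D) : ∃ ls : List (Assignment D), ls.Nodup ∧
    ls.toFinset = T ∧ ls.map Assignment.values = (T.image Assignment.values).sort (· ≤ ·) := by
  obtain ⟨ls, hls⟩ : ∃ ls : List (Assignment D),
      ls.map Assignment.values = (T.image Assignment.values).sort (· ≤ ·) := by
    have : (T.image Assignment.values).sort (· ≤ ·) ∈
        Set.range (List.map (Assignment.values (D := D))) := by
      rw [Set.range_list_map]
      intro v hv
      rw [Finset.mem_sort, Finset.mem_image] at hv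
      exact ⟨_, hv.choose_spec.2⟩
    exact this
  refine ⟨ls, .of_map _ (hls ▸ Finset.sort_nodup _ _), ?_, hls⟩
  apply Finset.image_injective Assignment.values_injective
  ext v
  rw [← Finset.mem_sort (· ≤ ·) (s := T.image Assignment.values), ← hls]
  simp

/-- A sublist of a sorted list is sorted. Deleting rows therefore yields exactly the encoding of the
subteam, and the query needs no sorting. -/
theorem encodeTeam_select {T : Team D} {ls : List (Assignment D)}
    (h : ls.map Assignment.values = (T.image Assignment.values).sort (· ≤ ·)) (z : List Bool) :
    encodeTeam (select z ls).toFinset = encodeTagged .var ((D.sort (· ≤ ·)).map Nat.bits)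
      ++ encodeTagged .row (select z (ls.map Assignment.values)) := by
  have himg : (select z ls).toFinset.image Assignment.values
      = ((select z ls).map Assignment.values).toFinset := by ext v; simp
  rw [encodeTeam_eq, select_map, himg]
  have hsub : ((select z ls).map Assignment.values).Sublist
      ((T.image Assignment.values).sort (· ≤ ·)) := h ▸ (select_sublist z ls).map _
  rw [(List.toFinset_sort (· ≤ ·) (hsub.nodup (Finset.sort_nodup _ _))).2
    ((Finset.pairwise_sort _ _).sublist hsub)]

end Teams

open Turing

/-! ### The running time -/

theorem TM2OutputsInTime.mono {tm : FinTM2} {l : List (tm.Γ tm.k₀)} {l' : Option (List (tm.Γ tm.k₁))}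
    {n n' : ℕ} (hn : n ≤ n') : Nonempty (TM2OutputsInTime tm l l' n) →
      Nonempty (TM2OutputsInTime tm l l' n') :=
  fun ⟨h⟩ => ⟨⟨h.toEvalsTo, h.steps_le_m.trans hn⟩⟩

/-- Separates the factor that depends on the parameter from the one that depends on the input
length. -/
theorem eval_mul_le (p : Polynomial ℕ) {a : ℕ} (ha : 0 < a) (b : ℕ) :
    p.eval (a * b) ≤ a ^ p.natDegree * p.eval b := by
  rw [Polynomial.eval_eq_sum_range, Polynomial.eval_eq_sum_range, Finset.mul_sum]
  refine Finset.sum_le_sum fun i hi => ?_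
  have : a ^ i ≤ a ^ p.natDegree := Nat.pow_le_pow_right ha (by simpa [Nat.lt_succ_iff] using hi)
  calc p.coeff i * (a * b) ^ i = a ^ i * (p.coeff i * b ^ i) := by ring
    _ ≤ _ := by gcongr

theorem eval_mono (p : Polynomial ℕ) {a b : ℕ} (h : a ≤ b) : p.eval a ≤ p.eval b := by
  rw [Polynomial.eval_eq_sum_range, Polynomial.eval_eq_sum_range]
  gcongr

theorem length_values {D : Finset ℕ} (s : Assignment D) : s.values.length = D.card := by
  simp [Assignment.values]

open Classical in
-- The number `g = 2 ^ |T| * (|x| + 1)` dominates every size in the computation: the formula, the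
-- table of the team, and the list of all masks.
theorem exists_machine {L : TeamLogic} (hL : L.AtomsPolyTimeCheckable) (m : Semantics) :
    ∃ (M : TM2ComputableAux Letter Bool) (Q : Polynomial ℕ), ∀ x : MCInstance L,
      Nonempty (TM2OutputsInTime M.tm ((encodeMC x).map M.inputAlphabet.invFun)
        (some ((Computability.encodeBool (decide (x.Holds m))).map M.outputAlphabet.invFun))
        (Q.eval (2 ^ x.teamSize * ((encodeMC x).length + 1)))) := by
  obtain ⟨N⟩ := hL
  refine ⟨(Prog.modelCheck m).machine N.toTM2ComputableAux,
    -- The cost in `Exec.modelCheck` with `tokenCost` unfolded, plus the final output step. A query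
    -- consists of a word, variables and rows of length at most `g` each and a separator, whence `3
    -- * X + 1`.
    100 * (.X + 1) ^ 2 + .X * (300 * (.X + 1) ^ 4 + .X * N.time.comp (3 * .X + 1)) + 1,
    fun x => ?_⟩
  obtain ⟨ls, hl, hls, hrows⟩ := exists_list_values x.team
  set g := 2 ^ x.teamSize * ((encodeMC x).length + 1) with hg
  set ns := (x.formula.vars.sort (· ≤ ·)).map Nat.bits with hns
  set rs := ls.map Assignment.values with hrs
  have hrsl : rs.length = ls.length := by simp [hrs]
  have ht : x.teamSize = rs.length := by
    rw [hrsl, MCInstance.teamSize, ← hls, List.toFinset_card_of_nodup hl]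
  have henc : encodeMC x
      = encodeFormula x.formula ++ .sep :: (encodeTagged .var ns ++ encodeTagged .row rs) := by
    rw [encodeMC, encodeTeam_eq, ← hrows]
  have hlen : (encodeMC x).length = (encodeFormula x.formula).length
      + ((encodeTagged .var ns).length + (encodeTagged .row rs).length + 1) := by
    rw [henc]; simp
  have hpow : 0 < 2 ^ x.teamSize := by positivity
  have hle : (encodeMC x).length + 1 ≤ g := Nat.le_mul_of_pos_left _ hpow
  have hrow := length_le_encodeTagged .row rs
  have hmask : 2 ^ rs.length * (rs.length + 1) ≤ g := by
    rw [hg, ht]; gcongr; omega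
  have hb : Bounded ns rs (allMasks rs.length) g := by
    refine ⟨?_, fun z hz => mem_allMasks.1 hz, by omega, by omega, ?_,
      (length_encodeWords_allMasks_le _).trans hmask, by omega⟩
    · simp [hrs, hns, length_values]
    · rw [length_allMasks]
      exact (Nat.le_mul_of_pos_right _ (by omega)).trans hmask
  have hexec := Exec.modelCheck (L := L) (m := m) (O := machineOracle N.toTM2ComputableAux)
    (sat := fun a z => decide (L.AtomSat x.formula.vars (select z ls).toFinset a))
    (τ := N.time.eval (3 * g + 1)) hb x.formula.vars (fun a ha hw z _ => ?_)
    (fun y hy => by rw [hns, hrs, column_values ls hy]; simp) x.formula subset_rfl (by omega) hmask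
  · have hiff := exists_mem_tableOf_iff m hl x.formula subset_rfl
    rw [← hrsl, hls, ← hns, ← hrs] at hiff
    rw [← henc] at hexec
    have hout := Prog.machine_outputs N.toTM2ComputableAux (Prog.modelCheck m) (encodeMC x)
      (decide (x.Holds m)) _ (by
        have hc := hiff.trans (decide_eq_true_iff (p := x.Holds m)).symm
        rw [if_congr hc rfl rfl] at hexec
        exact hexec)
    refine TM2OutputsInTime.mono ?_ hout
    simp [tokenCost]
  · have hquery := N.outputsFun ⟨a, x.formula.vars, (select z ls).toFinset, ha⟩
    have hsel := length_encodeTagged_select_le .row z rs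
    rw [encodeAtomInstance, encodeTeam_select hrows, ← hns, ← hrs] at hquery
    refine TM2OutputsInTime.mono (eval_mono _ ?_) ⟨hquery⟩
    simp only [List.length_append, List.length_cons, List.length_map] at hsel ⊢
    omega

/-- One and the same machine serves for every parameter. It never computes `κ`, which enters only
into the time bound. -/
theorem isFPT_of_teamSize_le {L : TeamLogic} (hL : L.AtomsPolyTimeCheckable) (m : Semantics)
    (κ : MCInstance L → ℕ) {F : ℕ → ℕ} (hF : Primrec F) (h : ∀ x, x.teamSize ≤ F (κ x)) :
    IsFPT (encodeMC (L := L)) (fun x => x.Holds m) κ := by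
  obtain ⟨M, Q, hM⟩ := exists_machine hL m
  refine ⟨M, fun k => (2 ^ F k) ^ Q.natDegree, Q.comp (.X + 1), ?_, fun x => ?_⟩
  · have hpow : Primrec₂ ((· ^ ·) : ℕ → ℕ → ℕ) := Primrec₂.unpaired'.1 Nat.Primrec.pow
    exact (hpow.comp (hpow.comp (.const 2) hF) (.const _)).to_comp
  · refine TM2OutputsInTime.mono ((eval_mul_le Q (by positivity) _).trans ?_) (hM x)
    have : 2 ^ x.teamSize ≤ 2 ^ F (κ x) := Nat.pow_le_pow_right (by omega) (h x)
    simp only [Polynomial.eval_comp, Polynomial.eval_add, Polynomial.eval_X, Polynomial.eval_one]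
    gcongr

/-! ### Bounds for the size of a team -/

section Bounds

variable {L : TeamLogic}

theorem card_team_le {D : Finset ℕ} (T : Team D) : T.card ≤ 2 ^ D.card :=
  (Finset.card_le_univ T).trans (by simp)

namespace Formula

theorem card_vars_le_size (φ : Formula L) : φ.vars.card ≤ φ.size := by
  induction φ with
  | atom a => exact (List.toFinset_card_le _).trans (by simp [size])
  | and φ ψ ihφ ihψ | or φ ψ ihφ ihψ =>
    refine (Finset.card_union_le _ _).trans ?_
    simp only [size]
    omega
  | _ => simp [vars, size]

/-- The step for binary connectives in both depth bounds: one more level at most doubles the number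
of leaves. -/
theorem add_le_mul_two_pow_max {a b c i j : ℕ} (ha : a ≤ c * 2 ^ i) (hb : b ≤ c * 2 ^ j) :
    a + b ≤ c * 2 ^ (max i j + 1) :=
  calc a + b ≤ c * 2 ^ max i j + c * 2 ^ max i j := by
        refine Nat.add_le_add (ha.trans ?_) (hb.trans ?_) <;> gcongr <;> simp
    _ = _ := by ring

theorem card_vars_le_two_pow_depth (φ : Formula L) : φ.vars.card ≤ 2 ^ φ.depth := by
  induction φ with
  | atom a => exact (List.toFinset_card_le _).trans (Nat.le_pow_clog (by omega) _)
  | and φ ψ ihφ ihψ | or φ ψ ihφ ihψ =>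
    rw [← one_mul (2 ^ _)] at ihφ ihψ ⊢
    exact (Finset.card_union_le _ _).trans (add_le_mul_two_pow_max ihφ ihψ)
  | _ => simp [vars, depth]

/-- The factor is `r + 1` and not `r`, because a leaf may also be a variable, even when `r = 0`. -/
theorem card_vars_le_mul_two_pow_leafDepth {r : ℕ} (hr : ∀ a : L.Atom, (L.args a).length ≤ r)
    (φ : Formula L) : φ.vars.card ≤ (r + 1) * 2 ^ φ.leafDepth := by
  induction φ with
  | atom a => exact (List.toFinset_card_le _).trans ((hr a).trans (by simp [leafDepth]))
  | and φ ψ ihφ ihψ | or φ ψ ihφ ihψ =>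
    exact (Finset.card_union_le _ _).trans (add_le_mul_two_pow_max ihφ ihψ)
  | _ => simp [vars, leafDepth]; try omega

theorem finite_subformulas (φ : Formula L) : φ.subformulas.Finite := by
  induction φ with
  | and φ ψ ihφ ihψ | or φ ψ ihφ ihψ => exact (Set.finite_singleton _).union (ihφ.union ihψ)
  | _ => simp [subformulas]

end Formula

end Bounds

/-! ### Complete bipartite subgraphs and tree decompositions -/

section Trees

variable {W : Type} {H : SimpleGraph W}

theorem forall_of_preconnected (h : H.Preconnected) {P : W → Prop}
    (hP : ∀ x y, H.Adj x y → P x → P y) {x : W} (hx : P x) (y : W) : P y := by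
  obtain ⟨p⟩ := h x y
  induction p with
  | nil => exact hx
  | cons hadj _ ih => exact ih (hP _ _ hadj hx)

variable {r : W} {p : ∀ x, H.Walk r x}

/-- Paths in a forest are unique, so of two adjacent nodes one is the parent of the other with
respect to the root `r`. -/
theorem eq_concat_or_eq_concat (hH : H.IsAcyclic) (hp : ∀ x, (p x).IsPath) {x y : W}
    (h : H.Adj x y) : p y = (p x).concat h ∨ p x = (p y).concat h.symm := by
  classical
  have huniq {u v : W} {q q' : H.Walk u v} (hq : q.IsPath) (hq' : q'.IsPath) : q = q' :=
    congrArg Subtype.val ((hH.subsingleton_path u v).elim ⟨q, hq⟩ ⟨q', hq'⟩)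
  by_cases hy : y ∈ (p x).support
  · right
    have e : (p x).dropUntil y hy = .cons h.symm .nil :=
      huniq ((hp x).dropUntil hy) (SimpleGraph.Walk.IsPath.of_adj h.symm)
    rw [← huniq ((hp x).takeUntil hy) (hp y), SimpleGraph.Walk.concat_eq_append, ← e,
      SimpleGraph.Walk.take_spec]
  · exact .inl (huniq (hp y) ((hp x).concat hy h))

/-- Lying below `t` means that `t` is on the path from the root; this cannot change along an edge
that avoids `t`. -/
theorem mem_support_iff_of_adj (hH : H.IsAcyclic) (hp : ∀ x, (p x).IsPath) {x y t : W}
    (h : H.Adj x y) (hx : x ≠ t) (hy : y ≠ t) : t ∈ (p x).support ↔ t ∈ (p y).support := by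
  rcases eq_concat_or_eq_concat hH hp h with e | e <;>
    simp [e, SimpleGraph.Walk.support_concat, hx.symm, hy.symm]

/-- If a subtree with root `t` meets another subtree that does not contain `t`, then the root of
the latter is farther from the root of the tree. -/
theorem length_lt_of_meet (hH : H.IsAcyclic) (hp : ∀ x, (p x).IsPath) {S S' : Set W}
    (hS : (H.induce S).Preconnected) (hS' : (H.induce S').Preconnected) {t y z : W} (ht : t ∈ S)
    (hmin : ∀ x ∈ S, (p t).length ≤ (p x).length) (ht' : t ∉ S') (hy : y ∈ S) (hy' : y ∈ S')
    (hz : z ∈ S') : (p t).length < (p z).length := by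
  classical
  -- All of `S` lies below `t`: the connected set `S` could leave this region only through the
  -- parent of `t`, which is nearer to the root than `hmin` allows.
  have hty : t ∈ (p y).support := by
    refine forall_of_preconnected (P := fun u : S => t ∈ (p u.1).support) hS ?_
      (x := ⟨t, ht⟩) (by simp) ⟨y, hy⟩
    rintro ⟨u, hu⟩ ⟨v, hv⟩ (hadj : H.Adj u v) (htu : t ∈ (p u).support)
    change t ∈ (p v).support
    rcases eq_or_ne v t with rfl | hvt
    · simp
    rcases eq_or_ne u t with rfl | hut
    · rcases eq_concat_or_eq_concat hH hp hadj with e | e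
      · simp [e, SimpleGraph.Walk.support_concat]
      · have := hmin v hv
        rw [e, SimpleGraph.Walk.length_concat] at this
        omega
    · exact (mem_support_iff_of_adj hH hp hadj hut hvt).1 htu
  -- `S'` avoids `t` and has the node `y` below `t`, so all of it lies below `t`, and strictly.
  have htz : t ∈ (p z).support := by
    refine forall_of_preconnected (P := fun u : S' => t ∈ (p u.1).support) hS' ?_
      (x := ⟨y, hy'⟩) hty ⟨z, hz⟩
    rintro ⟨u, hu⟩ ⟨v, hv⟩ (hadj : H.Adj u v) htu
    exact (mem_support_iff_of_adj hH hp hadj (ne_of_mem_of_not_mem hu ht')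
      (ne_of_mem_of_not_mem hv ht')).1 htu
  have hlt := SimpleGraph.Walk.length_takeUntil_lt_length htz (ne_of_mem_of_not_mem hz ht').symm
  have huniq : (p z).takeUntil t htz = p t :=
    congrArg Subtype.val
    ((hH.subsingleton_path r t).elim ⟨_, (hp z).takeUntil htz⟩ ⟨_, hp t⟩)
  rwa [huniq] at hlt

variable {V : Type} {G : SimpleGraph V}

/-- Root the tree and let `top v` be the node nearest to the root whose bag contains `v`. For the
vertex `c` of `A ∪ B` with the deepest top, the bag at `top c` contains the entire opposite side.
Otherwise the subtree of some neighbour would meet that of `c` without containing `top c`, and its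
top would be deeper still. -/
theorem TreeDecomposition.exists_bag_superset (d : TreeDecomposition G) (A B : Finset V)
    (h : ∀ a ∈ A, ∀ b ∈ B, G.Adj a b) : ∃ c ∈ d.bags, A ⊆ c ∨ B ⊆ c := by
  classical
  obtain ⟨r⟩ := d.isTree.connected.nonempty
  choose p hp using fun x => (d.isTree.existsUnique_path r x).exists
  have htop (v : V) : ∃ t : {b // b ∈ d.bags}, v ∈ t.1 ∧
      ∀ x : {b // b ∈ d.bags}, v ∈ x.1 → (p t).length ≤ (p x).length := by
    obtain ⟨b, hb, hv⟩ := d.cover v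
    obtain ⟨t, ht, hmin⟩ := (measure fun x => (p x).length).wf.has_min
      {x : {b // b ∈ d.bags} | v ∈ x.1} ⟨⟨b, hb⟩, hv⟩
    exact ⟨t, ht, fun x hx => not_lt.1 (hmin x hx)⟩
  choose top htop hmin using htop
  have key {a b : V} (hab : G.Adj a b) (hle : (p (top b)).length ≤ (p (top a)).length) :
      b ∈ (top a).1 := by
    by_contra hb
    obtain ⟨y, hy, hay, hby⟩ := d.edge a b hab
    exact (length_lt_of_meet d.isTree.isAcyclic hp (d.connected a).preconnected
      (d.connected b).preconnected (htop a) (hmin a) hb (y := ⟨y, hy⟩) hay hby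
      (htop b)).not_ge hle
  rcases (A ∪ B).eq_empty_or_nonempty with he | hne
  · exact ⟨r.1, r.2, .inl ((Finset.union_eq_empty.1 he).1 ▸ Finset.empty_subset _)⟩
  obtain ⟨c, hc, hmax⟩ := (A ∪ B).exists_max_image (fun v => (p (top v)).length) hne
  refine ⟨(top c).1, (top c).2, ?_⟩
  rcases Finset.mem_union.1 hc with hc | hc
  · exact .inr fun b hb => key (h c hc b hb) (hmax b (Finset.mem_union_right _ hb))
  · exact .inl fun a ha => key (h a ha c hc).symm (hmax a (Finset.mem_union_left _ ha))

/-- The decomposition with a single bag shows that the infimum is over a non-empty set and hence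
attained; the infimum of the empty set would be the default value 0. -/
theorem exists_width_eq_treewidth [Finite V] (G : SimpleGraph V) :
    ∃ d : TreeDecomposition G, d.width = treewidth G := by
  classical
  have := Fintype.ofFinite V
  have hsub : Subsingleton {b : Finset V // b ∈ ({Finset.univ} : Finset (Finset V))} :=
    ⟨fun a b => Subtype.ext ((Finset.mem_singleton.1 a.2).trans (Finset.mem_singleton.1 b.2).symm)⟩
  have hne : Nonempty {b : Finset V // b ∈ ({Finset.univ} : Finset (Finset V))} :=
    ⟨⟨Finset.univ, by simp⟩⟩
  refine Nat.sInf_mem (s := {w : ℕ | ∃ d : TreeDecomposition G, d.width = w}) ⟨_,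
    { bags := {Finset.univ}, tree := ⊥, isTree := ?_, cover := ?_, edge := ?_, connected := ?_ },
    rfl⟩
  · exact .of_subsingleton
  · simp
  · simp
  · intro v
    have : Nonempty {b : {b : Finset V // b ∈ ({Finset.univ} : Finset (Finset V))} | v ∈ b.1} :=
      ⟨⟨⟨Finset.univ, by simp⟩, by simp⟩⟩
    exact ⟨.of_subsingleton⟩

end Trees

/-! ### Team size in terms of treewidth and of the number of variables -/

namespace MCInstance

variable {L : TeamLogic}

theorem finite_carrier (x : MCInstance L) : x.carrier.Finite := by
  refine ((x.formula.finite_subformulas.image Sum.inl).union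
    ((x.formula.vars.finite_toSet.image fun v => Sum.inl (Formula.var v)).union
      (x.team.finite_toSet.image Sum.inr))).subset ?_
  rintro u (⟨ψ, h, rfl⟩ | ⟨v, h, rfl⟩ | ⟨s, h, rfl⟩)
  · exact .inl ⟨ψ, h, rfl⟩
  · exact .inr (.inl ⟨v, h, rfl⟩)
  · exact .inr (.inr ⟨s, h, rfl⟩)

theorem teamSize_le_two_pow_variableCount (x : MCInstance L) :
    x.teamSize ≤ 2 ^ x.variableCount := card_team_le _

theorem teamSize_le_two_pow_treewidth (x : MCInstance L) :
    x.teamSize ≤ 2 ^ (x.formulaTeamTreewidth + 1) := by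
  have := x.finite_carrier.to_subtype
  obtain ⟨d, hd⟩ := exists_width_eq_treewidth x.gaifmanGraph
  have hwidth {c : Finset {u // u ∈ x.carrier}} (hc : c ∈ d.bags) :
      c.card ≤ x.formulaTeamTreewidth + 1 := by
    have := Finset.le_sup (f := Finset.card) hc
    rw [formulaTeamTreewidth, ← hd, TreeDecomposition.width]
    omega
  let f (s : {s // s ∈ x.team}) : {u // u ∈ x.carrier} := ⟨.inr s.1, .inr (.inr ⟨s, s.2, rfl⟩)⟩
  let g (v : {v // v ∈ x.formula.vars}) : {u // u ∈ x.carrier} :=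
    ⟨.inl (.var v.1), .inr (.inl ⟨v, v.2, rfl⟩)⟩
  have hf : Function.Injective f := fun s t h =>
    Subtype.ext (Sum.inr_injective (congrArg Subtype.val h))
  have hg : Function.Injective g := fun s t h =>
    Subtype.ext (Formula.var.inj (Sum.inl_injective (congrArg Subtype.val h)))
  obtain ⟨c, hc, h | h⟩ := d.exists_bag_superset (x.team.attach.map ⟨f, hf⟩)
    (x.formula.vars.attach.map ⟨g, hg⟩) (by
      simp only [Finset.mem_map, Function.Embedding.coeFn_mk]
      rintro _ ⟨s, -, rfl⟩ _ ⟨v, -, rfl⟩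
      refine (SimpleGraph.fromRel_adj _ _ _).2 ⟨fun h => (nomatch congrArg Subtype.val h), .inl ?_⟩
      cases hv : s.1.val v.1
      · exact .isFalse _ _ v.2 hv
      · exact .isTrue _ _ v.2 hv)
  -- All assignments share a bag: the team size itself is at most `tw + 1`.
  · have hcard := (Finset.card_le_card h).trans (hwidth hc)
    rw [Finset.card_map, Finset.card_attach] at hcard
    exact hcard.trans Nat.lt_two_pow_self.le
  -- All variables share a bag: there are at most `tw + 1` of them, and the bound by the number of
  -- variables applies.
  · have hcard := (Finset.card_le_card h).trans (hwidth hc)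
    rw [Finset.card_map, Finset.card_attach] at hcard
    exact x.teamSize_le_two_pow_variableCount.trans (Nat.pow_le_pow_right (by omega) hcard)

theorem teamSize_le_of_card_vars_le (x : MCInstance L) {k : ℕ} (h : x.formula.vars.card ≤ k) :
    x.teamSize ≤ 2 ^ k :=
  x.teamSize_le_two_pow_variableCount.trans (Nat.pow_le_pow_right (by omega) h)

end MCInstance

end TeamSemantics

theorem mainTheorem8 (L : TeamSemantics.TeamLogic) (hL : L.AtomsPolyTimeCheckable) :
    (∀ m : TeamSemantics.Semantics,
      TeamSemantics.IsFPT (TeamSemantics.encodeMC (L := L)) (fun x => x.Holds m)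
        (fun x => x.formulaTeamTreewidth) ∧
      TeamSemantics.IsFPT (TeamSemantics.encodeMC (L := L)) (fun x => x.Holds m)
        (fun x => x.formula.depth) ∧
      TeamSemantics.IsFPT (TeamSemantics.encodeMC (L := L)) (fun x => x.Holds m)
        (fun x => x.variableCount) ∧
      TeamSemantics.IsFPT (TeamSemantics.encodeMC (L := L)) (fun x => x.Holds m)
        (fun x => x.formula.size) ∧
      ∀ r : ℕ, (∀ a : L.Atom, (L.args a).length ≤ r) →
        TeamSemantics.IsFPT (TeamSemantics.encodeMC (L := L)) (fun x => x.Holds m)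
          (fun x => x.formula.leafDepth)) ∧
    (∀ x : TeamSemantics.MCInstance L,
      x.teamSize ≤ 2 ^ (x.formulaTeamTreewidth + 1) ∧
      x.teamSize ≤ 2 ^ 2 ^ x.formula.depth ∧
      x.teamSize ≤ 2 ^ x.variableCount ∧
      x.teamSize ≤ 2 ^ x.formula.size ∧
      ∀ r : ℕ, (∀ a : L.Atom, (L.args a).length ≤ r) →
        x.teamSize ≤ 2 ^ ((r + 1) * 2 ^ x.formula.leafDepth)) := by
  have hbounds (x : TeamSemantics.MCInstance L) := And.intro x.teamSize_le_two_pow_treewidth <|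
    And.intro (x.teamSize_le_of_card_vars_le x.formula.card_vars_le_two_pow_depth) <|
    And.intro x.teamSize_le_two_pow_variableCount <|
    And.intro (x.teamSize_le_of_card_vars_le x.formula.card_vars_le_size) <|
    fun (r : ℕ) (hr : ∀ a : L.Atom, (L.args a).length ≤ r) =>
      x.teamSize_le_of_card_vars_le (x.formula.card_vars_le_mul_two_pow_leafDepth hr)
  have hpow : Primrec fun k : ℕ => 2 ^ k :=
    (Primrec₂.unpaired'.1 Nat.Primrec.pow : Primrec₂ ((· ^ ·) : ℕ → ℕ → ℕ)).comp (.const 2) .id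
  refine ⟨fun m => ⟨?_, ?_, ?_, ?_, fun r hr => ?_⟩, hbounds⟩
  · exact TeamSemantics.isFPT_of_teamSize_le hL m _ (hpow.comp .succ) fun x => (hbounds x).1
  · exact TeamSemantics.isFPT_of_teamSize_le hL m _ (hpow.comp hpow) fun x => (hbounds x).2.1
  · exact TeamSemantics.isFPT_of_teamSize_le hL m _ hpow fun x => (hbounds x).2.2.1
  · exact TeamSemantics.isFPT_of_teamSize_le hL m _ hpow fun x => (hbounds x).2.2.2.1
  · exact TeamSemantics.isFPT_of_teamSize_le hL m _
      (hpow.comp (Primrec.nat_mul.comp (.const (r + 1)) hpow))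
      fun x => (hbounds x).2.2.2.2 r hr
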